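/- **Setting.** Let $\mathcal X=\prod_{i=1}^n\mathcal X_i$ and $\mathcal Y=\prod_{j=1}^m\mathcal Y_j$ be products of Euclidean spaces and consider $\min_x f(x)+g(x)+h(Ax)$, where $A:\mathcal X\to\mathcal Y$ is linear with blocks $A_{j,i}:\mathcal X_i\to\mathcal Y_j$ (real numbers if all blocks are one-dimensional; $\|A_{j,i}\|$ is the operator norm), $g(x)=\sum_i g_i(x_i)$ and $h(y)=\sum_j h_j(y_j)$ with $g_i,h_j$ proper, lower semicontinuous and convex with values in $\mathbb R\cup\{+\infty\}$, and $f:\mathcal X\to\mathbb R$ is convex and differentiable with $f(x+U_i(u))\le f(x)+\langle\nabla_i f(x),u\rangle+\frac{\beta_i}2\|u\|^2$ for all $x\in\mathcal X$, $u\in\mathcal X_i$ and all $i$, where $\beta_i\ge 0$ and $U_i(u)$ has $i$-th block $u$ and all other blocks $0$. Assume $0\in\mathrm{ri}(\mathrm{dom}\,h-A\,\mathrm{dom}\,g)$ and that for every $j$ some block $A_{j,i}$ is nonzero. Let $h^*$ be the Fenchel conjugate of $h$, and let $z_\star=(x_\star,y_\star)$ be any primal-dual solution: $0\in\nabla f(x_\star)+\partial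 g(x_\star)+A^\top y_\star$ and $Ax_\star\in\partial h^*(y_\star)$. Let $p_i>0$, $\sum_i p_i=1$, $\underline p=p_{\min}=\min_ip_i$, $P=\mathrm{diag}(p_i)$, $J(i)=\{j:A_{j,i}\ne0\}$, $\pi_j=\sum_{i:A_{j,i}\neq0}p_i$, $\theta_j=\pi_j/\underline p$; let $\sigma_j,\tau_i>0$ satisfy $$\tau_i<\frac{2p_i-\underline p}{\beta_ip_i+\underline p^{-1}p_i\sum_j\pi_j\sigma_j\|A_{j,i}\|^2}$$ (no upper bound on $\tau_i$ if the denominator is $0$). Diagonal parameters are identified with diagonal matrices, and $\|x\|_W^2=\langle x,Wx\rangle$. For a positive diagonal $W$ let $\mathrm{prox}_{W,\varphi}(x)=\arg\min_u\varphi(u)+\frac12\|u-x\|^2_{W^{-1}}$. Starting from $z_0=(x_0,y_0)$ with $x_0\in\mathrm{dom}\,g$, iterate for $k\ge0$: $\bar y_{k+1}=\mathrm{prox}_{\sigma,h^*}(y_k+\sigma Ax_k)$; $\bar x_{k+1}=\mathrm{prox}_{\tau,g}(x_k-\tau(\nabla f(x_k)+A^\top\bar y_{k+1}))$; draw $i_{k+1}$,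 independently over $k$, with $\mathbb P(i_{k+1}=i)=p_i$; let $x_{k+1}$ be $x_k$ with its block $i_{k+1}$ replaced by that of $\bar x_{k+1}$; and let $y_{k+1}^j=\bar y_{k+1}^j+\sigma_j\theta_j(A(x_{k+1}-x_k))_j$ for $j\in J(i_{k+1})$, $y^j_{k+1}=y^j_k$ otherwise. Let $x_K^{av}=\frac1K\sum_{k=1}^Kx_k$, $K\ge1$. **Constants.** $V(z)=\frac{\underline p}2\|x\|^2_{\tau^{-1}P^{-1}}+\frac{\underline p}2\|y\|^2_{\sigma^{-1}\pi^{-1}}$ for $z=(x,y)$; $C(\tau)_i=\frac{2p_i}{\underline p\tau_i}-\frac1{\tau_i}-p_i\sum_j\pi_j^{-1}\sigma_j\theta_j^2\|A_{j,i}\|^2-\frac{\beta_ip_i}{\underline p}$; $C_{\tau,\tilde V}=\min_iC(\tau)_i\tau_i$; $\Delta_0=(f+g)(x_0)-(f+g)(x_\star)+\langle A^\top y_\star,x_0-x_\star\rangle+V(z_0-z_\star)$; $N=\|2P-\underline p\|=\max_i(2p_i-\underline p)$; $\|\pi^{-1}-I\|=\max_j(\pi_j^{-1}-1)$; $\kappa=\|\tau^{1/2}P^{1/2}A^\top\pi^{-1/2}\sigma^{1/2}\|^2$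 (operator norm); $h^*_{\pi^{-1}-I}(y)=\sum_j(\pi_j^{-1}-1)h_j^*(y^j)$; $$C_{g,2}=N\Big(1+\|P/\underline p\|+\kappa\Big)\frac{2\Delta_0}{\underline pC_{\tau,\tilde V}}+\frac{\Delta_0}{C_{\tau,\tilde V}}+(4+4\kappa)\Delta_0,$$ $$C_{g,5}=(1-\underline p)\Big((f+g)(x_0)-(f+g)(x_\star)+\|A^\top y_\star\|_{\tau P}\sqrt{\tfrac{\Delta_0}{\underline p}}\Big)+\underline p\Big(h^*_{\pi^{-1}-I}(y_0)-h^*_{\pi^{-1}-I}(y_\star)+\tfrac12\|Ax_\star\|^2_{\sigma\pi^{-1}}+\tfrac{\Delta_0}{\underline p}+\tfrac{\Delta_0N}{\underline p^2C_{\tau,\tilde V}}\Big),$$ $$C_{g,6}=(1-\underline p)\sqrt N\Big(\tfrac{4\Delta_0}{\underline p}+2\|y_\star\|^2_{\sigma^{-1}\pi^{-1}}\Big)+\underline p\sqrt N\,\|\pi^{-1}-I\|\Big(\tfrac{4\Delta_0}{\underline p}+2\|x_\star\|^2_{\tau^{-1}P^{-1}}\Big),$$ and $C_s=C_{g,2}+C_{g,5}+C_{g,6}$.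 With $c=2\underline p+2$ let $$C_f=2c\|y_\star-y_0\|_{\sigma^{-1}\pi^{-1}}+2\sqrt{cC_s}+2\sqrt2\,c,\qquad C_o=C_s+\|y_\star\|_{\sigma^{-1}\pi^{-1}}C_f+2c\,\underline p^{-1}V(z_0-z_\star),$$ $$C_l=C_s+c\|x_\star-x_0\|^2_{\tau^{-1}P^{-1}}+4cL_h^2.$$ With $c_1=\frac{3\underline p}2+\underline p\sqrt N\|\pi^{-1}-I\|$ and $c_2=\frac{3\underline p}2+(1-\underline p)\sqrt N$ let $$C_f'=2c_2\sqrt{\|y_\star-y_0\|^2_{\sigma^{-1}\pi^{-1}}+\tfrac{C_s}{c_2}+\tfrac{2c_1}{c_2}}+2c_2\|y_\star-y_0\|_{\sigma^{-1}\pi^{-1}},$$ $$C_o'=C_s+\|y_\star\|_{\sigma^{-1}\pi^{-1}}C_f'+c_1\|x_0-x_\star\|^2_{\tau^{-1}P^{-1}}+c_2\|y_\star-y_0\|^2_{\sigma^{-1}\pi^{-1}},\qquad C_l'=C_s+c_1\|x_\star-x_0\|^2_{\tau^{-1}P^{-1}}+4c_2L_h^2.$$ **Theorem.** For every $K\ge1$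 one has $x_K^{av}\in\mathrm{dom}\,g$, and all random variables below are integrable. 1. If $h=\delta_{\{b\}}$ for some $b\in\mathcal Y$, then $$\mathbb E\big[f(x_K^{av})+g(x_K^{av})-f(x_\star)-g(x_\star)\big]\le\frac{C_o}{\underline pK},\qquad \mathbb E\big[\|Ax_K^{av}-b\|_{\sigma\pi}\big]\le\frac{C_f}{\underline pK},$$ hence also $\mathbb E\|Ax_K^{av}-b\|\le\frac{1}{\sqrt{\min_j\sigma_j\pi_j}}\,\frac{C_f}{\underline pK}$ in the Euclidean norm. The same holds with $(C_o',C_f')$ in place of $(C_o,C_f)$. 2. If $h$ is $L_h$-Lipschitz continuous with respect to $\|\cdot\|_{\sigma\pi}$, and $y_0\in\mathrm{dom}\,h^*$, then $$\mathbb E\big[f(x_K^{av})+g(x_K^{av})+h(Ax_K^{av})-f(x_\star)-g(x_\star)-h(Ax_\star)\big]\le\frac{C_l}{\underline pK},$$ and the same holds with $C_l'$ in place of $C_l$. If $h$ is instead $L_h$-Lipschitz in the Euclidean norm, both bounds hold with $L_h$ replaced by $L_h/\sqrt{\min_j\sigma_j\pi_j}$. -/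

import Mathlib

open MeasureTheory ProbabilityTheory

noncomputable section

namespace PureCD

/-- A product `∏ᵢ ℝ^{d i}` of Euclidean blocks, with its Euclidean (ℓ²) structure. -/
abbrev Blk {k : ℕ} (d : Fin k → ℕ) : Type := PiLp 2 (fun i => EuclideanSpace ℝ (Fin (d i)))

/-- `‖x‖²_w = ∑ᵢ wᵢ ‖xᵢ‖²` for a diagonal weight `w`. -/
def wsq {k : ℕ} {d : Fin k → ℕ} (w : Fin k → ℝ) (x : Blk d) : ℝ := ∑ i, w i * ‖x i‖ ^ 2

/-- `‖x‖_w`. -/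
def wnorm {k : ℕ} {d : Fin k → ℕ} (w : Fin k → ℝ) (x : Blk d) : ℝ := √(wsq w x)

/-- The block vector `U_i(u)`: block `i` is `u` and the other blocks vanish. -/
def U {k : ℕ} (d : Fin k → ℕ) (i : Fin k) (u : EuclideanSpace ℝ (Fin (d i))) : Blk d :=
  WithLp.toLp 2 (Pi.single i u)

/-- Block diagonal operator `x ↦ (wᵢ xᵢ)ᵢ`. -/
def diag {k : ℕ} (d : Fin k → ℕ) (w : Fin k → ℝ) : Blk d →L[ℝ] Blk d :=
  LinearMap.toContinuousLinearMap
    { toFun := fun x => WithLp.toLp 2 (fun i => w i • x i)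
      map_add' := fun x y => by ext i; simp
      map_smul' := fun c x => by ext i; simp [mul_left_comm] }

/-- Proper, lower semicontinuous, convex (convexity through the epigraph), with values in
`ℝ ∪ {+∞}`. -/
structure IsPCC {E : Type*} [AddCommGroup E] [Module ℝ E] [TopologicalSpace E]
    (φ : E → EReal) : Prop where
  ne_bot : ∀ x, φ x ≠ ⊥
  proper : ∃ x, φ x ≠ ⊤
  lsc : LowerSemicontinuous φ
  convex : Convex ℝ {q : E × ℝ | φ q.1 ≤ (q.2 : EReal)}

/-- Effective domain. -/
def dom {E : Type*} (φ : E → EReal) : Set E := {x | φ x ≠ ⊤}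

/-- Fenchel conjugate `φ*(y) = sup_w ⟨w, y⟩ - φ(w)`. -/
def conj {E : Type*} [NormedAddCommGroup E] [InnerProductSpace ℝ E] (φ : E → EReal) (y : E) :
    EReal :=
  ⨆ w : E, ((inner ℝ w y : ℝ) : EReal) - φ w

/-- Convex subdifferential. -/
def subdiff {E : Type*} [NormedAddCommGroup E] [InnerProductSpace ℝ E] (φ : E → EReal) (x : E) :
    Set E :=
  {v | ∀ u, φ x + ((inner ℝ v (u - x) : ℝ) : EReal) ≤ φ u}

/-- `prox_{V,φ}(x) = argmin_u φ(u) + ½ ‖u - x‖²_{V⁻¹}` for a diagonal `V`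
(the minimizer is unique when `V > 0` and `φ` is proper, lsc, convex). -/
def prox {k : ℕ} {d : Fin k → ℕ} (V : Fin k → ℝ) (φ : Blk d → EReal) (x : Blk d) : Blk d :=
  Classical.epsilon fun u =>
    IsMinOn (fun v => φ v + ((1 / 2 * wsq (fun i => (V i)⁻¹) (v - x) : ℝ) : EReal)) Set.univ u

/-- The separable function `x ↦ ∑ᵢ φᵢ(xᵢ)`. -/
def sep {k : ℕ} {d : Fin k → ℕ} (φ : ∀ i, EuclideanSpace ℝ (Fin (d i)) → EReal) (x : Blk d) :
    EReal :=
  ∑ i, φ i (x i)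

/-- The data of `min_x f(x) + g(x) + h(Ax)` with `g = ∑ gᵢ` and `h = ∑ hⱼ` separable, the
coordinatewise smoothness constants `β` of `f`, the sampling probabilities `p`, and the diagonal
step sizes `τ`, `σ`. -/
structure Data {n m : ℕ} (dX : Fin n → ℕ) (dY : Fin m → ℕ) where
  f : Blk dX → ℝ
  g : ∀ i, EuclideanSpace ℝ (Fin (dX i)) → EReal
  h : ∀ j, EuclideanSpace ℝ (Fin (dY j)) → EReal
  A : Blk dX →L[ℝ] Blk dY
  β : Fin n → ℝ
  p : Fin n → ℝ
  τ : Fin n → ℝ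
  σ : Fin m → ℝ

namespace Data

variable {n m : ℕ} {dX : Fin n → ℕ} {dY : Fin m → ℕ} (D : Data dX dY)

/-- `g(x) = ∑ᵢ gᵢ(xᵢ)`. -/
def G : Blk dX → EReal := sep D.g

/-- `h(y) = ∑ⱼ hⱼ(yⱼ)`. -/
def H : Blk dY → EReal := sep D.h

/-- The transpose `Aᵀ`. -/
def At : Blk dY →L[ℝ] Blk dX := ContinuousLinearMap.adjoint D.A

/-- The block `A_{j,i} : 𝒳_i → 𝒴_j`. -/
def block (j : Fin m) (i : Fin n) :
    EuclideanSpace ℝ (Fin (dX i)) →L[ℝ] EuclideanSpace ℝ (Fin (dY j)) :=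
  LinearMap.toContinuousLinearMap
    { toFun := fun u => D.A (U dX i u) j
      map_add' := fun u v => by simp [U, Pi.single_add]
      map_smul' := fun c u => by simp [U, Pi.single_smul] }

/-- `p_min = minᵢ pᵢ`. -/
def pmin : ℝ := ⨅ i, D.p i

open Classical in
/-- `πⱼ = ∑_{i ∈ I(j)} pᵢ`, where `I(j) = {i : A_{j,i} ≠ 0}`. -/
def pi (j : Fin m) : ℝ := ∑ i with D.block j i ≠ 0, D.p i

/-- `θⱼ = πⱼ / p_min`. -/
def θ (j : Fin m) : ℝ := D.pi j / D.pmin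

/-- Standing assumptions on the problem. -/
structure Assumptions : Prop where
  f_convex : ConvexOn ℝ Set.univ D.f
  f_diff : Differentiable ℝ D.f
  β_nonneg : ∀ i, 0 ≤ D.β i
  f_smooth : ∀ (x : Blk dX) (i : Fin n) (u : EuclideanSpace ℝ (Fin (dX i))),
    D.f (x + U dX i u) ≤ D.f x + inner ℝ (gradient D.f x i) u + D.β i / 2 * ‖u‖ ^ 2
  g_pcc : ∀ i, IsPCC (D.g i)
  h_pcc : ∀ j, IsPCC (D.h j)
  slater : (0 : Blk dY) ∈
    intrinsicInterior ℝ {v | ∃ w ∈ dom D.H, ∃ x ∈ dom D.G, v = w - D.A x}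
  /-- Every row of `A` is nonzero, so that every `πⱼ` is positive. -/
  row_ne : ∀ j, ∃ i, D.block j i ≠ 0

/-- Sampling probabilities and step-size rule
`τᵢ < (2pᵢ - p_min) / (βᵢ pᵢ + p_min⁻¹ pᵢ ∑ⱼ πⱼ σⱼ ‖A_{j,i}‖²)`, cleared of its denominator. -/
structure StepRule : Prop where
  p_pos : ∀ i, 0 < D.p i
  p_sum : ∑ i, D.p i = 1
  τ_pos : ∀ i, 0 < D.τ i
  σ_pos : ∀ j, 0 < D.σ j
  τ_lt : ∀ i, D.τ i * (D.β i * D.p i +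
      D.pmin⁻¹ * D.p i * ∑ j, D.pi j * D.σ j * ‖D.block j i‖ ^ 2) < 2 * D.p i - D.pmin

/-- `z = (x, y)` satisfies the KKT conditions
`0 ∈ ∇f(x) + ∂g(x) + Aᵀy` and `0 ∈ Ax - ∂h*(y)`. -/
def IsKKT (z : Blk dX × Blk dY) : Prop :=
  -(gradient D.f z.1 + D.At z.2) ∈ subdiff D.G z.1 ∧ D.A z.1 ∈ subdiff (conj D.H) z.2

/-! ### The algorithm -/

/-- `ȳ_{k+1} = prox_{σ,h*}(y_k + σ A x_k)`. -/
def ybar (z : Blk dX × Blk dY) : Blk dY :=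
  prox D.σ (conj D.H) (z.2 + diag dY D.σ (D.A z.1))

/-- `x̄_{k+1} = prox_{τ,g}(x_k - τ(∇f(x_k) + Aᵀ ȳ_{k+1}))`. -/
def xbar (z : Blk dX × Blk dY) : Blk dX :=
  prox D.τ D.G (z.1 - diag dX D.τ (gradient D.f z.1 + D.At (D.ybar z)))

/-- `x_{k+1}`: block `i` is taken from `x̄_{k+1}`, the other blocks from `x_k`. -/
def xnext (i : Fin n) (z : Blk dX × Blk dY) : Blk dX :=
  WithLp.toLp 2 fun l => if l = i then D.xbar z l else z.1 l

open Classical in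
/-- `y_{k+1}`: block `j` is `ȳ_{k+1}^j + σⱼ θⱼ (A(x_{k+1} - x_k))ⱼ` if `A_{j,i} ≠ 0`, and `y_k^j`
otherwise. -/
def ynext (i : Fin n) (z : Blk dX × Blk dY) : Blk dY :=
  WithLp.toLp 2 fun j =>
    if D.block j i ≠ 0 then D.ybar z j + (D.σ j * D.θ j) • D.A (D.xnext i z - z.1) j else z.2 j

/-- The iterates `z_k = (x_k, y_k)` for the index sequence `i_{k+1} = s k`. -/
def iter (z₀ : Blk dX × Blk dY) (s : ℕ → Fin n) : ℕ → Blk dX × Blk dY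
  | 0 => z₀
  | k + 1 => (D.xnext (s k) (iter z₀ s k), D.ynext (s k) (iter z₀ s k))

/-- `x_K^{av} = (1/K) ∑_{k=1}^K x_k`. -/
def xav (z₀ : Blk dX × Blk dY) (s : ℕ → Fin n) (K : ℕ) : Blk dX :=
  (1 / (K : ℝ)) • ∑ k ∈ Finset.Icc 1 K, (D.iter z₀ s k).1

/-! ### The constants -/

/-- `f(x) + g(x)`, for `x ∈ dom g`. -/
def F (x : Blk dX) : ℝ := D.f x + (D.G x).toReal

/-- Diagonal of `τ⁻¹P⁻¹`. -/
def wx (i : Fin n) : ℝ := (D.τ i)⁻¹ * (D.p i)⁻¹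

/-- Diagonal of `σ⁻¹π⁻¹`. -/
def wy (j : Fin m) : ℝ := (D.σ j)⁻¹ * (D.pi j)⁻¹

/-- Diagonal of `σπ`. -/
def wd (j : Fin m) : ℝ := D.σ j * D.pi j

/-- `V(z) = (p_min/2)‖x‖²_{τ⁻¹P⁻¹} + (p_min/2)‖y‖²_{σ⁻¹π⁻¹}`. -/
def V (z : Blk dX × Blk dY) : ℝ :=
  D.pmin / 2 * wsq D.wx z.1 + D.pmin / 2 * wsq D.wy z.2

/-- `C(τ)ᵢ`. -/
def Cτ (i : Fin n) : ℝ :=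
  2 * D.p i / (D.pmin * D.τ i) - 1 / D.τ i
    - D.p i * ∑ j, (D.pi j)⁻¹ * D.σ j * D.θ j ^ 2 * ‖D.block j i‖ ^ 2
    - D.β i * D.p i / D.pmin

/-- `C_{τ,Ṽ} = minᵢ C(τ)ᵢ τᵢ`. -/
def CτV : ℝ := ⨅ i, D.Cτ i * D.τ i

/-- `Δ₀ = D_p(x₀; z⋆) + V(z₀ - z⋆)`, where
`D_p(x₀; z⋆) = f(x₀) + g(x₀) - f(x⋆) - g(x⋆) + ⟨Aᵀy⋆, x₀ - x⋆⟩`. -/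
def Δ₀ (z₀ zs : Blk dX × Blk dY) : ℝ :=
  D.F z₀.1 - D.F zs.1 + inner ℝ (D.At zs.2) (z₀.1 - zs.1) + D.V (z₀ - zs)

/-- `‖2P - p_min‖`. -/
def N2P : ℝ := ⨆ i, (2 * D.p i - D.pmin)

/-- `‖P / p_min‖`. -/
def NP : ℝ := ⨆ i, D.p i / D.pmin

/-- `‖π⁻¹ - I‖` (every `πⱼ` is at most `1`). -/
def Nπ : ℝ := ⨆ j, ((D.pi j)⁻¹ - 1)

/-- `‖τ^{1/2} P^{1/2} Aᵀ π^{-1/2} σ^{1/2}‖²`, an operator norm. -/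
def κ : ℝ :=
  ‖(diag dX fun i => √(D.τ i * D.p i)) ∘L D.At ∘L (diag dY fun j => √(D.σ j / D.pi j))‖ ^ 2

/-- `C_{g,2}`. -/
def Cg2 (z₀ zs : Blk dX × Blk dY) : ℝ :=
  D.N2P * (1 + D.NP + D.κ) * (2 * D.Δ₀ z₀ zs / (D.pmin * D.CτV))
    + D.Δ₀ z₀ zs / D.CτV + (4 + 4 * D.κ) * D.Δ₀ z₀ zs

/-- `h*_{π⁻¹-I}(y) = ∑ⱼ (πⱼ⁻¹ - 1) hⱼ*(yⱼ)`. -/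
def hγ (y : Blk dY) : ℝ := ∑ j, ((D.pi j)⁻¹ - 1) * (conj (D.h j) (y j)).toReal

/-- `C_{g,5}`. -/
def Cg5 (z₀ zs : Blk dX × Blk dY) : ℝ :=
  (1 - D.pmin) * (D.F z₀.1 - D.F zs.1
      + wnorm (fun i => D.τ i * D.p i) (D.At zs.2) * √(D.Δ₀ z₀ zs / D.pmin))
    + D.pmin * (D.hγ z₀.2 - D.hγ zs.2
      + 1 / 2 * wsq (fun j => D.σ j / D.pi j) (D.A zs.1)
      + D.Δ₀ z₀ zs / D.pmin + D.Δ₀ z₀ zs * D.N2P / (D.pmin ^ 2 * D.CτV))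

/-- `C_{g,6}`. -/
def Cg6 (z₀ zs : Blk dX × Blk dY) : ℝ :=
  (1 - D.pmin) * √D.N2P * (4 * D.Δ₀ z₀ zs / D.pmin + 2 * wsq D.wy zs.2)
    + D.pmin * √D.N2P * D.Nπ * (4 * D.Δ₀ z₀ zs / D.pmin + 2 * wsq D.wx zs.1)

/-- `C_s`. -/
def Cs (z₀ zs : Blk dX × Blk dY) : ℝ := D.Cg2 z₀ zs + D.Cg5 z₀ zs + D.Cg6 z₀ zs

/-- The simple constant `c = 2 p_min + 2`. -/
def c : ℝ := 2 * D.pmin + 2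

/-- `C_f`. -/
def Cf (z₀ zs : Blk dX × Blk dY) : ℝ :=
  2 * D.c * wnorm D.wy (zs.2 - z₀.2) + 2 * √(D.c * D.Cs z₀ zs) + 2 * √2 * D.c

/-- `C_o`. -/
def Co (z₀ zs : Blk dX × Blk dY) : ℝ :=
  D.Cs z₀ zs + wnorm D.wy zs.2 * D.Cf z₀ zs + 2 * D.c * D.pmin⁻¹ * D.V (z₀ - zs)

/-- `C_l`, for the Lipschitz constant `L`. -/
def Cl (z₀ zs : Blk dX × Blk dY) (L : ℝ) : ℝ :=
  D.Cs z₀ zs + D.c * wsq D.wx (zs.1 - z₀.1) + 4 * D.c * L ^ 2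

/-- The sharp `c₁`. -/
def c₁ : ℝ := 3 * D.pmin / 2 + D.pmin * √D.N2P * D.Nπ

/-- The sharp `c₂`. -/
def c₂ : ℝ := 3 * D.pmin / 2 + (1 - D.pmin) * √D.N2P

/-- `C_f`, sharp version. -/
def Cf' (z₀ zs : Blk dX × Blk dY) : ℝ :=
  2 * D.c₂ * √(wsq D.wy (zs.2 - z₀.2) + D.Cs z₀ zs / D.c₂ + 2 * D.c₁ / D.c₂)
    + 2 * D.c₂ * wnorm D.wy (zs.2 - z₀.2)

/-- `C_o`, sharp version. -/
def Co' (z₀ zs : Blk dX × Blk dY) : ℝ :=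
  D.Cs z₀ zs + wnorm D.wy zs.2 * D.Cf' z₀ zs + D.c₁ * wsq D.wx (z₀.1 - zs.1)
    + D.c₂ * wsq D.wy (zs.2 - z₀.2)

/-- `C_l`, sharp version. -/
def Cl' (z₀ zs : Blk dX × Blk dY) (L : ℝ) : ℝ :=
  D.Cs z₀ zs + D.c₁ * wsq D.wx (zs.1 - z₀.1) + 4 * D.c₂ * L ^ 2

end Data

end PureCD

end

/-! The engine is `Data.one_step`. Conditionally on the current iterate, and for every fixed dual
point y, the quantity f + g + ⟨y, A·⟩ plus the distance V to (x⋆, y) satisfies a descent inequality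
with damping 1 - p_min, which releases p_min times a primal-dual gap and a surplus `decr` measuring
both prox displacements. It combines coordinatewise smoothness with the three-point inequalities of
the two prox steps. The factor θⱼ = πⱼ/p_min makes the expected primal-dual coupling cancel, and the
step-size rule says that the remaining coefficient `Cτ` is positive.

The conclusions need a y chosen after seeing the final average, hence depending on the whole sample
path, where conditional expectations no longer apply. However, y enters the Lyapunov function only
through a linear term ⟨y, `lin`⟩ and a quadratic term that does not depend on the draw. The error is
therefore ⟨y, M⟩, where M is a sum of martingale differences `noise`. In these the A-terms cancel
and only the Bernoulli fluctuation of ȳ - y_k survives; its variance is charged to `decr`. The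
deterministic choice y = y⋆ makes the noise centered and both gaps nonnegative, so the expected sum
of `decr` is at most Δ₀ and E‖M‖² ≤ 2 p_min Δ₀. Young's inequality then absorbs M at the price of
p_min ‖y - y₀‖² and Δ₀/2. Telescoping and Jensen give `Data.averaged_gap_le`: p_min K times the
expected gap at the average is at most `gapConst` + c₂ E‖y - y₀‖².

It remains to choose y. For h = δ_{b}, optimizing the quadratic in y bounds the residual, and then y
= y⋆ bounds the objective. For Lipschitz h, y is an almost-subgradient of h at the averaged point,
and dom h* lies in a ball of radius L. The primal comparison point stays at x⋆, so no c₁ term is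
generated: the c₁ terms of the stated constants, like several others, are nonnegative slack. -/

namespace PureCD

open Filter Topology

/-! ### Convex extended-valued functions, tangents and subgradients -/

section Convex

variable {E : Type*} [NormedAddCommGroup E] [InnerProductSpace ℝ E]

/-- Convexity of an extended-valued function in terms of real values. -/
theorem apply_combo_le {φ : E → EReal} (hb : ∀ x, φ x ≠ ⊥)
    (hc : Convex ℝ {q : E × ℝ | φ q.1 ≤ (q.2 : EReal)}) {x u : E} (hx : φ x ≠ ⊤) (hu : φ u ≠ ⊤)
    {a b : ℝ} (ha : 0 ≤ a) (hb' : 0 ≤ b) (hab : a + b = 1) :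
    φ (a • x + b • u) ≤ ((a * (φ x).toReal + b * (φ u).toReal : ℝ) : EReal) := by
  have h1 : (x, (φ x).toReal) ∈ {q : E × ℝ | φ q.1 ≤ (q.2 : EReal)} := by
    simp [EReal.coe_toReal hx (hb x)]
  have h2 : (u, (φ u).toReal) ∈ {q : E × ℝ | φ q.1 ≤ (q.2 : EReal)} := by
    simp [EReal.coe_toReal hu (hb u)]
  have := hc h1 h2 ha hb' hab
  simpa using this

theorem combo_mem_dom {φ : E → EReal} (hb : ∀ x, φ x ≠ ⊥)
    (hc : Convex ℝ {q : E × ℝ | φ q.1 ≤ (q.2 : EReal)}) {x u : E} (hx : φ x ≠ ⊤) (hu : φ u ≠ ⊤)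
    {a b : ℝ} (ha : 0 ≤ a) (hb' : 0 ≤ b) (hab : a + b = 1) : φ (a • x + b • u) ≠ ⊤ :=
  ((apply_combo_le hb hc hx hu ha hb' hab).trans_lt (EReal.coe_lt_top _)).ne

theorem toReal_combo_le {φ : E → EReal} (hb : ∀ x, φ x ≠ ⊥)
    (hc : Convex ℝ {q : E × ℝ | φ q.1 ≤ (q.2 : EReal)}) {x u : E} (hx : φ x ≠ ⊤) (hu : φ u ≠ ⊤)
    {a b : ℝ} (ha : 0 ≤ a) (hb' : 0 ≤ b) (hab : a + b = 1) :
    (φ (a • x + b • u)).toReal ≤ a * (φ x).toReal + b * (φ u).toReal := by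
  have h := EReal.toReal_le_toReal (apply_combo_le hb hc hx hu ha hb' hab) (hb _)
    (EReal.coe_ne_top _)
  rwa [EReal.toReal_coe] at h

theorem convexOn_toReal {φ : E → EReal} (hb : ∀ x, φ x ≠ ⊥)
    (hc : Convex ℝ {q : E × ℝ | φ q.1 ≤ (q.2 : EReal)}) :
    ConvexOn ℝ (dom φ) fun x => (φ x).toReal :=
  ⟨fun _ hx _ hu _ _ ha hb' hab => combo_mem_dom hb hc hx hu ha hb' hab,
    fun _ hx _ hu _ _ ha hb' hab => toReal_combo_le hb hc hx hu ha hb' hab⟩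

/-- A differentiable convex function lies above its tangents. -/
theorem add_inner_gradient_le [CompleteSpace E] {f : E → ℝ} (hf : ConvexOn ℝ Set.univ f)
    (hd : Differentiable ℝ f) (x y : E) : f x + inner ℝ (gradient f x) (y - x) ≤ f y := by
  have hg : HasDerivAt (fun t : ℝ => f (x + t • (y - x))) (inner ℝ (gradient f x) (y - x)) 0 := by
    have h1 : HasDerivAt (fun t : ℝ => x + t • (y - x)) (y - x) 0 := by
      simpa using ((hasDerivAt_id (0 : ℝ)).smul_const (y - x)).const_add x
    have h2 : HasFDerivAt f (InnerProductSpace.toDual ℝ E (gradient f x)) (x + (0 : ℝ) • (y - x)) := by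
      simpa using (hd x).hasGradientAt.hasFDerivAt
    exact h2.comp_hasDerivAt (0 : ℝ) h1
  have ht := hg.tendsto_slope_zero_right
  have : ∀ᶠ t : ℝ in 𝓝[>] 0,
      t⁻¹ • (f (x + (0 + t) • (y - x)) - f (x + (0 : ℝ) • (y - x))) ≤ f y - f x := by
    filter_upwards [Ioo_mem_nhdsGT (zero_lt_one' ℝ)] with t ht
    have h := hf.2 (Set.mem_univ x) (Set.mem_univ y) (by linarith [ht.2] : 0 ≤ 1 - t) ht.1.le
      (by ring)
    have e : (1 - t) • x + t • y = x + (0 + t) • (y - x) := by module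
    rw [e] at h
    simp only [smul_eq_mul, zero_smul, add_zero] at h ⊢
    rw [inv_mul_le_iff₀ ht.1]
    linarith
  linarith [le_of_tendsto ht this]

/-- A subgradient at some point provides an affine minorant. -/
theorem exists_affine_minorant {φ : E → EReal} {x v : E} (hb : ∀ x, φ x ≠ ⊥)
    (hv : v ∈ subdiff φ x) (hx : φ x ≠ ⊤) (u : E) :
    ((inner ℝ v u + ((φ x).toReal - inner ℝ v x) : ℝ) : EReal) ≤ φ u := by
  have := hv u
  rw [← EReal.coe_toReal hx (hb x), ← EReal.coe_add] at this
  refine le_trans (le_of_eq ?_) this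
  congr 1
  rw [inner_sub_right]; ring

theorem mem_dom_of_mem_subdiff {φ : E → EReal} {x v u : E}
    (hv : v ∈ subdiff φ x) (hu : φ u ≠ ⊤) : φ x ≠ ⊤ := by
  intro h
  have := hv u
  rw [h, EReal.top_add_coe] at this
  exact hu (top_le_iff.mp this)

theorem toReal_add_inner_le {φ : E → EReal} (hb : ∀ x, φ x ≠ ⊥) {x v u : E}
    (hv : v ∈ subdiff φ x) (hu : φ u ≠ ⊤) :
    (φ x).toReal + inner ℝ v (u - x) ≤ (φ u).toReal := by
  have hx := mem_dom_of_mem_subdiff hv hu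
  have := hv u
  rw [← EReal.coe_toReal hx (hb x), ← EReal.coe_toReal hu (hb u), ← EReal.coe_add,
    EReal.coe_le_coe_iff] at this
  exact this

end Convex

/-! ### Fenchel conjugates -/

section Conj

variable {E : Type*} [NormedAddCommGroup E] [InnerProductSpace ℝ E] {φ : E → EReal}

theorem conj_ne_bot (hp : ∃ w, φ w ≠ ⊤) (y : E) : conj φ y ≠ ⊥ := by
  obtain ⟨w, hw⟩ := hp
  refine ne_bot_of_le_ne_bot ?_ (le_iSup (fun w : E => ((inner ℝ w y : ℝ) : EReal) - φ w) w)
  intro h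
  rw [sub_eq_add_neg, EReal.add_eq_bot_iff] at h
  rcases h with h | h
  · exact EReal.coe_ne_bot _ h
  · exact hw (by simpa using h)

/-- Fenchel's inequality. -/
theorem inner_le_conj_add (hb : ∀ w, φ w ≠ ⊥) {w y : E} (hw : φ w ≠ ⊤) (hy : conj φ y ≠ ⊤) :
    inner ℝ w y ≤ (conj φ y).toReal + (φ w).toReal := by
  have h := le_iSup (fun w : E => ((inner ℝ w y : ℝ) : EReal) - φ w) w
  have h' : ((inner ℝ w y : ℝ) : EReal) - φ w ≤ conj φ y := h
  rw [← EReal.coe_toReal hw (hb w), ← EReal.coe_toReal hy (conj_ne_bot ⟨w, hw⟩ y),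
    ← EReal.coe_sub, EReal.coe_le_coe_iff] at h'
  linarith

theorem conj_le_coe (hb : ∀ w, φ w ≠ ⊥) {y : E} {a : ℝ}
    (h : ∀ w, φ w ≠ ⊤ → inner ℝ w y - (φ w).toReal ≤ a) : conj φ y ≤ (a : EReal) := by
  refine iSup_le fun w => ?_
  by_cases hw : φ w = ⊤
  · rw [hw, EReal.sub_top]; exact bot_le
  · rw [← EReal.coe_toReal hw (hb w), ← EReal.coe_sub, EReal.coe_le_coe_iff]
    exact h w hw

theorem convex_epigraph_conj (hb : ∀ w, φ w ≠ ⊥) (hp : ∃ w, φ w ≠ ⊤) :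
    Convex ℝ {q : E × ℝ | conj φ q.1 ≤ (q.2 : EReal)} := by
  rintro ⟨x, s⟩ hx ⟨u, t⟩ hu a b ha hb' hab
  have aux : ∀ {y : E} {r : ℝ}, conj φ y ≤ (r : EReal) →
      ∀ w, φ w ≠ ⊤ → inner ℝ w y - (φ w).toReal ≤ r := by
    intro y r h w hw
    have hy : conj φ y ≠ ⊤ := (h.trans_lt (EReal.coe_lt_top _)).ne
    have h1 := inner_le_conj_add hb hw hy
    have h2 := EReal.toReal_le_toReal h (conj_ne_bot hp y) (EReal.coe_ne_top _)
    rw [EReal.toReal_coe] at h2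
    linarith
  refine conj_le_coe hb fun w hw => ?_
  have h1 := aux hx w hw
  have h2 := aux hu w hw
  simp only [Prod.smul_mk, Prod.mk_add_mk, smul_eq_mul, inner_add_right, inner_smul_right]
  have e : (φ w).toReal = a * (φ w).toReal + b * (φ w).toReal := by rw [← add_mul, hab, one_mul]
  rw [e]
  have h3 := mul_le_mul_of_nonneg_left h1 ha
  have h4 := mul_le_mul_of_nonneg_left h2 hb'
  linarith

theorem lowerSemicontinuous_conj (hb : ∀ w, φ w ≠ ⊥) : LowerSemicontinuous (conj φ) := by
  refine lowerSemicontinuous_iSup fun w => Continuous.lowerSemicontinuous ?_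
  by_cases hw : φ w = ⊤
  · simp only [hw, EReal.sub_top]; exact continuous_const
  · rw [← EReal.coe_toReal hw (hb w)]
    simp only [← EReal.coe_sub]
    exact continuous_coe_real_ereal.comp (by fun_prop)

end Conj

/-! ### Weighted norms and existence of proximal points -/

section Weighted

variable {k : ℕ} {d : Fin k → ℕ}

theorem wsq_nonneg {w : Fin k → ℝ} (hw : ∀ i, 0 ≤ w i) (x : Blk d) : 0 ≤ wsq w x :=
  Finset.sum_nonneg fun i _ => mul_nonneg (hw i) (sq_nonneg _)

theorem wsq_neg (w : Fin k → ℝ) (x : Blk d) : wsq w (-x) = wsq w x := by simp [wsq]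

theorem wsq_sub_comm (w : Fin k → ℝ) (x y : Blk d) : wsq w (x - y) = wsq w (y - x) := by
  rw [← wsq_neg, neg_sub]

theorem norm_combo_sq {E : Type*} [NormedAddCommGroup E] [InnerProductSpace ℝ E] (t : ℝ)
    (a b : E) : ‖a + t • (b - a)‖ ^ 2
      = (1 - t) * ‖a‖ ^ 2 + t * ‖b‖ ^ 2 - t * (1 - t) * ‖b - a‖ ^ 2 := by
  rw [norm_add_sq_real, norm_smul, mul_pow, norm_sub_sq_real, inner_smul_right, inner_sub_right,
    real_inner_self_eq_norm_sq, Real.norm_eq_abs, sq_abs, real_inner_comm]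
  ring

theorem wsq_combo (w : Fin k → ℝ) (t : ℝ) (a b : Blk d) :
    wsq w (a + t • (b - a)) = (1 - t) * wsq w a + t * wsq w b - t * (1 - t) * wsq w (b - a) := by
  simp only [wsq, Finset.mul_sum, ← Finset.sum_add_distrib, ← Finset.sum_sub_distrib]
  refine Finset.sum_congr rfl fun i _ => ?_
  have := norm_combo_sq t (a i) (b i)
  simp only [PiLp.add_apply, PiLp.smul_apply, PiLp.sub_apply]
  rw [this]; ring

theorem continuous_wsq (w : Fin k → ℝ) : Continuous (wsq (d := d) w) := by
  unfold wsq
  fun_prop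

theorem norm_sq_eq_sum (x : Blk d) : ‖x‖ ^ 2 = ∑ i, ‖x i‖ ^ 2 := PiLp.norm_sq_eq_of_L2 _ x

theorem inner_eq_sum (x y : Blk d) : inner ℝ x y = ∑ i, inner ℝ (x i) (y i) := PiLp.inner_apply x y

/-- `prox` is a choice, so it has content only once a minimizer exists. The affine minorant plus the
quadratic is coercive, which reduces the problem to a closed ball, where lower semicontinuity and
compactness suffice. -/
theorem isMinOn_prox {V : Fin k → ℝ} (hV : ∀ i, 0 < V i) {φ : Blk d → EReal}
    (hb : ∀ x, φ x ≠ ⊥) (hl : LowerSemicontinuous φ) {v u₀ : Blk d} {c : ℝ}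
    (ha : ∀ u, ((inner ℝ v u + c : ℝ) : EReal) ≤ φ u) (hu₀ : φ u₀ ≠ ⊤) (x : Blk d) :
    IsMinOn (fun u => φ u + ((1 / 2 * wsq (fun i => (V i)⁻¹) (u - x) : ℝ) : EReal)) Set.univ
      (prox V φ x) := by
  unfold prox
  refine Classical.epsilon_spec (p := fun u => IsMinOn (fun u => φ u +
    ((1 / 2 * wsq (fun i => (V i)⁻¹) (u - x) : ℝ) : EReal)) Set.univ u) ?_
  set W : Fin k → ℝ := fun i => (V i)⁻¹ with hW
  set ψ : Blk d → EReal := fun u => φ u + ((1 / 2 * wsq W (u - x) : ℝ) : EReal) with hψ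
  have hψl : LowerSemicontinuous ψ := by
    refine hl.add' (Continuous.lowerSemicontinuous ?_) fun u =>
      EReal.continuousAt_add (.inr (EReal.coe_ne_bot _)) (.inl (hb u))
    exact continuous_coe_real_ereal.comp
      (continuous_const.mul ((continuous_wsq W).comp (continuous_id.sub continuous_const)))
  -- Induction over index sets, started at 1, also covers an empty product, where the weights have
  -- no minimum.
  obtain ⟨δ, hδ, hδW⟩ : ∃ δ > 0, ∀ i, δ ≤ W i := by
    have : ∀ s : Finset (Fin k), ∃ δ > 0, ∀ i ∈ s, δ ≤ W i := by
      intro s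
      induction s using Finset.induction_on with
      | empty => exact ⟨1, one_pos, by simp⟩
      | insert i s _ ih =>
        obtain ⟨δ, h1, h2⟩ := ih
        refine ⟨min δ (W i), lt_min h1 (inv_pos.2 (hV i)), fun j hj => ?_⟩
        rcases Finset.mem_insert.1 hj with rfl | hj
        · exact min_le_right _ _
        · exact (min_le_left _ _).trans (h2 j hj)
    obtain ⟨δ, h1, h2⟩ := this Finset.univ
    exact ⟨δ, h1, fun i => h2 i (Finset.mem_univ i)⟩
  have hlow : ∀ u, ((inner ℝ v x + c - ‖v‖ * ‖u - x‖ + δ / 2 * ‖u - x‖ ^ 2 : ℝ) : EReal) ≤ ψ u := by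
    intro u
    have h1 : δ * ‖u - x‖ ^ 2 ≤ wsq W (u - x) := by
      rw [norm_sq_eq_sum, Finset.mul_sum]
      exact Finset.sum_le_sum fun i _ => mul_le_mul_of_nonneg_right (hδW i) (sq_nonneg _)
    have h2 : inner ℝ v x - ‖v‖ * ‖u - x‖ ≤ inner ℝ v u := by
      have := abs_le.1 (abs_real_inner_le_norm v (u - x))
      rw [inner_sub_right] at this
      linarith [this.1]
    calc _ ≤ (((inner ℝ v u + c) + 1 / 2 * wsq W (u - x) : ℝ) : EReal) := by
          rw [EReal.coe_le_coe_iff]; linarith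
      _ ≤ ψ u := by rw [EReal.coe_add]; exact add_le_add_left (ha u) _
  set M : ℝ := (φ u₀).toReal + 1 / 2 * wsq W (u₀ - x) with hM
  have hM' : ψ u₀ = (M : EReal) := by
    rw [hM, EReal.coe_add, EReal.coe_toReal hu₀ (hb _)]
  -- The ball must contain u₀, and outside it the lower bound (δ/2)r² - ‖v‖r + const must exceed the
  -- value M at u₀. Requiring r ≥ 1 lets the linear term dominate the constants.
  set R : ℝ := max (‖u₀ - x‖) (max 1 (2 / δ * (‖v‖ + |M - c - inner ℝ v x| + 1))) with hR
  obtain ⟨a, -, hamin⟩ := LowerSemicontinuousOn.exists_isMinOn (s := Metric.closedBall x R)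
    ⟨u₀, by rw [Metric.mem_closedBall, dist_eq_norm]; exact le_max_left _ _⟩
    (isCompact_closedBall x R) (hψl.lowerSemicontinuousOn _)
  refine ⟨a, fun u _ => ?_⟩
  have hau₀ : ψ a ≤ ψ u₀ := hamin (by
    rw [Metric.mem_closedBall, dist_eq_norm]; exact le_max_left _ _)
  by_cases hu : u ∈ Metric.closedBall x R
  · exact hamin hu
  · rw [Metric.mem_closedBall, dist_eq_norm, not_le] at hu
    refine hau₀.trans (le_trans ?_ (hlow u))
    rw [hM', EReal.coe_le_coe_iff]
    have h1 : 1 ≤ ‖u - x‖ := ((le_max_left _ _).trans (le_max_right _ _)).trans hu.le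
    have h2 : 2 / δ * (‖v‖ + |M - c - inner ℝ v x| + 1) ≤ ‖u - x‖ :=
      ((le_max_right _ _).trans (le_max_right _ _)).trans hu.le
    have h3 : ‖v‖ + |M - c - inner ℝ v x| + 1 ≤ δ / 2 * ‖u - x‖ := by
      have := mul_le_mul_of_nonneg_left h2 (by positivity : 0 ≤ δ / 2)
      have e : δ / 2 * (2 / δ * (‖v‖ + |M - c - inner ℝ v x| + 1))
        = ‖v‖ + |M - c - inner ℝ v x| + 1 := by field_simp
      linarith
    have h4 := le_abs_self (M - c - inner ℝ v x)
    have h5 := abs_nonneg (M - c - inner ℝ v x)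
    nlinarith

/-- The three-point inequality for a minimizer of a convex function plus a weighted quadratic. -/
theorem three_point_of_isMinOn {w : Fin k → ℝ} {φ : Blk d → EReal} (hb : ∀ x, φ x ≠ ⊥)
    (hc : Convex ℝ {q : Blk d × ℝ | φ q.1 ≤ (q.2 : EReal)}) {x z u : Blk d}
    (hz : IsMinOn (fun u => φ u + ((1 / 2 * wsq w (u - x) : ℝ) : EReal)) Set.univ z)
    (hu : φ u ≠ ⊤) :
    φ z ≠ ⊤ ∧ (φ z).toReal + 1 / 2 * wsq w (z - x) + 1 / 2 * wsq w (u - z)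
      ≤ (φ u).toReal + 1 / 2 * wsq w (u - x) := by
  have hz' : ∀ u, φ z + ((1 / 2 * wsq w (z - x) : ℝ) : EReal)
      ≤ φ u + ((1 / 2 * wsq w (u - x) : ℝ) : EReal) := fun u => hz (Set.mem_univ u)
  have hzt : φ z ≠ ⊤ := by
    intro h
    have := hz' u
    rw [h, EReal.top_add_coe, top_le_iff, ← EReal.coe_toReal hu (hb u), ← EReal.coe_add] at this
    exact EReal.coe_ne_top _ this
  refine ⟨hzt, ?_⟩
  -- Minimality is tested at (1 - t)z + tu. The strong convexity of the quadratic yields the third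
  -- term with a factor 1 - t after division by t; then t → 0.
  have key : ∀ t : ℝ, 0 < t → t ≤ 1 →
      (φ z).toReal + 1 / 2 * wsq w (z - x) + 1 / 2 * (1 - t) * wsq w (u - z)
        ≤ (φ u).toReal + 1 / 2 * wsq w (u - x) := by
    intro t ht ht1
    have h1 := hz' ((1 - t) • z + t • u)
    have h2 := toReal_combo_le hb hc hzt hu (by linarith : 0 ≤ 1 - t) ht.le (by ring)
    have h3 := combo_mem_dom hb hc hzt hu (by linarith : 0 ≤ 1 - t) ht.le (by ring)
    rw [← EReal.coe_toReal hzt (hb z), ← EReal.coe_toReal h3 (hb _), ← EReal.coe_add,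
      ← EReal.coe_add, EReal.coe_le_coe_iff] at h1
    have e : (1 - t) • z + t • u - x = (z - x) + t • ((u - x) - (z - x)) := by module
    rw [e, wsq_combo, sub_sub_sub_cancel_right] at h1
    refine le_of_mul_le_mul_left ?_ ht
    nlinarith
  have hlim : Tendsto (fun t : ℝ => (φ z).toReal + 1 / 2 * wsq w (z - x)
      + 1 / 2 * (1 - t) * wsq w (u - z)) (𝓝[>] 0)
      (𝓝 ((φ z).toReal + 1 / 2 * wsq w (z - x) + 1 / 2 * wsq w (u - z))) := by
    refine Tendsto.mono_left ?_ nhdsWithin_le_nhds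
    have : Continuous (fun t : ℝ => (φ z).toReal + 1 / 2 * wsq w (z - x)
      + 1 / 2 * (1 - t) * wsq w (u - z)) := by fun_prop
    simpa using this.tendsto 0
  refine le_of_tendsto hlim ?_
  filter_upwards [Ioc_mem_nhdsGT (zero_lt_one' ℝ)] with t ht using key t ht.1 ht.2

theorem abs_inner_le_wnorm {w w' : Fin k → ℝ} (hw : ∀ i, 0 ≤ w i) (hw' : ∀ i, 0 ≤ w' i)
    (h : ∀ i, w i * w' i = 1) (x y : Blk d) : |inner ℝ x y| ≤ wnorm w x * wnorm w' y := by
  have h1 : ∀ i, √(w i) * √(w' i) = 1 := fun i => by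
    rw [← Real.sqrt_mul (hw i), h i, Real.sqrt_one]
  have h2 : |inner ℝ x y| ≤ ∑ i, (√(w i) * ‖x i‖) * (√(w' i) * ‖y i‖) := by
    rw [inner_eq_sum]
    refine (Finset.abs_sum_le_sum_abs _ _).trans (Finset.sum_le_sum fun i _ => ?_)
    calc |inner ℝ (x i) (y i)| ≤ ‖x i‖ * ‖y i‖ := abs_real_inner_le_norm _ _
      _ = (√(w i) * √(w' i)) * (‖x i‖ * ‖y i‖) := by rw [h1, one_mul]
      _ = _ := by ring
  refine h2.trans ((Real.sum_mul_le_sqrt_mul_sqrt _ _ _).trans (le_of_eq ?_))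
  simp only [wnorm, wsq, mul_pow, Real.sq_sqrt (hw _), Real.sq_sqrt (hw' _)]

theorem wnorm_nonneg (w : Fin k → ℝ) (x : Blk d) : 0 ≤ wnorm w x := Real.sqrt_nonneg _

theorem sq_wnorm {w : Fin k → ℝ} (hw : ∀ i, 0 ≤ w i) (x : Blk d) : wnorm w x ^ 2 = wsq w x :=
  Real.sq_sqrt (wsq_nonneg hw x)

end Weighted

end PureCD

namespace PureCD

open Filter Topology

/-! ### Separable functions and their conjugates -/

section SumEReal

variable {ι : Type*}

theorem sum_ne_bot {a : ι → EReal} (s : Finset ι) (h : ∀ i ∈ s, a i ≠ ⊥) : ∑ i ∈ s, a i ≠ ⊥ := by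
  classical
  induction s using Finset.induction_on with
  | empty => simp
  | insert i s hi ih =>
    rw [Finset.sum_insert hi, Ne, EReal.add_eq_bot_iff, not_or]
    exact ⟨h i (Finset.mem_insert_self _ _), ih fun j hj => h j (Finset.mem_insert_of_mem hj)⟩

theorem sum_eq_coe {a : ι → EReal} (s : Finset ι) (h : ∀ i ∈ s, a i ≠ ⊥) (h' : ∀ i ∈ s, a i ≠ ⊤) :
    ∑ i ∈ s, a i = ((∑ i ∈ s, (a i).toReal : ℝ) : EReal) := by
  classical
  induction s using Finset.induction_on with
  | empty => simp
  | insert i s hi ih =>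
    rw [Finset.sum_insert hi, Finset.sum_insert hi, EReal.coe_add,
      ih (fun j hj => h j (Finset.mem_insert_of_mem hj))
        (fun j hj => h' j (Finset.mem_insert_of_mem hj)),
      EReal.coe_toReal (h' i (Finset.mem_insert_self _ _)) (h i (Finset.mem_insert_self _ _))]

theorem sum_ne_top_iff {a : ι → EReal} (s : Finset ι) (h : ∀ i ∈ s, a i ≠ ⊥) :
    ∑ i ∈ s, a i ≠ ⊤ ↔ ∀ i ∈ s, a i ≠ ⊤ := by
  classical
  constructor
  · intro hs i hi hit
    rw [← Finset.add_sum_erase s a hi, hit, EReal.top_add_of_ne_bot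
      (sum_ne_bot _ fun j hj => h j (Finset.mem_of_mem_erase hj))] at hs
    exact hs rfl
  · intro h'
    rw [sum_eq_coe s h h']
    exact EReal.coe_ne_top _

end SumEReal

section Sep

variable {k : ℕ} {d : Fin k → ℕ} {φ : ∀ i, EuclideanSpace ℝ (Fin (d i)) → EReal}

theorem sep_ne_bot (h : ∀ i x, φ i x ≠ ⊥) (x : Blk d) : sep φ x ≠ ⊥ :=
  sum_ne_bot _ fun i _ => h i _

theorem sep_ne_top_iff (h : ∀ i x, φ i x ≠ ⊥) (x : Blk d) : sep φ x ≠ ⊤ ↔ ∀ i, φ i (x i) ≠ ⊤ := by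
  simpa [sep] using sum_ne_top_iff Finset.univ (a := fun i => φ i (x i)) fun i _ => h i _

theorem toReal_sep (h : ∀ i x, φ i x ≠ ⊥) {x : Blk d} (hx : ∀ i, φ i (x i) ≠ ⊤) :
    (sep φ x).toReal = ∑ i, (φ i (x i)).toReal := by
  unfold sep
  rw [sum_eq_coe _ (fun i _ => h i _) (fun i _ => hx i), EReal.toReal_coe]

theorem lowerSemicontinuous_sep (h : ∀ i x, φ i x ≠ ⊥) (hl : ∀ i, LowerSemicontinuous (φ i)) :
    LowerSemicontinuous (sep φ) := by
  classical
  have : ∀ s : Finset (Fin k), LowerSemicontinuous fun x : Blk d => ∑ i ∈ s, φ i (x i) := by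
    intro s
    induction s using Finset.induction_on with
    | empty => simpa using lowerSemicontinuous_const
    | insert i s hi ih =>
      simp only [Finset.sum_insert hi]
      refine LowerSemicontinuous.add' ?_ ih fun x => EReal.continuousAt_add
        (.inr (sum_ne_bot _ fun i _ => h i _)) (.inl (h i _))
      exact (hl i).comp (g := fun x : Blk d => x i) (by fun_prop)
  exact this Finset.univ

theorem convex_epigraph_sep (h : ∀ i x, φ i x ≠ ⊥)
    (hc : ∀ i, Convex ℝ {q : EuclideanSpace ℝ (Fin (d i)) × ℝ | φ i q.1 ≤ (q.2 : EReal)}) :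
    Convex ℝ {q : Blk d × ℝ | sep φ q.1 ≤ (q.2 : EReal)} := by
  rintro ⟨x, s⟩ hx ⟨u, t⟩ hu a b ha hb hab
  have aux : ∀ {x : Blk d} {s : ℝ}, sep φ x ≤ (s : EReal) →
      (∀ i, φ i (x i) ≠ ⊤) ∧ ∑ i, (φ i (x i)).toReal ≤ s := by
    intro x s hx
    have h1 := (sep_ne_top_iff h x).1 (hx.trans_lt (EReal.coe_lt_top _)).ne
    refine ⟨h1, ?_⟩
    rw [← toReal_sep h h1]
    have := EReal.toReal_le_toReal hx (sep_ne_bot h x) (EReal.coe_ne_top _)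
    rwa [EReal.toReal_coe] at this
  obtain ⟨hx1, hx2⟩ := aux hx
  obtain ⟨hu1, hu2⟩ := aux hu
  have h3 : ∀ i, φ i ((a • x + b • u) i) ≠ ⊤ := fun i =>
    combo_mem_dom (h i) (hc i) (hx1 i) (hu1 i) ha hb hab
  have h4 : ∀ i, (φ i ((a • x + b • u) i)).toReal
      ≤ a * (φ i (x i)).toReal + b * (φ i (u i)).toReal := fun i =>
    toReal_combo_le (h i) (hc i) (hx1 i) (hu1 i) ha hb hab
  have h5 := Finset.sum_le_sum fun i (_ : i ∈ Finset.univ) => h4 i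
  rw [Finset.sum_add_distrib, ← Finset.mul_sum, ← Finset.mul_sum] at h5
  change sep φ (a • x + b • u) ≤ ((a • s + b • t : ℝ) : EReal)
  rw [← EReal.coe_toReal ((sep_ne_top_iff h _).2 h3) (sep_ne_bot h _), toReal_sep h h3,
    EReal.coe_le_coe_iff, smul_eq_mul, smul_eq_mul]
  have := mul_le_mul_of_nonneg_left hx2 ha
  have := mul_le_mul_of_nonneg_left hu2 hb
  linarith

theorem exists_sep_ne_top (h : ∀ i x, φ i x ≠ ⊥) (hp : ∀ i, ∃ x, φ i x ≠ ⊤) :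
    ∃ x, sep φ x ≠ ⊤ := by
  choose x hx using hp
  exact ⟨WithLp.toLp 2 x, (sep_ne_top_iff h _).2 hx⟩

/-- The conjugate of a separable function is separable. -/
theorem conj_sep (h : ∀ i x, φ i x ≠ ⊥) (hp : ∀ i, ∃ x, φ i x ≠ ⊤) {y : Blk d}
    (hy : conj (sep φ) y ≠ ⊤) :
    (∀ i, conj (φ i) (y i) ≠ ⊤) ∧
      (conj (sep φ) y).toReal = ∑ i, (conj (φ i) (y i)).toReal := by
  classical
  have hH := exists_sep_ne_top h hp
  have key : ∀ w : ∀ i, EuclideanSpace ℝ (Fin (d i)), (∀ i, φ i (w i) ≠ ⊤) →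
      ∑ i, (inner ℝ (w i) (y i) - (φ i (w i)).toReal) ≤ (conj (sep φ) y).toReal := by
    intro w hw
    have := inner_le_conj_add (sep_ne_bot h) (w := WithLp.toLp 2 w) ((sep_ne_top_iff h _).2 hw) hy
    rw [toReal_sep h hw, inner_eq_sum] at this
    rw [Finset.sum_sub_distrib]
    simp only at this
    linarith
  have hfin : ∀ i, conj (φ i) (y i) ≠ ⊤ := by
    intro i
    choose w₀ hw₀ using hp
    -- Freezing the other blocks at points of their domains bounds the i-th supremum by the full
    -- one.
    refine ne_of_lt (lt_of_le_of_lt (conj_le_coe (h i) (a := (conj (sep φ) y).toReal -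
      ∑ l ∈ Finset.univ.erase i, (inner ℝ (w₀ l) (y l) - (φ l (w₀ l)).toReal)) ?_)
      (EReal.coe_lt_top _))
    intro w hw
    have := key (Function.update w₀ i w) fun l => by
      by_cases hl : l = i
      · subst hl; simpa using hw
      · simpa [hl] using hw₀ l
    rw [← Finset.add_sum_erase _ _ (Finset.mem_univ i), Function.update_self] at this
    rw [Finset.sum_congr rfl (g := fun l => inner ℝ (w₀ l) (y l) - (φ l (w₀ l)).toReal)] at this
    · linarith
    · intro l hl
      rw [Function.update_of_ne (Finset.ne_of_mem_erase hl)]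
  refine ⟨hfin, le_antisymm ?_ ?_⟩
  · have := EReal.toReal_le_toReal (conj_le_coe (sep_ne_bot h) (y := y)
      (a := ∑ i, (conj (φ i) (y i)).toReal) fun w hw => ?_) (conj_ne_bot hH y) (EReal.coe_ne_top _)
    · rwa [EReal.toReal_coe] at this
    · have hw' := (sep_ne_top_iff h w).1 hw
      rw [toReal_sep h hw', inner_eq_sum, ← Finset.sum_sub_distrib]
      refine Finset.sum_le_sum fun i _ => ?_
      linarith [inner_le_conj_add (h i) (hw' i) (hfin i)]
  · refine le_of_forall_pos_le_add fun ε hε => ?_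
    -- Near-maximizers are chosen block by block. Dividing by k + 1 instead of k keeps the tolerance
    -- positive when k = 0.
    have hw : ∀ i, ∃ w, φ i w ≠ ⊤ ∧ (conj (φ i) (y i)).toReal - ε / (k + 1)
        ≤ inner ℝ w (y i) - (φ i w).toReal := by
      intro i
      by_contra! hcon
      have h1 := conj_le_coe (h i) fun w hw => (hcon w hw).le
      have h2 := EReal.toReal_le_toReal h1 (conj_ne_bot (hp i) _) (EReal.coe_ne_top _)
      rw [EReal.toReal_coe] at h2
      have : 0 < ε / (k + 1) := by positivity
      linarith
    choose w hw1 hw2 using hw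
    have h1 := key w hw1
    have h2 := Finset.sum_le_sum fun i (_ : i ∈ Finset.univ) => hw2 i
    rw [Finset.sum_sub_distrib] at h2
    have h3 : ∑ _i : Fin k, ε / (k + 1) ≤ ε := by
      rw [Finset.sum_const, Finset.card_univ, Fintype.card_fin, nsmul_eq_mul]
      rw [mul_div_assoc', div_le_iff₀ (by positivity)]
      nlinarith
    linarith

end Sep

namespace Data

variable {n m : ℕ} {dX : Fin n → ℕ} {dY : Fin m → ℕ} {D : Data dX dY}

/-! ### Consequences of the standing assumptions and of the step-size rule -/

namespace Assumptions

theorem G_ne_bot (hD : D.Assumptions) (x : Blk dX) : D.G x ≠ ⊥ :=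
  sep_ne_bot (fun i => (hD.g_pcc i).ne_bot) x

theorem H_ne_bot (hD : D.Assumptions) (y : Blk dY) : D.H y ≠ ⊥ :=
  sep_ne_bot (fun j => (hD.h_pcc j).ne_bot) y

theorem G_convex (hD : D.Assumptions) : Convex ℝ {q : Blk dX × ℝ | D.G q.1 ≤ (q.2 : EReal)} :=
  convex_epigraph_sep (fun i => (hD.g_pcc i).ne_bot) fun i => (hD.g_pcc i).convex

theorem H_convex (hD : D.Assumptions) : Convex ℝ {q : Blk dY × ℝ | D.H q.1 ≤ (q.2 : EReal)} :=
  convex_epigraph_sep (fun i => (hD.h_pcc i).ne_bot) fun i => (hD.h_pcc i).convex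

theorem G_lsc (hD : D.Assumptions) : LowerSemicontinuous D.G :=
  lowerSemicontinuous_sep (fun i => (hD.g_pcc i).ne_bot) fun i => (hD.g_pcc i).lsc

theorem mem_dom_G (hD : D.Assumptions) {x : Blk dX} : x ∈ dom D.G ↔ ∀ i, D.g i (x i) ≠ ⊤ :=
  sep_ne_top_iff (fun i => (hD.g_pcc i).ne_bot) x

theorem toReal_G (hD : D.Assumptions) {x : Blk dX} (hx : x ∈ dom D.G) :
    (D.G x).toReal = ∑ i, (D.g i (x i)).toReal :=
  toReal_sep (fun i => (hD.g_pcc i).ne_bot) (hD.mem_dom_G.1 hx)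

theorem exists_H_ne_top (hD : D.Assumptions) : ∃ w, D.H w ≠ ⊤ :=
  exists_sep_ne_top (fun j => (hD.h_pcc j).ne_bot) fun j => (hD.h_pcc j).proper

theorem conj_H_ne_bot (hD : D.Assumptions) (y : Blk dY) : conj D.H y ≠ ⊥ :=
  conj_ne_bot hD.exists_H_ne_top y

theorem convexOn_F (hD : D.Assumptions) : ConvexOn ℝ (dom D.G) D.F :=
  (hD.f_convex.subset (Set.subset_univ _) (convexOn_toReal hD.G_ne_bot hD.G_convex).1).add
    (convexOn_toReal hD.G_ne_bot hD.G_convex)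

end Assumptions

section Blocks

theorem A_U (D : Data dX dY) (i : Fin n) (u : EuclideanSpace ℝ (Fin (dX i))) (j : Fin m) :
    D.A (U dX i u) j = D.block j i u := rfl

theorem inner_U (x : Blk dX) (i : Fin n) (u : EuclideanSpace ℝ (Fin (dX i))) :
    inner ℝ x (U dX i u) = inner ℝ (x i) u := by
  rw [inner_eq_sum, Finset.sum_eq_single i]
  · simp [U]
  · intro l _ hl; simp [U, hl]
  · simp

theorem inner_At (D : Data dX dY) (y : Blk dY) (x : Blk dX) :
    inner ℝ (D.At y) x = inner ℝ y (D.A x) := ContinuousLinearMap.adjoint_inner_left _ _ _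

theorem norm_At_apply_le (D : Data dX dY) (y : Blk dY) (i : Fin n) :
    ‖D.At y i‖ ≤ ∑ j, ‖D.block j i‖ * ‖y j‖ := by
  have h : ‖D.At y i‖ ^ 2 ≤ (∑ j, ‖D.block j i‖ * ‖y j‖) * ‖D.At y i‖ := by
    rw [← real_inner_self_eq_norm_sq, ← inner_U, inner_At, inner_eq_sum, Finset.sum_mul]
    refine Finset.sum_le_sum fun j _ => ?_
    rw [A_U]
    refine (real_inner_le_norm _ _).trans ?_
    have := (D.block j i).le_opNorm (D.At y i)
    calc _ ≤ ‖y j‖ * (‖D.block j i‖ * ‖D.At y i‖) := by gcongr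
      _ = _ := by ring
  by_contra! hc
  have : 0 < ‖D.At y i‖ :=
    lt_of_le_of_lt (Finset.sum_nonneg fun j _ => by positivity) hc
  nlinarith

end Blocks

namespace StepRule

theorem nonempty (hS : D.StepRule) : Nonempty (Fin n) := by
  by_contra h
  rw [not_nonempty_iff] at h
  have := hS.p_sum
  simp at this

theorem exists_p_eq_pmin (hS : D.StepRule) : ∃ i, D.p i = D.pmin :=
  have := hS.nonempty
  exists_eq_ciInf_of_finite

theorem pmin_le (D : Data dX dY) (i : Fin n) : D.pmin ≤ D.p i :=
  ciInf_le (Set.finite_range _).bddBelow i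

theorem pmin_pos (hS : D.StepRule) : 0 < D.pmin := by
  obtain ⟨i, hi⟩ := hS.exists_p_eq_pmin
  rw [← hi]; exact hS.p_pos i

theorem p_le_one (hS : D.StepRule) (i : Fin n) : D.p i ≤ 1 := by
  rw [← hS.p_sum]
  exact Finset.single_le_sum (fun l _ => (hS.p_pos l).le) (Finset.mem_univ i)

theorem pmin_le_one (hS : D.StepRule) : D.pmin ≤ 1 := by
  obtain ⟨i, hi⟩ := hS.exists_p_eq_pmin
  rw [← hi]; exact hS.p_le_one i

theorem card_mul_pmin_le (hS : D.StepRule) : n * D.pmin ≤ 1 := by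
  rw [← hS.p_sum]
  simpa using Finset.sum_le_sum fun i (_ : i ∈ Finset.univ) => pmin_le D i

theorem pi_pos (hS : D.StepRule) (hD : D.Assumptions) (j : Fin m) : 0 < D.pi j := by
  classical
  obtain ⟨i, hi⟩ := hD.row_ne j
  exact Finset.sum_pos (fun l _ => hS.p_pos l) ⟨i, Finset.mem_filter.2 ⟨Finset.mem_univ i, hi⟩⟩

theorem pi_nonneg (hS : D.StepRule) (j : Fin m) : 0 ≤ D.pi j :=
  Finset.sum_nonneg fun l _ => (hS.p_pos l).le

theorem pi_le_one (hS : D.StepRule) (j : Fin m) : D.pi j ≤ 1 := by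
  classical
  rw [← hS.p_sum]
  exact Finset.sum_le_sum_of_subset_of_nonneg (Finset.filter_subset _ _)
    fun l _ _ => (hS.p_pos l).le

theorem wx_pos (hS : D.StepRule) (i : Fin n) : 0 < D.wx i :=
  mul_pos (inv_pos.2 (hS.τ_pos i)) (inv_pos.2 (hS.p_pos i))

theorem wy_pos (hS : D.StepRule) (hD : D.Assumptions) (j : Fin m) : 0 < D.wy j :=
  mul_pos (inv_pos.2 (hS.σ_pos j)) (inv_pos.2 (hS.pi_pos hD j))

theorem wd_pos (hS : D.StepRule) (hD : D.Assumptions) (j : Fin m) : 0 < D.wd j :=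
  mul_pos (hS.σ_pos j) (hS.pi_pos hD j)

theorem wy_mul_wd (hS : D.StepRule) (hD : D.Assumptions) (j : Fin m) : D.wy j * D.wd j = 1 := by
  have := hS.pi_pos hD j
  have := hS.σ_pos j
  unfold wy wd
  field_simp

theorem le_N2P (D : Data dX dY) (i : Fin n) : 2 * D.p i - D.pmin ≤ D.N2P :=
  le_ciSup (f := fun i => 2 * D.p i - D.pmin) (Set.finite_range _).bddAbove i

theorem pmin_le_N2P (hS : D.StepRule) : D.pmin ≤ D.N2P := by
  obtain ⟨i, hi⟩ := hS.exists_p_eq_pmin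
  have := le_N2P D i
  linarith

theorem N2P_pos (hS : D.StepRule) : 0 < D.N2P := hS.pmin_pos.trans_le hS.pmin_le_N2P

theorem N2P_le_two (hS : D.StepRule) : D.N2P ≤ 2 := by
  have := hS.nonempty
  refine ciSup_le fun i => ?_
  linarith [hS.p_le_one i, hS.pmin_pos]

theorem one_le_NP (hS : D.StepRule) : 1 ≤ D.NP := by
  obtain ⟨i, hi⟩ := hS.exists_p_eq_pmin
  refine le_trans (le_of_eq ?_) (le_ciSup (f := fun i => D.p i / D.pmin)
    (Set.finite_range _).bddAbove i)
  rw [hi, div_self hS.pmin_pos.ne']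

theorem Nπ_nonneg (hS : D.StepRule) (hD : D.Assumptions) : 0 ≤ D.Nπ :=
  Real.iSup_nonneg fun j => by
    have := one_le_inv_iff₀.2 ⟨hS.pi_pos hD j, hS.pi_le_one j⟩
    linarith

/-- Substituting θⱼ = πⱼ/p_min turns πⱼ⁻¹θⱼ² into πⱼ/p_min². Thus `Cτ` is, up to scaling, exactly
the slack in the step-size rule, and its positivity follows. -/
theorem pmin_mul_CτV (hS : D.StepRule) (hD : D.Assumptions) (i : Fin n) :
    D.pmin * (D.Cτ i * D.τ i) = 2 * D.p i - D.pmin - D.τ i * (D.β i * D.p i +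
      D.pmin⁻¹ * D.p i * ∑ j, D.pi j * D.σ j * ‖D.block j i‖ ^ 2) := by
  have h1 := hS.pmin_pos.ne'
  have h2 := (hS.τ_pos i).ne'
  have h3 : ∑ j, (D.pi j)⁻¹ * D.σ j * D.θ j ^ 2 * ‖D.block j i‖ ^ 2
      = (D.pmin ^ 2)⁻¹ * ∑ j, D.pi j * D.σ j * ‖D.block j i‖ ^ 2 := by
    rw [Finset.mul_sum]
    refine Finset.sum_congr rfl fun j _ => ?_
    have := (hS.pi_pos hD j).ne'
    unfold θ
    field_simp
  unfold Cτ
  rw [h3]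
  field_simp
  ring

theorem Cτ_mul_τ_pos (hS : D.StepRule) (hD : D.Assumptions) (i : Fin n) : 0 < D.Cτ i * D.τ i := by
  have h := hS.pmin_mul_CτV hD i
  have h1 := hS.τ_lt i
  refine pos_of_mul_pos_right (a := D.pmin) ?_ hS.pmin_pos.le
  linarith

theorem Cτ_pos (hS : D.StepRule) (hD : D.Assumptions) (i : Fin n) : 0 < D.Cτ i :=
  pos_of_mul_pos_left (hS.Cτ_mul_τ_pos hD i) (hS.τ_pos i).le

theorem CτV_pos (hS : D.StepRule) (hD : D.Assumptions) : 0 < D.CτV := by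
  have := hS.nonempty
  obtain ⟨i, hi⟩ := exists_eq_ciInf_of_finite (f := fun i => D.Cτ i * D.τ i)
  unfold CτV
  rw [← hi]
  exact hS.Cτ_mul_τ_pos hD i

theorem sum_pi_σ_nonneg (hS : D.StepRule) (i : Fin n) :
    0 ≤ ∑ j, D.pi j * D.σ j * ‖D.block j i‖ ^ 2 :=
  Finset.sum_nonneg fun j _ =>
    mul_nonneg (mul_nonneg (hS.pi_nonneg j) (hS.σ_pos j).le) (sq_nonneg _)

/-- At an index attaining p_min the slack is at most 2p_min - p_min. This lets terms divided by
`CτV` dominate the same terms without it. -/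
theorem CτV_le_one (hS : D.StepRule) (hD : D.Assumptions) : D.CτV ≤ 1 := by
  obtain ⟨i, hi⟩ := hS.exists_p_eq_pmin
  refine (ciInf_le (f := fun i => D.Cτ i * D.τ i) (Set.finite_range _).bddBelow i).trans ?_
  have h := hS.pmin_mul_CτV hD i
  have h1 : 0 ≤ D.τ i * (D.β i * D.p i +
      D.pmin⁻¹ * D.p i * ∑ j, D.pi j * D.σ j * ‖D.block j i‖ ^ 2) := by
    have := hS.τ_pos i
    have := hS.p_pos i
    have := hS.pmin_pos
    have := hD.β_nonneg i
    have := hS.sum_pi_σ_nonneg i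
    positivity
  rw [hi] at h h1
  have := hS.pmin_pos
  refine le_of_mul_le_mul_left ?_ this
  linarith

/-- The step-size rule bounds the coupling operator. -/
theorem wsq_At_le (hS : D.StepRule) (hD : D.Assumptions) (y : Blk dY) :
    wsq (fun i => D.τ i * D.p i) (D.At y) ≤ D.N2P * wsq D.wy y := by
  have hy : 0 ≤ wsq D.wy y := wsq_nonneg (fun j => (hS.wy_pos hD j).le) y
  -- Cauchy–Schwarz over j produces precisely the sum in the step-size rule, so each block
  -- contributes at most p_min N ‖y‖². Summing over i costs nothing because n p_min ≤ 1.
  have h1 : ∀ i, ‖D.At y i‖ ^ 2 ≤ (∑ j, D.pi j * D.σ j * ‖D.block j i‖ ^ 2) * wsq D.wy y := by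
    intro i
    have h2 : (∑ j, ‖D.block j i‖ * ‖y j‖) ^ 2
        ≤ (∑ j, D.pi j * D.σ j * ‖D.block j i‖ ^ 2) * ∑ j, D.wy j * ‖y j‖ ^ 2 := by
      refine Finset.sum_sq_le_sum_mul_sum_of_sq_le_mul _ (fun j _ => ?_) (fun j _ => ?_)
        fun j _ => ?_
      · exact mul_nonneg (mul_nonneg (hS.pi_nonneg j) (hS.σ_pos j).le) (sq_nonneg _)
      · exact mul_nonneg (hS.wy_pos hD j).le (sq_nonneg _)
      · have := hS.wy_mul_wd hD j
        unfold wd at this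
        refine le_of_eq ?_
        calc _ = (D.wy j * (D.σ j * D.pi j)) * (‖D.block j i‖ * ‖y j‖) ^ 2 := by rw [this, one_mul]
          _ = _ := by ring
    exact (pow_le_pow_left₀ (norm_nonneg _) (norm_At_apply_le D y i) 2).trans h2
  calc wsq (fun i => D.τ i * D.p i) (D.At y)
      ≤ ∑ _i : Fin n, D.pmin * D.N2P * wsq D.wy y := by
        refine Finset.sum_le_sum fun i _ => ?_
        have hτp : 0 ≤ D.τ i * D.p i := mul_nonneg (hS.τ_pos i).le (hS.p_pos i).le
        refine (mul_le_mul_of_nonneg_left (h1 i) hτp).trans ?_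
        rw [← mul_assoc]
        refine mul_le_mul_of_nonneg_right ?_ hy
        have h3 := hS.τ_lt i
        have h4 := le_N2P D i
        have h5 : 0 ≤ D.τ i * (D.β i * D.p i) :=
          mul_nonneg (hS.τ_pos i).le (mul_nonneg (hD.β_nonneg i) (hS.p_pos i).le)
        have hq := hS.pmin_pos
        have h6 : D.pmin⁻¹ * (D.τ i * D.p i * ∑ j, D.pi j * D.σ j * ‖D.block j i‖ ^ 2) ≤ D.N2P := by
          rw [mul_add] at h3
          have e : D.τ i * (D.pmin⁻¹ * D.p i * ∑ j, D.pi j * D.σ j * ‖D.block j i‖ ^ 2)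
            = D.pmin⁻¹ * (D.τ i * D.p i * ∑ j, D.pi j * D.σ j * ‖D.block j i‖ ^ 2) := by ring
          linarith
        rwa [inv_mul_le_iff₀ hq] at h6
    _ = (n * D.pmin) * (D.N2P * wsq D.wy y) := by
        rw [Finset.sum_const, Finset.card_univ, Fintype.card_fin, nsmul_eq_mul]; ring
    _ ≤ 1 * (D.N2P * wsq D.wy y) :=
        mul_le_mul_of_nonneg_right hS.card_mul_pmin_le (mul_nonneg hS.N2P_pos.le hy)
    _ = _ := one_mul _

theorem wnorm_At_le (hS : D.StepRule) (hD : D.Assumptions) (y : Blk dY) :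
    wnorm (fun i => D.τ i * D.p i) (D.At y) ≤ √D.N2P * wnorm D.wy y := by
  unfold wnorm
  rw [← Real.sqrt_mul hS.N2P_pos.le]
  exact Real.sqrt_le_sqrt (hS.wsq_At_le hD y)

theorem abs_inner_At_le_wnorm (hS : D.StepRule) (a x : Blk dX) :
    |inner ℝ a x| ≤ wnorm (fun i => D.τ i * D.p i) a * wnorm D.wx x := by
  refine abs_inner_le_wnorm (fun i => (mul_pos (hS.τ_pos i) (hS.p_pos i)).le)
    (fun i => (hS.wx_pos i).le) (fun i => ?_) _ _
  have := (hS.τ_pos i).ne'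
  have := (hS.p_pos i).ne'
  unfold wx
  field_simp

theorem abs_inner_At_le (hS : D.StepRule) (hD : D.Assumptions) (y : Blk dY) (x : Blk dX) :
    |inner ℝ (D.At y) x| ≤ √D.N2P * wnorm D.wy y * wnorm D.wx x :=
  (hS.abs_inner_At_le_wnorm _ _).trans
    (mul_le_mul_of_nonneg_right (hS.wnorm_At_le hD y) (wnorm_nonneg _ _))

end StepRule

end Data

end PureCD

namespace PureCD

open Filter Topology

/-! ### Forward-backward steps and the one-step inequality -/

section Weighted

variable {k : ℕ} {d : Fin k → ℕ}

theorem diag_apply (w : Fin k → ℝ) (x : Blk d) (i : Fin k) : diag d w x i = w i • x i := rfl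

theorem wsq_sub_diag {V : Fin k → ℝ} (hV : ∀ i, 0 < V i) (a b : Blk d) :
    wsq (fun i => (V i)⁻¹) (a - diag d V b)
      = wsq (fun i => (V i)⁻¹) a - 2 * inner ℝ b a + wsq V b := by
  simp only [wsq, inner_eq_sum, Finset.mul_sum, ← Finset.sum_add_distrib,
    ← Finset.sum_sub_distrib]
  refine Finset.sum_congr rfl fun i _ => ?_
  have := (hV i).ne'
  rw [PiLp.sub_apply, diag_apply, norm_sub_sq_real, norm_smul, inner_smul_right, real_inner_comm,
    mul_pow, Real.norm_eq_abs, sq_abs]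
  field_simp

theorem wsq_add_U (w : Fin k → ℝ) (a : Blk d) (i : Fin k) (v : EuclideanSpace ℝ (Fin (d i))) :
    wsq w (a + U d i v) = wsq w a + w i * (‖a i + v‖ ^ 2 - ‖a i‖ ^ 2) := by
  have h : ∀ l ∈ Finset.univ.erase i, w l * ‖(a + U d i v) l‖ ^ 2 = w l * ‖a l‖ ^ 2 := by
    intro l hl
    simp [U, Finset.ne_of_mem_erase hl]
  unfold wsq
  rw [← Finset.add_sum_erase _ _ (Finset.mem_univ i), Finset.sum_congr rfl h,
    ← Finset.add_sum_erase _ _ (Finset.mem_univ i)]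
  simp [U]
  ring

/-- First-order characterization of a forward-backward step. -/
theorem prox_sub_diag {V : Fin k → ℝ} (hV : ∀ i, 0 < V i) {φ : Blk d → EReal}
    (hb : ∀ x, φ x ≠ ⊥) (hl : LowerSemicontinuous φ)
    (hc : Convex ℝ {q : Blk d × ℝ | φ q.1 ≤ (q.2 : EReal)}) {v : Blk d} {c : ℝ}
    (ha : ∀ u, ((inner ℝ v u + c : ℝ) : EReal) ≤ φ u) (x b : Blk d) {u : Blk d} (hu : φ u ≠ ⊤) :
    φ (prox V φ (x - diag d V b)) ≠ ⊤ ∧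
      (φ (prox V φ (x - diag d V b))).toReal + inner ℝ b (prox V φ (x - diag d V b) - u)
        + 1 / 2 * wsq (fun i => (V i)⁻¹) (prox V φ (x - diag d V b) - x)
        + 1 / 2 * wsq (fun i => (V i)⁻¹) (u - prox V φ (x - diag d V b))
        ≤ (φ u).toReal + 1 / 2 * wsq (fun i => (V i)⁻¹) (u - x) := by
  obtain ⟨h1, h2⟩ := three_point_of_isMinOn hb hc (isMinOn_prox hV hb hl ha hu (x - diag d V b)) hu
  refine ⟨h1, ?_⟩
  generalize prox V φ (x - diag d V b) = z at *
  have e : ∀ a : Blk d, a - (x - diag d V b) = (a - x) - diag d V (-b) := by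
    intro a; rw [map_neg]; abel
  rw [e, e, wsq_sub_diag hV, wsq_sub_diag hV] at h2
  have e2 : z - u = (z - x) - (u - x) := by abel
  rw [e2, inner_sub_right]
  simp only [inner_neg_left] at h2
  linarith

end Weighted

namespace Data

variable {n m : ℕ} {dX : Fin n → ℕ} {dY : Fin m → ℕ} {D : Data dX dY}

/-- Real-valued conjugate `h*`. -/
noncomputable def hs (D : Data dX dY) (y : Blk dY) : ℝ := (conj D.H y).toReal

/-- The weights `σ⁻¹`. -/
noncomputable def σinv (D : Data dX dY) (j : Fin m) : ℝ := (D.σ j)⁻¹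

theorem xnext_eq (D : Data dX dY) (i : Fin n) (z : Blk dX × Blk dY) :
    D.xnext i z = z.1 + U dX i (D.xbar z i - z.1 i) := by
  ext l a
  by_cases h : l = i
  · subst h; simp [xnext, U]
  · simp [xnext, U, h]

section Prox

variable (hD : D.Assumptions) (hS : D.StepRule)

include hD hS

theorem ybar_spec (z : Blk dX × Blk dY) {y : Blk dY} (hy : conj D.H y ≠ ⊤) :
    conj D.H (D.ybar z) ≠ ⊤ ∧
      D.hs (D.ybar z) - inner ℝ (D.ybar z - y) (D.A z.1) + 1 / 2 * wsq D.σinv (D.ybar z - z.2)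
        + 1 / 2 * wsq D.σinv (D.ybar z - y) ≤ D.hs y + 1 / 2 * wsq D.σinv (z.2 - y) := by
  obtain ⟨w, hw⟩ := hD.exists_H_ne_top
  -- Any point of dom h gives an affine minorant of h*, which is what existence of the proximal
  -- point requires.
  have ha : ∀ u, ((inner ℝ w u + -(D.H w).toReal : ℝ) : EReal) ≤ conj D.H u := by
    intro u
    refine le_trans (le_of_eq ?_) (le_iSup (fun w => ((inner ℝ w u : ℝ) : EReal) - D.H w) w)
    rw [← EReal.coe_toReal hw (hD.H_ne_bot w), ← EReal.coe_sub, ← sub_eq_add_neg, EReal.toReal_coe]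
  have h := prox_sub_diag hS.σ_pos hD.conj_H_ne_bot (lowerSemicontinuous_conj hD.H_ne_bot)
    (convex_epigraph_conj hD.H_ne_bot hD.exists_H_ne_top) ha z.2 (-D.A z.1) hy
  have e : prox D.σ (conj D.H) (z.2 - diag dY D.σ (-D.A z.1)) = D.ybar z := by
    unfold ybar; rw [map_neg, sub_neg_eq_add]
  rw [e] at h
  refine ⟨h.1, ?_⟩
  have h2 := h.2
  rw [inner_neg_left, real_inner_comm, wsq_sub_comm _ y, wsq_sub_comm _ y] at h2
  unfold hs σinv
  linarith

variable {zs : Blk dX × Blk dY} (hzs : D.IsKKT zs)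

include hzs

/-- Since g and the metric are separable, a test point differing from x̄ only in block i localizes
the three-point inequality to that block. The KKT subgradient supplies the affine minorant of g. -/
theorem xbar_spec (z : Blk dX × Blk dY) (hz : z.1 ∈ dom D.G) : D.xbar z ∈ dom D.G ∧
    ∀ (i : Fin n) (u : EuclideanSpace ℝ (Fin (dX i))), D.g i u ≠ ⊤ →
      (D.g i (D.xbar z i)).toReal
        + inner ℝ ((gradient D.f z.1 + D.At (D.ybar z)) i) (D.xbar z i - u)
        + 1 / 2 * ((D.τ i)⁻¹ * ‖D.xbar z i - z.1 i‖ ^ 2)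
        + 1 / 2 * ((D.τ i)⁻¹ * ‖D.xbar z i - u‖ ^ 2)
        ≤ (D.g i u).toReal + 1 / 2 * ((D.τ i)⁻¹ * ‖z.1 i - u‖ ^ 2) := by
  have hs' : D.G zs.1 ≠ ⊤ := mem_dom_of_mem_subdiff hzs.1 hz
  have ha := exists_affine_minorant hD.G_ne_bot hzs.1 hs'
  have h := fun u (hu : D.G u ≠ ⊤) => prox_sub_diag hS.τ_pos hD.G_ne_bot hD.G_lsc hD.G_convex ha z.1
    (gradient D.f z.1 + D.At (D.ybar z)) hu
  change ∀ u, D.G u ≠ ⊤ → D.G (D.xbar z) ≠ ⊤ ∧ (D.G (D.xbar z)).toReal + inner ℝ _ (D.xbar z - u)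
    + 1 / 2 * wsq _ (D.xbar z - z.1) + 1 / 2 * wsq _ (u - D.xbar z) ≤ _ at h
  set b := gradient D.f z.1 + D.At (D.ybar z)
  have hx := (h _ hz).1
  refine ⟨hx, fun i u hu => ?_⟩
  set u' : Blk dX := D.xbar z + U dX i (u - D.xbar z i) with hu'
  have hxi := hD.mem_dom_G.1 hx
  have hu'i : u' i = u := by simp [hu', U]
  have hu'l : ∀ l ∈ Finset.univ.erase i, u' l = D.xbar z l := by
    intro l hl; simp [hu', U, Finset.ne_of_mem_erase hl]
  have hud : u' ∈ dom D.G := by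
    refine hD.mem_dom_G.2 fun l => ?_
    by_cases hl : l = i
    · subst hl; rwa [hu'i]
    · rw [hu'l l (by simp [hl])]; exact hxi l
  have hsu : ∑ l ∈ Finset.univ.erase i, (D.g l (u' l)).toReal
      = ∑ l ∈ Finset.univ.erase i, (D.g l (D.xbar z l)).toReal :=
    Finset.sum_congr rfl fun l hl => by rw [hu'l l hl]
  have h2 := (h _ hud).2
  rw [hD.toReal_G hx, hD.toReal_G hud, ← Finset.add_sum_erase _ _ (Finset.mem_univ i),
    ← Finset.add_sum_erase (a := i) _ (fun l => (D.g l (u' l)).toReal) (Finset.mem_univ i),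
    hsu, hu'i] at h2
  have e1 : D.xbar z - u' = -(U dX i (u - D.xbar z i)) := by rw [hu']; abel
  have e2 : u' - D.xbar z = 0 + U dX i (u - D.xbar z i) := by rw [hu']; abel
  have e3 : u' - z.1 = (D.xbar z - z.1) + U dX i (u - D.xbar z i) := by rw [hu']; abel
  rw [e1, e2, e3, wsq_add_U, wsq_add_U, inner_neg_right, inner_U] at h2
  have e4 : (D.xbar z - z.1) i + (u - D.xbar z i) = -(z.1 i - u) := by
    rw [PiLp.sub_apply]; abel
  have e5 : wsq (fun i => (D.τ i)⁻¹) (0 : Blk dX) = 0 := by simp [wsq]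
  have e6 : D.xbar z i - u = -(u - D.xbar z i) := by abel
  rw [e4, norm_neg, e5] at h2
  rw [e6, inner_neg_right, norm_neg]
  simp only [PiLp.zero_apply, zero_add, norm_zero, PiLp.sub_apply] at h2
  linarith

theorem xnext_mem_dom (i : Fin n) (z : Blk dX × Blk dY) (hz : z.1 ∈ dom D.G) :
    D.xnext i z ∈ dom D.G := by
  have h := hD.mem_dom_G.1 (D.xbar_spec hD hS hzs z hz).1
  refine hD.mem_dom_G.2 fun l => ?_
  by_cases hl : l = i
  · subst hl; simpa [xnext] using h l
  · simpa [xnext, hl] using hD.mem_dom_G.1 hz l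

theorem F_xnext_le (i : Fin n) (z : Blk dX × Blk dY) (hz : z.1 ∈ dom D.G) :
    D.F (D.xnext i z) ≤ D.F z.1 + inner ℝ (gradient D.f z.1 i) (D.xbar z i - z.1 i)
      + D.β i / 2 * ‖D.xbar z i - z.1 i‖ ^ 2
      + ((D.g i (D.xbar z i)).toReal - (D.g i (z.1 i)).toReal) := by
  have h1 := hD.f_smooth z.1 i (D.xbar z i - z.1 i)
  rw [← xnext_eq] at h1
  have h2 : (D.G (D.xnext i z)).toReal = (D.G z.1).toReal +
      ((D.g i (D.xbar z i)).toReal - (D.g i (z.1 i)).toReal) := by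
    rw [hD.toReal_G (D.xnext_mem_dom hD hS hzs i z hz), hD.toReal_G hz,
      ← Finset.add_sum_erase _ _ (Finset.mem_univ i),
      ← Finset.add_sum_erase (a := i) _ (fun l => (D.g l (z.1 l)).toReal) (Finset.mem_univ i),
      Finset.sum_congr rfl (g := fun l => (D.g l (z.1 l)).toReal) (fun l hl => by
        simp [xnext, Finset.ne_of_mem_erase hl])]
    simp [xnext]
    ring
  unfold F
  rw [h2]
  linarith

end Prox

theorem A_xnext_apply (D : Data dX dY) (i : Fin n) (z : Blk dX × Blk dY) (j : Fin m) :
    D.A (D.xnext i z - z.1) j = D.block j i (D.xbar z i - z.1 i) := by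
  rw [xnext_eq, add_sub_cancel_left, A_U]

theorem inner_A_xnext (D : Data dX dY) (y : Blk dY) (i : Fin n) (z : Blk dX × Blk dY) :
    inner ℝ y (D.A (D.xnext i z))
      = inner ℝ y (D.A z.1) + inner ℝ (D.At y i) (D.xbar z i - z.1 i) := by
  rw [xnext_eq, map_add, inner_add_right, ← inner_At, ← inner_At, inner_U]

open Classical in
-- Updated blocks contribute the expansion of ‖ȳ - y + correction‖². Blocks with A_{j,i} = 0
-- contribute neither a correction nor a coupling term, so the cross terms reassemble into the full
-- Aᵀ(ȳ - y) in block i.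
theorem wsq_ynext_le (hD : D.Assumptions) (hS : D.StepRule) (i : Fin n) (z : Blk dX × Blk dY)
    (y : Blk dY) :
    wsq D.wy (D.ynext i z - y) ≤ wsq D.wy (z.2 - y)
      + ∑ j, (if D.block j i ≠ 0 then D.wy j * (‖(D.ybar z - y) j‖ ^ 2 - ‖(z.2 - y) j‖ ^ 2) else 0)
      + 2 / D.pmin * inner ℝ (D.At (D.ybar z - y) i) (D.xbar z i - z.1 i)
      + (∑ j, (D.pi j)⁻¹ * D.σ j * D.θ j ^ 2 * ‖D.block j i‖ ^ 2) * ‖D.xbar z i - z.1 i‖ ^ 2 := by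
  set dx := D.xbar z i - z.1 i with hdx
  have e1 : inner ℝ (D.At (D.ybar z - y) i) dx
      = ∑ j, inner ℝ ((D.ybar z - y) j) (D.block j i dx) := by
    rw [← inner_U, inner_At, inner_eq_sum]; rfl
  rw [e1, Finset.mul_sum, Finset.sum_mul]
  unfold wsq
  rw [← Finset.sum_add_distrib, ← Finset.sum_add_distrib, ← Finset.sum_add_distrib]
  refine Finset.sum_le_sum fun j _ => ?_
  have hπ := hS.pi_pos hD j
  have hσ := hS.σ_pos j
  have hq := hS.pmin_pos
  by_cases hb : D.block j i = 0
  · simp [hb, ynext]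
  · have e2 : (D.ynext i z - y) j = (D.ybar z - y) j + (D.σ j * D.θ j) • D.block j i dx := by
      simp only [PiLp.sub_apply, ynext, ne_eq, hb, not_false_eq_true, if_true]
      rw [← PiLp.sub_apply, ← A_xnext_apply]
      simp only [PiLp.sub_apply, map_sub]
      abel
    rw [e2, norm_add_sq_real, inner_smul_right, norm_smul, mul_pow, Real.norm_eq_abs, sq_abs,
      if_pos hb]
    have h1 : ‖D.block j i dx‖ ^ 2 ≤ ‖D.block j i‖ ^ 2 * ‖dx‖ ^ 2 := by
      rw [← mul_pow]
      exact pow_le_pow_left₀ (norm_nonneg _) ((D.block j i).le_opNorm dx) 2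
    -- This is what θⱼ = πⱼ/p_min is for: the cross-term coefficient becomes the same for all j.
    have h2 : D.wy j * (D.σ j * D.θ j) = 1 / D.pmin := by
      unfold wy θ; field_simp
    have h3 : D.wy j * (D.σ j * D.θ j) ^ 2 = (D.pi j)⁻¹ * D.σ j * D.θ j ^ 2 := by
      unfold wy; field_simp
    have h4 : 0 ≤ (D.pi j)⁻¹ * D.σ j * D.θ j ^ 2 := by positivity
    have h5 := mul_le_mul_of_nonneg_left h1 h4
    have e3 : D.wy j * (‖(D.ybar z - y) j‖ ^ 2
        + 2 * (D.σ j * D.θ j * inner ℝ ((D.ybar z - y) j) (D.block j i dx))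
        + (D.σ j * D.θ j) ^ 2 * ‖D.block j i dx‖ ^ 2)
        = D.wy j * ‖(D.ybar z - y) j‖ ^ 2
        + 2 * (D.wy j * (D.σ j * D.θ j)) * inner ℝ ((D.ybar z - y) j) (D.block j i dx)
        + (D.wy j * (D.σ j * D.θ j) ^ 2) * ‖D.block j i dx‖ ^ 2 := by ring
    rw [e3, h2, h3]
    have e4 : 2 * (1 / D.pmin) = 2 / D.pmin := by ring
    rw [e4]
    linarith

/-- `½ p_min (∑ᵢ C(τ)ᵢ ‖x̄ᵢ - xᵢ‖² + ‖ȳ - y‖²_{σ⁻¹})`. -/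
noncomputable def decr (D : Data dX dY) (z : Blk dX × Blk dY) : ℝ :=
  D.pmin / 2 * wsq D.Cτ (D.xbar z - z.1) + D.pmin / 2 * wsq D.σinv (D.ybar z - z.2)

open Classical in
theorem sum_p_ite (D : Data dX dY) (j : Fin m) (a b : ℝ) (hp : ∑ i, D.p i = 1) :
    ∑ i, D.p i * (if D.block j i ≠ 0 then a else b) = D.pi j * a + (1 - D.pi j) * b := by
  have : ∀ i, D.p i * (if D.block j i ≠ 0 then a else b)
      = (if D.block j i ≠ 0 then D.p i else 0) * (a - b) + D.p i * b := by
    intro i; split_ifs <;> ring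
  simp only [this, Finset.sum_add_distrib, ← Finset.sum_mul, hp]
  rw [← Finset.sum_filter]
  unfold pi
  ring

/-- One step of the method, in conditional expectation, against an arbitrary dual point. -/
theorem one_step (hD : D.Assumptions) (hS : D.StepRule) {zs : Blk dX × Blk dY} (hzs : D.IsKKT zs)
    (z : Blk dX × Blk dY) (hz : z.1 ∈ dom D.G) {y : Blk dY} (hy : conj D.H y ≠ ⊤) :
    ∑ i, D.p i * (D.F (D.xnext i z) + inner ℝ y (D.A (D.xnext i z))
        + D.V ((D.xnext i z, D.ynext i z) - (zs.1, y)))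
      + D.pmin * (D.hs (D.ybar z) - inner ℝ (D.ybar z) (D.A zs.1)) + D.decr z
      ≤ (1 - D.pmin) * (D.F z.1 + inner ℝ y (D.A z.1)) + D.pmin * (D.F zs.1 + D.hs y)
        + D.V (z - (zs.1, y)) := by
  classical
  obtain ⟨hxb, hx⟩ := D.xbar_spec hD hS hzs z hz
  have hsd : zs.1 ∈ dom D.G := mem_dom_of_mem_subdiff hzs.1 hz
  have hq := hS.pmin_pos
  set q := D.pmin with hqdef
  set T : Fin n → ℝ := fun i => ∑ j, (if D.block j i ≠ 0 then
    D.wy j * (‖(D.ybar z - y) j‖ ^ 2 - ‖(z.2 - y) j‖ ^ 2) else 0) with hT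
  set C0 : ℝ := D.F z.1 + inner ℝ y (D.A z.1) + q / 2 * wsq D.wx (z.1 - zs.1)
    + q / 2 * wsq D.wy (z.2 - y) with hC0
  -- The weight pᵢ of the descent estimate is split as p_min + (pᵢ - p_min). The first share uses
  -- the prox inequality at x⋆, the second uses it at the current xᵢ. Together they give (2pᵢ -
  -- p_min)/(2τᵢ) in front of the squared displacement.
  have hi : ∀ i, D.p i * (D.F (D.xnext i z) + inner ℝ y (D.A (D.xnext i z))
        + D.V ((D.xnext i z, D.ynext i z) - (zs.1, y)))
      ≤ D.p i * C0 + (- (q / 2 * (D.Cτ i * ‖(D.xbar z - z.1) i‖ ^ 2))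
        - q * inner ℝ ((gradient D.f z.1 + D.At (D.ybar z)) i) ((z.1 - zs.1) i)
        + q * ((D.g i (zs.1 i)).toReal - (D.g i (z.1 i)).toReal) + q / 2 * (D.p i * T i)) := by
    intro i
    have hp := hS.p_pos i
    have hτ := hS.τ_pos i
    have h1 := D.F_xnext_le hD hS hzs i z hz
    have h2 := D.inner_A_xnext y i z
    have h3 : wsq D.wx (D.xnext i z - zs.1) = wsq D.wx (z.1 - zs.1)
        + D.wx i * (‖D.xbar z i - zs.1 i‖ ^ 2 - ‖z.1 i - zs.1 i‖ ^ 2) := by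
      rw [xnext_eq, add_sub_right_comm, wsq_add_U]
      congr 4
      · rw [PiLp.sub_apply]; abel_nf
    have h4 := D.wsq_ynext_le hD hS i z y
    have h5 := hx i _ (hD.mem_dom_G.1 hsd i)
    have h6 := hx i _ (hD.mem_dom_G.1 hz i)
    set v := (gradient D.f z.1 + D.At (D.ybar z)) i with hv
    set dx := D.xbar z i - z.1 i with hdx
    have ev : inner ℝ v dx = inner ℝ (gradient D.f z.1 i) dx + inner ℝ (D.At (D.ybar z) i) dx := by
      rw [hv, PiLp.add_apply, inner_add_left]
    have ea : inner ℝ (D.At (D.ybar z - y) i) dx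
        = inner ℝ (D.At (D.ybar z) i) dx - inner ℝ (D.At y i) dx := by
      rw [map_sub, PiLp.sub_apply, inner_sub_left]
    have ex : D.xbar z i - zs.1 i = dx + (z.1 - zs.1) i := by
      rw [hdx, PiLp.sub_apply]; abel
    have e5 : inner ℝ v (D.xbar z i - zs.1 i) = inner ℝ v dx + inner ℝ v ((z.1 - zs.1) i) := by
      rw [ex, inner_add_right]
    rw [e5] at h5
    rw [sub_self, norm_zero] at h6
    rw [ea] at h4
    have hpw : D.p i * D.wx i = (D.τ i)⁻¹ := by
      unfold wx; field_simp
    have hC : q / 2 * (D.Cτ i * ‖(D.xbar z - z.1) i‖ ^ 2)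
        = ((2 * D.p i - q) * (1 / 2 * ((D.τ i)⁻¹ * ‖dx‖ ^ 2)) - D.p i * (D.β i / 2 * ‖dx‖ ^ 2)
          - q / 2 * D.p i * ((∑ j, (D.pi j)⁻¹ * D.σ j * D.θ j ^ 2 * ‖D.block j i‖ ^ 2)
            * ‖dx‖ ^ 2)) := by
      rw [PiLp.sub_apply, ← hdx]
      unfold Cτ
      rw [← hqdef]
      field_simp
      ring
    have hV : D.V ((D.xnext i z, D.ynext i z) - (zs.1, y))
        = q / 2 * wsq D.wx (D.xnext i z - zs.1) + q / 2 * wsq D.wy (D.ynext i z - y) := rfl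
    rw [hC, hV, h2, h3, hC0]
    set S := (∑ j, (D.pi j)⁻¹ * D.σ j * D.θ j ^ 2 * ‖D.block j i‖ ^ 2) * ‖dx‖ ^ 2
    have h1' := mul_le_mul_of_nonneg_left h1 hp.le
    have h4' := mul_le_mul_of_nonneg_left h4 (by positivity : 0 ≤ q / 2 * D.p i)
    have h5' := mul_le_mul_of_nonneg_left h5 hq.le
    have h6' := mul_le_mul_of_nonneg_left h6 (sub_nonneg.2 (StepRule.pmin_le D i))
    rw [← hqdef] at h6'
    -- The correction replaces Aᵀy by Aᵀȳ in the coupling with dx, matching the direction used in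
    -- the primal prox step.
    have e7 : q / 2 * D.p i * (2 / q * (inner ℝ (D.At (D.ybar z) i) dx - inner ℝ (D.At y i) dx))
        = D.p i * (inner ℝ (D.At (D.ybar z) i) dx - inner ℝ (D.At y i) dx) := by
      field_simp
    have e8 : D.p i * (q / 2 * (D.wx i * (‖D.xbar z i - zs.1 i‖ ^ 2 - ‖z.1 i - zs.1 i‖ ^ 2)))
        = q / 2 * ((D.τ i)⁻¹ * (‖D.xbar z i - zs.1 i‖ ^ 2 - ‖z.1 i - zs.1 i‖ ^ 2)) := by
      rw [← hpw]; ring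
    simp only [hT]
    rw [ev] at h5' h6'
    linear_combination h1' + h4' + h5' + h6' + e7 + e8
  have hsum := Finset.sum_le_sum fun i (_ : i ∈ Finset.univ) => hi i
  rw [Finset.sum_add_distrib, ← Finset.sum_mul, hS.p_sum, one_mul, Finset.sum_add_distrib,
    Finset.sum_add_distrib, Finset.sum_sub_distrib, Finset.sum_neg_distrib, ← Finset.mul_sum,
    ← Finset.mul_sum, ← Finset.mul_sum, ← Finset.mul_sum, Finset.sum_sub_distrib,
    ← hD.toReal_G hsd, ← hD.toReal_G hz, ← inner_eq_sum] at hsum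
  -- Block j is updated with probability πⱼ, which cancels πⱼ⁻¹ in the dual metric. The result
  -- matches the quadratic terms of the dual prox inequality.
  have hTs : ∑ i, D.p i * T i = wsq D.σinv (D.ybar z - y) - wsq D.σinv (z.2 - y) := by
    simp only [hT, Finset.mul_sum]
    rw [Finset.sum_comm]
    simp only [wsq]
    rw [← Finset.sum_sub_distrib]
    refine Finset.sum_congr rfl fun j _ => ?_
    rw [sum_p_ite D j _ _ hS.p_sum]
    have := (hS.pi_pos hD j).ne'
    have := (hS.σ_pos j).ne'
    unfold wy σinv
    field_simp
    ring
  rw [hTs] at hsum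
  have hyb := (D.ybar_spec hD hS z hy).2
  have hyb' := mul_le_mul_of_nonneg_left hyb hq.le
  have hf := mul_le_mul_of_nonneg_left
    (add_inner_gradient_le hD.f_convex hD.f_diff z.1 zs.1) hq.le
  have e1 : inner ℝ (gradient D.f z.1) (zs.1 - z.1) = - inner ℝ (gradient D.f z.1) (z.1 - zs.1) := by
    rw [← inner_neg_right, neg_sub]
  have e2 : inner ℝ (gradient D.f z.1 + D.At (D.ybar z)) (z.1 - zs.1)
      = inner ℝ (gradient D.f z.1) (z.1 - zs.1)
        + (inner ℝ (D.ybar z) (D.A z.1) - inner ℝ (D.ybar z) (D.A zs.1)) := by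
    rw [inner_add_left, inner_At, map_sub, inner_sub_right (D.ybar z)]
  have e3 : inner ℝ (D.ybar z - y) (D.A z.1)
      = inner ℝ (D.ybar z) (D.A z.1) - inner ℝ y (D.A z.1) := inner_sub_left _ _ _
  rw [e1] at hf
  rw [e2] at hsum
  rw [e3] at hyb'
  have hV : D.V (z - (zs.1, y)) = q / 2 * wsq D.wx (z.1 - zs.1) + q / 2 * wsq D.wy (z.2 - y) := rfl
  have hF : ∀ x, D.F x = D.f x + (D.G x).toReal := fun _ => rfl
  have hw : wsq D.Cτ (D.xbar z - z.1) = ∑ i, D.Cτ i * ‖(D.xbar z - z.1) i‖ ^ 2 := rfl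
  rw [hV]
  unfold decr
  rw [← hw] at hsum
  rw [hC0, hF z.1] at hsum
  rw [hF z.1, hF zs.1]
  linear_combination hsum + hyb' + hf

end Data

end PureCD

namespace PureCD

/-! ### Dependence on the dual test point and its martingale noise -/

namespace Data

variable {n m : ℕ} {dX : Fin n → ℕ} {dY : Fin m → ℕ} {D : Data dX dY}

/-- The coefficient of the dual test point `y` in the Lyapunov function after one step. -/
noncomputable def lin (D : Data dX dY) (z : Blk dX × Blk dY) (i : Fin n) : Blk dY :=
  D.A (D.xnext i z) - D.pmin • diag dY D.wy (D.ynext i z)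

/-- Centered version of `lin`. -/
noncomputable def noise (D : Data dX dY) (z : Blk dX × Blk dY) (i : Fin n) : Blk dY :=
  ∑ l, D.p l • D.lin z l - D.lin z i

theorem wsq_sub_expand (D : Data dX dY) (u y : Blk dY) :
    wsq D.wy (u - y) = wsq D.wy u - 2 * inner ℝ y (diag dY D.wy u) + wsq D.wy y := by
  simp only [wsq, inner_eq_sum, Finset.mul_sum, ← Finset.sum_add_distrib,
    ← Finset.sum_sub_distrib]
  refine Finset.sum_congr rfl fun i _ => ?_
  rw [PiLp.sub_apply, diag_apply, norm_sub_sq_real, inner_smul_right, real_inner_comm]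
  ring

/-- Isolates how y enters after a draw. The only dependence mixing y with the draw is linear, so
even a path-dependent y meets the randomness only through an inner product. -/
theorem V_next_expand (D : Data dX dY) (z : Blk dX × Blk dY) (i : Fin n) (xs : Blk dX)
    (y : Blk dY) :
    inner ℝ y (D.A (D.xnext i z)) + D.V ((D.xnext i z, D.ynext i z) - (xs, y))
      = D.V ((D.xnext i z, D.ynext i z) - (xs, 0)) + inner ℝ y (D.lin z i)
        + D.pmin / 2 * wsq D.wy y := by
  have e : ∀ y, D.V ((D.xnext i z, D.ynext i z) - (xs, y))
      = D.pmin / 2 * wsq D.wx (D.xnext i z - xs) + D.pmin / 2 * wsq D.wy (D.ynext i z - y) :=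
    fun _ => rfl
  rw [e, e, wsq_sub_expand, sub_zero, lin, inner_sub_right, inner_smul_right]
  ring

theorem sum_smul_noise (hS : D.StepRule) (z : Blk dX × Blk dY) :
    ∑ i, D.p i • D.noise z i = 0 := by
  simp only [noise, smul_sub, Finset.sum_sub_distrib, ← Finset.sum_smul, hS.p_sum, one_smul,
    sub_self]

theorem sum_p_inner_noise (hS : D.StepRule) (z : Blk dX × Blk dY) (v : Blk dY) :
    ∑ i, D.p i * inner ℝ v (D.noise z i) = 0 := by
  simp only [← inner_smul_right, ← inner_sum]
  rw [sum_smul_noise hS, inner_zero_right]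

open Classical in
-- The A-increment in x_{k+1} is cancelled exactly by the correction in y_{k+1}, since p_min
-- (σⱼπⱼ)⁻¹ σⱼθⱼ = 1. On blocks that are not updated the increment vanishes. Only the Bernoulli
-- indicator of an update remains random.
theorem lin_apply (hD : D.Assumptions) (hS : D.StepRule) (z : Blk dX × Blk dY) (i : Fin n)
    (j : Fin m) :
    D.lin z i j = D.A z.1 j - (D.pmin * D.wy j) • z.2 j
      - ((if D.block j i ≠ 0 then (1 : ℝ) else 0) * (D.pmin * D.wy j)) • (D.ybar z - z.2) j := by
  have e : D.A (D.xnext i z) j = D.A z.1 j + D.A (D.xnext i z - z.1) j := by simp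
  have e1 : D.lin z i j = D.A (D.xnext i z) j - D.pmin • D.wy j • D.ynext i z j := rfl
  rw [e1, e]
  by_cases hb : D.block j i = 0
  · rw [A_xnext_apply]
    simp [hb, ynext, smul_smul]
  · have := (hS.pi_pos hD j).ne'
    have := (hS.σ_pos j).ne'
    have := hS.pmin_pos.ne'
    have h1 : D.pmin * D.wy j * (D.σ j * D.θ j) = 1 := by
      unfold wy θ; field_simp
    have h2 : D.ynext i z j = D.ybar z j + (D.σ j * D.θ j) • D.A (D.xnext i z - z.1) j := by
      simp [ynext, hb]
    rw [h2, smul_smul, smul_add, smul_smul _ (D.σ j * D.θ j), h1, if_pos hb, PiLp.sub_apply]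
    module

open Classical in
theorem noise_apply (hD : D.Assumptions) (hS : D.StepRule) (z : Blk dX × Blk dY) (i : Fin n)
    (j : Fin m) :
    D.noise z i j = (((if D.block j i ≠ 0 then (1 : ℝ) else 0) - D.pi j) * (D.pmin * D.wy j)) •
      (D.ybar z - z.2) j := by
  have h : D.noise z i j = ∑ l, D.p l • D.lin z l j - D.lin z i j := by
    simp [noise, WithLp.ofLp_sum]
  have hπ : ∑ l, D.p l * (if D.block j l ≠ 0 then (1 : ℝ) else 0) = D.pi j := by
    rw [sum_p_ite D j _ _ hS.p_sum]; ring
  rw [h]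
  simp only [lin_apply hD hS, smul_sub, Finset.sum_sub_distrib, ← Finset.sum_smul, hS.p_sum,
    smul_smul, ← mul_assoc, one_smul]
  simp only [← Finset.sum_mul, hS.p_sum, hπ]
  module

/-- In each block this is the Bernoulli variance πⱼ(1 - πⱼ) in the metric σπ. One factor πⱼ cancels
and 1 - πⱼ ≤ 1 is dropped, leaving a quantity controlled by `decr`. -/
theorem sum_p_wsq_noise_le (hD : D.Assumptions) (hS : D.StepRule) (z : Blk dX × Blk dY) :
    ∑ i, D.p i * wsq D.wd (D.noise z i) ≤ D.pmin ^ 2 * wsq D.σinv (D.ybar z - z.2) := by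
  classical
  simp only [wsq, Finset.mul_sum]
  rw [Finset.sum_comm]
  refine Finset.sum_le_sum fun j _ => ?_
  have hπ := hS.pi_pos hD j
  have hσ := hS.σ_pos j
  have hπ1 := hS.pi_le_one j
  have e : ∀ i, D.p i * (D.wd j * ‖D.noise z i j‖ ^ 2)
      = D.p i * (if D.block j i ≠ 0 then
          D.wd j * ((1 - D.pi j) * (D.pmin * D.wy j)) ^ 2 * ‖(D.ybar z - z.2) j‖ ^ 2 else
          D.wd j * ((0 - D.pi j) * (D.pmin * D.wy j)) ^ 2 * ‖(D.ybar z - z.2) j‖ ^ 2) := by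
    intro i
    rw [noise_apply hD hS, norm_smul, mul_pow, Real.norm_eq_abs, sq_abs]
    split_ifs <;> ring
  simp only [e]
  rw [sum_p_ite D j _ _ hS.p_sum]
  have h2 : D.pi j * (D.wd j * ((1 - D.pi j) * (D.pmin * D.wy j)) ^ 2 *
        ‖(D.ybar z - z.2) j‖ ^ 2)
      + (1 - D.pi j) * (D.wd j * ((0 - D.pi j) * (D.pmin * D.wy j)) ^ 2 *
        ‖(D.ybar z - z.2) j‖ ^ 2)
      = (1 - D.pi j) * (D.pmin ^ 2 * (D.σinv j * ‖(D.ybar z - z.2) j‖ ^ 2)) := by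
    unfold wd wy σinv
    field_simp
    ring
  rw [h2]
  have : 0 ≤ D.pmin ^ 2 * (D.σinv j * ‖(D.ybar z - z.2) j‖ ^ 2) := by
    unfold σinv; positivity
  nlinarith

end Data

/-! ### Expectation over finitely many independent draws -/

section Expectation

variable {n : ℕ} (p : Fin n → ℝ) (i₀ : Fin n) (K : ℕ)

/-- Extension of a finite index sequence by a constant. -/
def extend (i₀ : Fin n) {K : ℕ} (t : Fin K → Fin n) (k : ℕ) : Fin n :=
  if h : k < K then t ⟨k, h⟩ else i₀

/-- Expectation of a function of `K` independent draws with law `p`. -/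
noncomputable def Ex (Φ : (ℕ → Fin n) → ℝ) : ℝ :=
  ∑ t : Fin K → Fin n, (∏ k, p (t k)) * Φ (extend i₀ t)

/-- `Φ s` depends only on `s 0, …, s (k - 1)`. -/
def DependsOnFirst {α : Type*} (k : ℕ) (Φ : (ℕ → Fin n) → α) : Prop :=
  ∀ s s' : ℕ → Fin n, (∀ j < k, s j = s' j) → Φ s = Φ s'

variable {p i₀ K}

theorem Ex_add (Φ Ψ : (ℕ → Fin n) → ℝ) :
    Ex p i₀ K (fun s => Φ s + Ψ s) = Ex p i₀ K Φ + Ex p i₀ K Ψ := by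
  simp [Ex, mul_add, Finset.sum_add_distrib]

theorem Ex_sub (Φ Ψ : (ℕ → Fin n) → ℝ) :
    Ex p i₀ K (fun s => Φ s - Ψ s) = Ex p i₀ K Φ - Ex p i₀ K Ψ := by
  simp [Ex, mul_sub, Finset.sum_sub_distrib]

theorem Ex_const_mul (a : ℝ) (Φ : (ℕ → Fin n) → ℝ) :
    Ex p i₀ K (fun s => a * Φ s) = a * Ex p i₀ K Φ := by
  simp [Ex, Finset.mul_sum, mul_left_comm]

theorem Ex_sum {ι : Type*} (S : Finset ι) (Φ : ι → (ℕ → Fin n) → ℝ) :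
    Ex p i₀ K (fun s => ∑ k ∈ S, Φ k s) = ∑ k ∈ S, Ex p i₀ K (Φ k) := by
  simp only [Ex, Finset.mul_sum]
  rw [Finset.sum_comm]

theorem Ex_const (hp : ∑ i, p i = 1) (a : ℝ) : Ex p i₀ K (fun _ => a) = a := by
  unfold Ex
  rw [← Finset.sum_mul, ← Fintype.sum_pow, hp, one_pow, one_mul]

theorem Ex_mono (hp : ∀ i, 0 ≤ p i) {Φ Ψ : (ℕ → Fin n) → ℝ} (h : ∀ s, Φ s ≤ Ψ s) :
    Ex p i₀ K Φ ≤ Ex p i₀ K Ψ :=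
  Finset.sum_le_sum fun _ _ =>
    mul_le_mul_of_nonneg_left (h _) (Finset.prod_nonneg fun _ _ => hp _)

theorem Ex_nonneg (hp : ∀ i, 0 ≤ p i) {Φ : (ℕ → Fin n) → ℝ} (h : ∀ s, 0 ≤ Φ s) :
    0 ≤ Ex p i₀ K Φ :=
  Finset.sum_nonneg fun _ _ => mul_nonneg (Finset.prod_nonneg fun _ _ => hp _) (h _)

theorem sq_Ex_le (hp : ∀ i, 0 ≤ p i) (hp1 : ∑ i, p i = 1) (Φ : (ℕ → Fin n) → ℝ) :
    Ex p i₀ K Φ ^ 2 ≤ Ex p i₀ K (fun s => Φ s ^ 2) := by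
  have h : 0 ≤ Ex p i₀ K (fun s => (Φ s ^ 2 - 2 * Ex p i₀ K Φ * Φ s) + Ex p i₀ K Φ ^ 2) :=
    Ex_nonneg hp fun s => by nlinarith [sq_nonneg (Φ s - Ex p i₀ K Φ)]
  rw [Ex_add, Ex_sub, Ex_const_mul, Ex_const hp1] at h
  nlinarith

/-- The tower property. -/
theorem Ex_tower (hp1 : ∑ i, p i = 1) {k : ℕ} (hk : k < K) {ψ : (ℕ → Fin n) → Fin n → ℝ}
    (hψ : DependsOnFirst k ψ) :
    Ex p i₀ K (fun s => ψ s (s k)) = Ex p i₀ K (fun s => ∑ i, p i * ψ s i) := by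
  classical
  unfold Ex
  set k' : Fin K := ⟨k, hk⟩ with hk'
  set e := Equiv.funSplitAt k' (Fin n) with he
  have h1 : ∀ (a : Fin n) (r : {j // j ≠ k'} → Fin n),
      ∏ j, p (e.symm (a, r) j) = p a * ∏ j, p (r j) := by
    intro a r
    rw [Fintype.prod_eq_mul_prod_subtype_ne _ k']
    congr 1
    · simp [he]
    · refine Finset.prod_congr rfl fun j _ => ?_
      simp [he, j.2]
  -- Changing coordinate k does not affect the integrand's past, so the product law can be summed
  -- over that coordinate first.
  have h2 : ∀ (a : Fin n) (r : {j // j ≠ k'} → Fin n),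
      ψ (extend i₀ (e.symm (a, r))) = ψ (extend i₀ (e.symm (i₀, r))) := by
    intro a r
    refine hψ _ _ fun j hj => ?_
    have hjK : j < K := hj.trans hk
    have hne : (⟨j, hjK⟩ : Fin K) ≠ k' := by
      intro h; rw [hk', Fin.mk.injEq] at h; omega
    simp [extend, hjK, he, hne]
  have h3 : ∀ (a : Fin n) (r : {j // j ≠ k'} → Fin n), extend i₀ (e.symm (a, r)) k = a := by
    intro a r
    simp [extend, hk, he, hk']
  rw [← e.symm.sum_comp, ← e.symm.sum_comp, Fintype.sum_prod_type_right, Fintype.sum_prod_type_right]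
  refine Finset.sum_congr rfl fun r _ => ?_
  simp only [h1, h2, h3]
  rw [← Finset.sum_mul, ← Finset.sum_mul, hp1, one_mul, Finset.mul_sum]
  refine Finset.sum_congr rfl fun a _ => by ring

theorem DependsOnFirst.mono {α : Type*} {k l : ℕ} (hkl : k ≤ l) {Φ : (ℕ → Fin n) → α}
    (h : DependsOnFirst k Φ) : DependsOnFirst l Φ :=
  fun s s' hs => h s s' fun j hj => hs j (hj.trans_le hkl)

end Expectation

namespace Data

variable {n m : ℕ} {dX : Fin n → ℕ} {dY : Fin m → ℕ}

theorem dependsOnFirst_iter (D : Data dX dY) (z₀ : Blk dX × Blk dY) (k : ℕ) :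
    DependsOnFirst k fun s => D.iter z₀ s k := by
  induction k with
  | zero => intro s s' _; rfl
  | succ k ih =>
    intro s s' h
    have h1 : D.iter z₀ s k = D.iter z₀ s' k := ih s s' fun j hj => h j (by omega)
    simp only [iter, h1, h k (Nat.lt_succ_self k)]

theorem dependsOnFirst_xav (D : Data dX dY) (z₀ : Blk dX × Blk dY) (K : ℕ) :
    DependsOnFirst K fun s => D.xav z₀ s K := by
  intro s s' h
  simp only [xav]
  congr 1
  refine Finset.sum_congr rfl fun k hk => ?_
  exact congrArg Prod.fst
    (((D.dependsOnFirst_iter z₀ k).mono (Finset.mem_Icc.1 hk).2) s s' h)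

end Data

end PureCD

namespace PureCD

/-! ### Telescoping and moment bounds -/

namespace Data

variable {n m : ℕ} {dX : Fin n → ℕ} {dY : Fin m → ℕ} {D : Data dX dY}

theorem iter_mem_dom (hD : D.Assumptions) (hS : D.StepRule) {zs : Blk dX × Blk dY}
    (hzs : D.IsKKT zs) {z₀ : Blk dX × Blk dY} (hx₀ : z₀.1 ∈ dom D.G) (s : ℕ → Fin n) (k : ℕ) :
    (D.iter z₀ s k).1 ∈ dom D.G := by
  induction k with
  | zero => exact hx₀
  | succ k ih => exact D.xnext_mem_dom hD hS hzs _ _ ih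

theorem xav_eq (D : Data dX dY) (z₀ : Blk dX × Blk dY) (s : ℕ → Fin n) (K : ℕ) :
    D.xav z₀ s K = ∑ k ∈ Finset.range K, (1 / (K : ℝ)) • (D.iter z₀ s (k + 1)).1 := by
  unfold xav
  rw [Finset.smul_sum, Finset.range_eq_Ico, Finset.sum_Ico_add' (fun k =>
    (1 / (K : ℝ)) • (D.iter z₀ s k).1) 0 K 1]
  rfl

theorem xav_mem_dom (hD : D.Assumptions) (hS : D.StepRule) {zs : Blk dX × Blk dY}
    (hzs : D.IsKKT zs) {z₀ : Blk dX × Blk dY} (hx₀ : z₀.1 ∈ dom D.G) (s : ℕ → Fin n) {K : ℕ}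
    (hK : 1 ≤ K) : D.xav z₀ s K ∈ dom D.G ∧
      K * D.F (D.xav z₀ s K) ≤ ∑ k ∈ Finset.range K, D.F (D.iter z₀ s (k + 1)).1 := by
  have hK' : (0 : ℝ) < K := by exact_mod_cast hK
  have h0 : ∀ k ∈ Finset.range K, (0 : ℝ) ≤ 1 / (K : ℝ) := fun _ _ => by positivity
  have h1 : ∑ _k ∈ Finset.range K, (1 / (K : ℝ)) = 1 := by
    rw [Finset.sum_const, Finset.card_range, nsmul_eq_mul]; field_simp
  have hm : ∀ k ∈ Finset.range K, (D.iter z₀ s (k + 1)).1 ∈ dom D.G :=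
    fun k _ => iter_mem_dom hD hS hzs hx₀ s (k + 1)
  rw [xav_eq]
  refine ⟨hD.convexOn_F.1.sum_mem h0 h1 hm, ?_⟩
  have := hD.convexOn_F.map_sum_le h0 h1 hm
  rw [← Finset.smul_sum, ← Finset.smul_sum, smul_eq_mul] at this
  rw [← Finset.smul_sum]
  calc _ ≤ (K : ℝ) * (1 / K * ∑ k ∈ Finset.range K, D.F (D.iter z₀ s (k + 1)).1) := by gcongr
    _ = _ := by field_simp

/-- Nonnegativity of the primal gap `D_p(x; z⋆)`. -/
theorem F_add_inner_le (hD : D.Assumptions) {zs : Blk dX × Blk dY} (hzs : D.IsKKT zs)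
    {x : Blk dX} (hx : x ∈ dom D.G) :
    D.F zs.1 - inner ℝ (D.At zs.2) (x - zs.1) ≤ D.F x := by
  have h1 := add_inner_gradient_le hD.f_convex hD.f_diff zs.1 x
  have h2 := toReal_add_inner_le hD.G_ne_bot hzs.1 hx
  rw [inner_neg_left, inner_add_left] at h2
  unfold F
  linarith

theorem hs_add_inner_le (hD : D.Assumptions) {zs : Blk dX × Blk dY} (hzs : D.IsKKT zs)
    {y : Blk dY} (hy : conj D.H y ≠ ⊤) :
    D.hs zs.2 - inner ℝ zs.2 (D.A zs.1) ≤ D.hs y - inner ℝ y (D.A zs.1) := by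
  have h := toReal_add_inner_le hD.conj_H_ne_bot hzs.2 hy
  rw [inner_sub_right, real_inner_comm y, real_inner_comm zs.2] at h
  unfold hs
  linarith

theorem V_nonneg (hD : D.Assumptions) (hS : D.StepRule) (z : Blk dX × Blk dY) : 0 ≤ D.V z := by
  have := hS.pmin_pos
  have := wsq_nonneg (fun i => (hS.wx_pos i).le) z.1
  have := wsq_nonneg (fun j => (hS.wy_pos hD j).le) z.2
  unfold V
  positivity

theorem decr_bound (hD : D.Assumptions) (hS : D.StepRule) (z : Blk dX × Blk dY) :
    0 ≤ wsq D.σinv (D.ybar z - z.2) ∧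
      D.pmin ^ 2 * wsq D.σinv (D.ybar z - z.2) ≤ 2 * D.pmin * D.decr z := by
  have := hS.pmin_pos
  have h1 := wsq_nonneg (fun i => (hS.Cτ_pos hD i).le) (D.xbar z - z.1)
  have h2 := wsq_nonneg (w := D.σinv) (fun j => (inv_pos.2 (hS.σ_pos j)).le) (D.ybar z - z.2)
  refine ⟨h2, ?_⟩
  unfold decr
  nlinarith [mul_nonneg (sq_nonneg D.pmin) h1]

theorem decr_nonneg (hD : D.Assumptions) (hS : D.StepRule) (z : Blk dX × Blk dY) :
    0 ≤ D.decr z := by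
  have hq := hS.pmin_pos
  have h1 := wsq_nonneg (fun i => (hS.Cτ_pos hD i).le) (D.xbar z - z.1)
  have h2 := (decr_bound hD hS z).1
  unfold decr
  positivity

theorem wsq_add_expand {k : ℕ} {d : Fin k → ℕ} (w : Fin k → ℝ) (a b : Blk d) :
    wsq w (a + b) = wsq w a + 2 * inner ℝ (diag d w a) b + wsq w b := by
  simp only [wsq, inner_eq_sum, Finset.mul_sum, ← Finset.sum_add_distrib]
  refine Finset.sum_congr rfl fun i _ => ?_
  rw [PiLp.add_apply, diag_apply, norm_add_sq_real, real_inner_smul_left]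
  ring

/-- Martingale property: the noise at step k is centered given the past, and v is determined by the
past. -/
theorem Ex_inner_noise (hS : D.StepRule) (z₀ : Blk dX × Blk dY) (i₀ : Fin n) {K k : ℕ} (hk : k < K)
    {v : (ℕ → Fin n) → Blk dY}
    (hv : DependsOnFirst k v) :
    Ex D.p i₀ K (fun s => inner ℝ (v s) (D.noise (D.iter z₀ s k) (s k))) = 0 := by
  have hadapt : DependsOnFirst k fun s i => (inner ℝ (v s) (D.noise (D.iter z₀ s k) i) : ℝ) := by
    intro s s' h
    have h1 := D.dependsOnFirst_iter z₀ k s s' h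
    simp only at h1
    simp only [h1, hv s s' h]
  rw [Ex_tower hS.p_sum hk hadapt]
  simp only [sum_p_inner_noise hS]
  exact Ex_const hS.p_sum 0

section Path

variable (hD : D.Assumptions) (hS : D.StepRule) {zs : Blk dX × Blk dY} (hzs : D.IsKKT zs)
  {z₀ : Blk dX × Blk dY} (hx₀ : z₀.1 ∈ dom D.G) (i₀ : Fin n) {K : ℕ}

include hD hS hzs hx₀

/-- Here y may look at the whole path. The one-step inequality holds pathwise with y frozen;
replacing the average over draws by the actual draw costs only the noise term, whose mean need not
vanish. -/
theorem Ex_one_step {k : ℕ} (hk : k < K) (y : (ℕ → Fin n) → Blk dY)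
    (hy : ∀ s, conj D.H (y s) ≠ ⊤) :
    Ex D.p i₀ K (fun s => D.F (D.iter z₀ s (k + 1)).1
        + inner ℝ (y s) (D.A (D.iter z₀ s (k + 1)).1))
      + Ex D.p i₀ K (fun s => D.V (D.iter z₀ s (k + 1) - (zs.1, y s)))
      + D.pmin * Ex D.p i₀ K (fun s => D.hs (D.ybar (D.iter z₀ s k))
          - inner ℝ (D.ybar (D.iter z₀ s k)) (D.A zs.1))
      + Ex D.p i₀ K (fun s => D.decr (D.iter z₀ s k))
      + Ex D.p i₀ K (fun s => inner ℝ (y s) (D.noise (D.iter z₀ s k) (s k)))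
    ≤ (1 - D.pmin) * Ex D.p i₀ K (fun s => D.F (D.iter z₀ s k).1
        + inner ℝ (y s) (D.A (D.iter z₀ s k).1))
      + D.pmin * Ex D.p i₀ K (fun s => D.F zs.1 + D.hs (y s))
      + Ex D.p i₀ K (fun s => D.V (D.iter z₀ s k - (zs.1, y s))) := by
  -- The part of the Lyapunov function free of y, obtained by putting the dual comparison point at
  -- 0. It is adapted, so the tower property applies to it.
  set B : Blk dX × Blk dY → Fin n → ℝ := fun z i =>
    D.F (D.xnext i z) + D.V ((D.xnext i z, D.ynext i z) - (zs.1, 0)) with hB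
  have hadapt : DependsOnFirst k fun s => B (D.iter z₀ s k) := fun s s' h =>
    congrArg B (D.dependsOnFirst_iter z₀ k s s' h)
  have htower := Ex_tower (i₀ := i₀) hS.p_sum hk hadapt
  have hstep : ∀ s, (∑ i, D.p i * B (D.iter z₀ s k) i - B (D.iter z₀ s k) (s k))
      + ((D.F (D.iter z₀ s (k + 1)).1 + inner ℝ (y s) (D.A (D.iter z₀ s (k + 1)).1))
        + D.V (D.iter z₀ s (k + 1) - (zs.1, y s))
        + D.pmin * (D.hs (D.ybar (D.iter z₀ s k)) - inner ℝ (D.ybar (D.iter z₀ s k)) (D.A zs.1))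
        + D.decr (D.iter z₀ s k) + inner ℝ (y s) (D.noise (D.iter z₀ s k) (s k)))
      ≤ (1 - D.pmin) * (D.F (D.iter z₀ s k).1 + inner ℝ (y s) (D.A (D.iter z₀ s k).1))
        + D.pmin * (D.F zs.1 + D.hs (y s)) + D.V (D.iter z₀ s k - (zs.1, y s)) := by
    intro s
    have h := one_step hD hS hzs (D.iter z₀ s k) (iter_mem_dom hD hS hzs hx₀ s k) (hy s)
    have e1 : ∀ i, D.F (D.xnext i (D.iter z₀ s k)) + inner ℝ (y s) (D.A (D.xnext i (D.iter z₀ s k)))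
        + D.V ((D.xnext i (D.iter z₀ s k), D.ynext i (D.iter z₀ s k)) - (zs.1, y s))
        = B (D.iter z₀ s k) i + inner ℝ (y s) (D.lin (D.iter z₀ s k) i)
          + D.pmin / 2 * wsq D.wy (y s) := by
      intro i
      rw [add_assoc, V_next_expand, hB]; ring
    have e2 : D.F (D.iter z₀ s (k + 1)).1 + inner ℝ (y s) (D.A (D.iter z₀ s (k + 1)).1)
        + D.V (D.iter z₀ s (k + 1) - (zs.1, y s)) = _ := e1 (s k)
    have e3 : inner ℝ (y s) (D.noise (D.iter z₀ s k) (s k))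
        = ∑ i, D.p i * inner ℝ (y s) (D.lin (D.iter z₀ s k) i)
          - inner ℝ (y s) (D.lin (D.iter z₀ s k) (s k)) := by
      simp only [noise, inner_sub_right, inner_sum, inner_smul_right]
    simp only [e1, mul_add, Finset.sum_add_distrib, ← Finset.sum_mul, hS.p_sum] at h
    rw [e2, e3]
    linarith
  have h := Ex_mono (p := D.p) (i₀ := i₀) (K := K) (fun i => (hS.p_pos i).le) hstep
  simp only [Ex_add, Ex_sub, Ex_const_mul] at h htower ⊢
  rw [← htower] at h
  linarith

theorem Ex_telescope {k : ℕ} (hk : k ≤ K) (y : (ℕ → Fin n) → Blk dY)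
    (hy : ∀ s, conj D.H (y s) ≠ ⊤) :
    D.pmin * ∑ l ∈ Finset.range k, (Ex D.p i₀ K (fun s => D.F (D.iter z₀ s (l + 1)).1
          + inner ℝ (y s) (D.A (D.iter z₀ s (l + 1)).1))
        + Ex D.p i₀ K (fun s => D.hs (D.ybar (D.iter z₀ s l))
          - inner ℝ (D.ybar (D.iter z₀ s l)) (D.A zs.1))
        - Ex D.p i₀ K (fun s => D.F zs.1 + D.hs (y s)))
      + ∑ l ∈ Finset.range k, Ex D.p i₀ K (fun s => D.decr (D.iter z₀ s l))
      + ∑ l ∈ Finset.range k,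
          Ex D.p i₀ K (fun s => inner ℝ (y s) (D.noise (D.iter z₀ s l) (s l)))
      + (1 - D.pmin) * Ex D.p i₀ K (fun s => D.F (D.iter z₀ s k).1
          + inner ℝ (y s) (D.A (D.iter z₀ s k).1))
      + Ex D.p i₀ K (fun s => D.V (D.iter z₀ s k - (zs.1, y s)))
    ≤ (1 - D.pmin) * Ex D.p i₀ K (fun s => D.F z₀.1 + inner ℝ (y s) (D.A z₀.1))
      + Ex D.p i₀ K (fun s => D.V (z₀ - (zs.1, y s))) := by
  induction k with
  | zero => simp [iter]
  | succ k ih =>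
    have h1 := ih (by omega)
    have h2 := Ex_one_step hD hS hzs hx₀ i₀ (Nat.lt_of_succ_le hk) y hy
    rw [Finset.sum_range_succ, Finset.sum_range_succ, Finset.sum_range_succ]
    linarith

variable (hy₀ : conj D.H z₀.2 ≠ ⊤)

include hy₀

/-- Telescoping at the constant point y⋆: the noise has mean zero and the primal and dual gaps are
nonnegative by the KKT conditions, so everything left is bounded by the initial value. -/
theorem sum_decr_add_V_le :
    ∑ l ∈ Finset.range K, Ex D.p i₀ K (fun s => D.decr (D.iter z₀ s l))
      + Ex D.p i₀ K (fun s => D.V (D.iter z₀ s K - zs)) ≤ D.Δ₀ z₀ zs := by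
  have hys := mem_dom_of_mem_subdiff hzs.2 hy₀
  have h := Ex_telescope hD hS hzs hx₀ i₀ (le_refl K) (fun _ => zs.2) fun _ => hys
  have hq := hS.pmin_pos
  have hq1 := hS.pmin_le_one
  have hp := fun i => (hS.p_pos i).le
  have h0 : ∀ l, D.F zs.1 + inner ℝ zs.2 (D.A zs.1) ≤ Ex D.p i₀ K (fun s =>
      D.F (D.iter z₀ s l).1 + inner ℝ zs.2 (D.A (D.iter z₀ s l).1)) := by
    intro l
    rw [← Ex_const (p := D.p) (i₀ := i₀) (K := K) hS.p_sum (D.F zs.1 + inner ℝ zs.2 (D.A zs.1))]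
    refine Ex_mono hp fun s => ?_
    have := F_add_inner_le hD hzs (iter_mem_dom hD hS hzs hx₀ s l)
    rw [inner_At, map_sub, inner_sub_right] at this
    linarith
  have h1 : ∀ l, D.hs zs.2 - inner ℝ zs.2 (D.A zs.1) ≤ Ex D.p i₀ K (fun s =>
      D.hs (D.ybar (D.iter z₀ s l)) - inner ℝ (D.ybar (D.iter z₀ s l)) (D.A zs.1)) := by
    intro l
    rw [← Ex_const (p := D.p) (i₀ := i₀) (K := K) hS.p_sum (D.hs zs.2 - inner ℝ zs.2 (D.A zs.1))]
    exact Ex_mono hp fun s => hs_add_inner_le hD hzs (ybar_spec hD hS _ hys).1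
  have h2 : ∑ l ∈ Finset.range K,
      Ex D.p i₀ K (fun s => inner ℝ zs.2 (D.noise (D.iter z₀ s l) (s l))) = 0 :=
    Finset.sum_eq_zero fun l hl => Ex_inner_noise hS z₀ i₀ (Finset.mem_range.1 hl)
      fun _ _ _ => rfl
  rw [h2, Ex_const hS.p_sum, Ex_const hS.p_sum, Ex_const hS.p_sum] at h
  have h3 := Finset.sum_nonneg fun l (_ : l ∈ Finset.range K) =>
    (by linarith [h0 (l + 1), h1 l] : 0 ≤ Ex D.p i₀ K (fun s => D.F (D.iter z₀ s (l + 1)).1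
          + inner ℝ zs.2 (D.A (D.iter z₀ s (l + 1)).1))
        + Ex D.p i₀ K (fun s => D.hs (D.ybar (D.iter z₀ s l))
          - inner ℝ (D.ybar (D.iter z₀ s l)) (D.A zs.1))
        - (D.F zs.1 + D.hs zs.2))
  have h4 := mul_nonneg hq.le h3
  have h5 := mul_le_mul_of_nonneg_left (h0 K) (sub_nonneg.2 hq1)
  have h6 := F_add_inner_le hD hzs hx₀
  have h7 : inner ℝ (D.At zs.2) (z₀.1 - zs.1) = inner ℝ zs.2 (D.A z₀.1) - inner ℝ zs.2 (D.A zs.1) := by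
    rw [inner_At, map_sub, inner_sub_right]
  have h8 : ∀ z : Blk dX × Blk dY, z - (zs.1, zs.2) = z - zs := fun _ => rfl
  simp only [h8] at h
  unfold Δ₀
  rw [h7] at h6 ⊢
  nlinarith

/-- The accumulated noise. -/
theorem Ex_wsq_sum_noise_le :
    Ex D.p i₀ K (fun s => wsq D.wd (∑ l ∈ Finset.range K, D.noise (D.iter z₀ s l) (s l)))
      ≤ 2 * D.pmin * D.Δ₀ z₀ zs := by
  have hq := hS.pmin_pos
  have hp := fun i => (hS.p_pos i).le
  -- Martingale increments are orthogonal: the cross term with the accumulated past has zero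
  -- expectation, and each square is paid for by `decr`.
  have key : ∀ k ≤ K,
      Ex D.p i₀ K (fun s => wsq D.wd (∑ l ∈ Finset.range k, D.noise (D.iter z₀ s l) (s l)))
        ≤ 2 * D.pmin * ∑ l ∈ Finset.range k, Ex D.p i₀ K (fun s => D.decr (D.iter z₀ s l)) := by
    intro k
    induction k with
    | zero =>
      intro _
      have : wsq D.wd (0 : Blk dY) = 0 := by simp [wsq]
      simp only [Finset.range_zero, Finset.sum_empty, this, mul_zero]
      exact (Ex_const hS.p_sum 0).le
    | succ k ih =>
      intro hk
      have h1 := ih (by omega)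
      simp only [Finset.sum_range_succ, wsq_add_expand]
      rw [Ex_add, Ex_add, Ex_const_mul]
      have hadapt : DependsOnFirst k fun s => diag dY D.wd
          (∑ l ∈ Finset.range k, D.noise (D.iter z₀ s l) (s l)) := by
        intro s s' h
        refine congrArg (diag dY D.wd) (Finset.sum_congr rfl fun l hl => ?_)
        have hl' := Finset.mem_range.1 hl
        have e := D.dependsOnFirst_iter z₀ l s s' fun j hj => h j (hj.trans hl')
        simp only at e
        rw [e, h l hl']
      have e1 := Ex_inner_noise hS z₀ i₀ (Nat.lt_of_succ_le hk) hadapt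
      have hadapt2 : DependsOnFirst k fun s i => wsq D.wd (D.noise (D.iter z₀ s k) i) :=
        fun s s' h => congrArg (fun z i => wsq D.wd (D.noise z i))
          (D.dependsOnFirst_iter z₀ k s s' h)
      have e2 := Ex_tower (i₀ := i₀) hS.p_sum (Nat.lt_of_succ_le hk) hadapt2
      have h2 : Ex D.p i₀ K (fun s => ∑ i, D.p i * wsq D.wd (D.noise (D.iter z₀ s k) i))
          ≤ Ex D.p i₀ K (fun s => 2 * D.pmin * D.decr (D.iter z₀ s k)) :=
        Ex_mono hp fun s => (sum_p_wsq_noise_le hD hS _).trans (decr_bound hD hS _).2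
      rw [Ex_const_mul] at h2
      rw [e1, e2, mul_add]
      linarith
  have h1 := key K le_rfl
  have h2 := sum_decr_add_V_le hD hS hzs hx₀ i₀ (K := K) hy₀
  have h3 : 0 ≤ Ex D.p i₀ K (fun s => D.V (D.iter z₀ s K - zs)) :=
    Ex_nonneg hp fun s => V_nonneg hD hS _
  nlinarith

theorem Ex_wsq_iter_le :
    Ex D.p i₀ K (fun s => wsq D.wx ((D.iter z₀ s K).1 - zs.1)) ≤ 2 * (D.Δ₀ z₀ zs / D.pmin) := by
  have hq := hS.pmin_pos
  have hp := fun i => (hS.p_pos i).le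
  have h2 := sum_decr_add_V_le hD hS hzs hx₀ i₀ (K := K) hy₀
  have h1 : 0 ≤ ∑ l ∈ Finset.range K, Ex D.p i₀ K (fun s => D.decr (D.iter z₀ s l)) :=
    Finset.sum_nonneg fun l _ => Ex_nonneg hp fun s => decr_nonneg hD hS _
  have h3 : Ex D.p i₀ K (fun s => D.pmin / 2 * wsq D.wx ((D.iter z₀ s K).1 - zs.1))
      ≤ Ex D.p i₀ K (fun s => D.V (D.iter z₀ s K - zs)) := by
    refine Ex_mono hp fun s => ?_
    have := wsq_nonneg (fun j => (hS.wy_pos hD j).le) ((D.iter z₀ s K).2 - zs.2)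
    have e : D.V (D.iter z₀ s K - zs) = D.pmin / 2 * wsq D.wx ((D.iter z₀ s K).1 - zs.1)
      + D.pmin / 2 * wsq D.wy ((D.iter z₀ s K).2 - zs.2) := rfl
    rw [e]
    nlinarith
  rw [Ex_const_mul] at h3
  rw [← mul_div_assoc, le_div_iff₀ hq]
  linarith

end Path

end Data

end PureCD

namespace PureCD

/-! ### The averaged gap against a path-dependent dual point -/

namespace Data

variable {n m : ℕ} {dX : Fin n → ℕ} {dY : Fin m → ℕ} {D : Data dX dY}

theorem Δ₀_bounds (hD : D.Assumptions) (hS : D.StepRule) {zs : Blk dX × Blk dY}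
    (hzs : D.IsKKT zs) {z₀ : Blk dX × Blk dY} (hx₀ : z₀.1 ∈ dom D.G) :
    D.V (z₀ - zs) ≤ D.Δ₀ z₀ zs ∧ 0 ≤ D.Δ₀ z₀ zs ∧
      wsq D.wx (z₀.1 - zs.1) + wsq D.wy (z₀.2 - zs.2) ≤ 2 * (D.Δ₀ z₀ zs / D.pmin) := by
  have hq := hS.pmin_pos
  have h1 : D.V (z₀ - zs) ≤ D.Δ₀ z₀ zs := by
    have := F_add_inner_le hD hzs hx₀
    unfold Δ₀
    linarith
  refine ⟨h1, (V_nonneg hD hS _).trans h1, ?_⟩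
  have e : D.V (z₀ - zs) = D.pmin / 2 * wsq D.wx (z₀.1 - zs.1)
    + D.pmin / 2 * wsq D.wy (z₀.2 - zs.2) := rfl
  rw [e] at h1
  rw [← mul_div_assoc, le_div_iff₀ hq]
  linarith

/-- The coefficient of w² must be 1, since it enters c₂. The other two satisfy 2(9/8 + 169/200) =
3.94, which leaves 0.06 below the coefficient 4 in `Cg6`. -/
theorem young_four (w y x ξ : ℝ) :
    (w + y) * (x + ξ) ≤ w ^ 2 + 9 / 8 * (x ^ 2 + y ^ 2) + 169 / 200 * ξ ^ 2 := by
  nlinarith [sq_nonneg (w - (x + ξ) / 2), sq_nonneg (y - 4 / 9 * (x + ξ)),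
    sq_nonneg (x - 18 / 25 * ξ), sq_nonneg ξ, sq_nonneg x]

theorem wnorm_add_le {k : ℕ} {d : Fin k → ℕ} {w : Fin k → ℝ} (hw : ∀ i, 0 ≤ w i) (a b : Blk d) :
    wnorm w (a + b) ≤ wnorm w a + wnorm w b := by
  have ha := wnorm_nonneg w a
  have hb := wnorm_nonneg w b
  refine Real.sqrt_le_iff.2 ⟨by positivity, ?_⟩
  have h1 : inner ℝ (diag d w a) b ≤ wnorm w a * wnorm w b := by
    have h2 : inner ℝ (diag d w a) b
        ≤ ∑ i, (√(w i) * ‖a i‖) * (√(w i) * ‖b i‖) := by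
      rw [inner_eq_sum]
      refine Finset.sum_le_sum fun i _ => ?_
      rw [diag_apply, real_inner_smul_left]
      have := mul_le_mul_of_nonneg_left (real_inner_le_norm (a i) (b i)) (hw i)
      calc _ ≤ w i * (‖a i‖ * ‖b i‖) := this
        _ = (√(w i) * √(w i)) * (‖a i‖ * ‖b i‖) := by rw [Real.mul_self_sqrt (hw i)]
        _ = _ := by ring
    refine h2.trans ((Real.sum_mul_le_sqrt_mul_sqrt _ _ _).trans (le_of_eq ?_))
    simp only [wnorm, wsq, mul_pow, Real.sq_sqrt (hw _)]
  rw [wsq_add_expand, ← sq_wnorm hw a, ← sq_wnorm hw b]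
  nlinarith

theorem wnorm_sub_le {k : ℕ} {d : Fin k → ℕ} {w : Fin k → ℝ} (hw : ∀ i, 0 ≤ w i) (a b : Blk d) :
    wnorm w (a - b) ≤ wnorm w a + wnorm w b := by
  have := wnorm_add_le hw a (-b)
  rw [← sub_eq_add_neg] at this
  have e : wnorm w (-b) = wnorm w b := by unfold wnorm; rw [wsq_neg]
  rwa [e] at this

/-- Bounds the (1 - p_min) boundary term of the telescoping. Splitting y = y⋆ + (y - y⋆), the first
part is handled by nonnegativity of the primal gap, the second by the operator bound √N and Young's
inequality. -/
theorem coupling_le (hD : D.Assumptions) (hS : D.StepRule) {zs : Blk dX × Blk dY}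
    (hzs : D.IsKKT zs) (z₀ : Blk dX × Blk dY) {x : Blk dX} (hx : x ∈ dom D.G) (y : Blk dY) :
    D.F z₀.1 + inner ℝ y (D.A z₀.1) - (D.F x + inner ℝ y (D.A x))
      ≤ D.F z₀.1 - D.F zs.1
        + wnorm (fun i => D.τ i * D.p i) (D.At zs.2) * wnorm D.wx (z₀.1 - zs.1)
        + √D.N2P * (wsq D.wy (y - z₀.2)
          + 9 / 8 * (wsq D.wx (z₀.1 - zs.1) + wsq D.wy (z₀.2 - zs.2))
          + 169 / 200 * wsq D.wx (x - zs.1)) := by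
  have hwx := fun i => (hS.wx_pos i).le
  have hwy := fun j => (hS.wy_pos hD j).le
  have h1 := F_add_inner_le hD hzs hx
  have h2 := (abs_le.1 (hS.abs_inner_At_le_wnorm (D.At zs.2) (z₀.1 - zs.1))).2
  have h3 := (abs_le.1 (hS.abs_inner_At_le hD (y - zs.2) (z₀.1 - x))).2
  have h4 : wnorm D.wy (y - zs.2) ≤ wnorm D.wy (y - z₀.2) + wnorm D.wy (z₀.2 - zs.2) := by
    simpa using wnorm_add_le hwy (y - z₀.2) (z₀.2 - zs.2)
  have h5 : wnorm D.wx (z₀.1 - x) ≤ wnorm D.wx (z₀.1 - zs.1) + wnorm D.wx (x - zs.1) := by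
    simpa using wnorm_sub_le hwx (z₀.1 - zs.1) (x - zs.1)
  have h6 := young_four (wnorm D.wy (y - z₀.2)) (wnorm D.wy (z₀.2 - zs.2))
    (wnorm D.wx (z₀.1 - zs.1)) (wnorm D.wx (x - zs.1))
  rw [sq_wnorm hwx, sq_wnorm hwx, sq_wnorm hwy, sq_wnorm hwy] at h6
  have h7 : wnorm D.wy (y - zs.2) * wnorm D.wx (z₀.1 - x) ≤
      (wnorm D.wy (y - z₀.2) + wnorm D.wy (z₀.2 - zs.2))
        * (wnorm D.wx (z₀.1 - zs.1) + wnorm D.wx (x - zs.1)) :=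
    mul_le_mul h4 h5 (wnorm_nonneg _ _) (add_nonneg (wnorm_nonneg _ _) (wnorm_nonneg _ _))
  have h8 := mul_le_mul_of_nonneg_left (h7.trans h6) (Real.sqrt_nonneg D.N2P)
  rw [← mul_assoc] at h8
  have e1 : inner ℝ (D.At zs.2) (x - zs.1) = inner ℝ zs.2 (D.A x) - inner ℝ zs.2 (D.A zs.1) := by
    rw [inner_At, map_sub, inner_sub_right]
  have e2 : inner ℝ (D.At zs.2) (z₀.1 - zs.1)
      = inner ℝ zs.2 (D.A z₀.1) - inner ℝ zs.2 (D.A zs.1) := by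
    rw [inner_At, map_sub, inner_sub_right]
  have e3 : inner ℝ (D.At (y - zs.2)) (z₀.1 - x) = inner ℝ y (D.A z₀.1) - inner ℝ y (D.A x)
      - (inner ℝ zs.2 (D.A z₀.1) - inner ℝ zs.2 (D.A x)) := by
    rw [inner_At, map_sub, inner_sub_left, inner_sub_right, inner_sub_right]
  rw [e1] at h1
  rw [e2] at h2
  rw [e3] at h3
  linarith

/-- The additive constant in the bound on the averaged gap. -/
noncomputable def gapConst (D : Data dX dY) (z₀ zs : Blk dX × Blk dY) : ℝ :=
  (1 - D.pmin) * (D.F z₀.1 - D.F zs.1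
      + wnorm (fun i => D.τ i * D.p i) (D.At zs.2) * √(D.Δ₀ z₀ zs / D.pmin))
    + (1 - D.pmin) * √D.N2P * (4 * D.Δ₀ z₀ zs / D.pmin + 2 * wsq D.wy zs.2)
    + 3 / 2 * D.Δ₀ z₀ zs

theorem coupling_const_le (hD : D.Assumptions) (hS : D.StepRule) {zs : Blk dX × Blk dY}
    (hzs : D.IsKKT zs) {z₀ : Blk dX × Blk dY} (hx₀ : z₀.1 ∈ dom D.G) :
    wnorm (fun i => D.τ i * D.p i) (D.At zs.2) * wnorm D.wx (z₀.1 - zs.1)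
        + √D.N2P * (9 / 8 * (2 * (D.Δ₀ z₀ zs / D.pmin)) + 169 / 200 * (2 * (D.Δ₀ z₀ zs / D.pmin)))
      ≤ wnorm (fun i => D.τ i * D.p i) (D.At zs.2) * √(D.Δ₀ z₀ zs / D.pmin)
        + √D.N2P * (4 * D.Δ₀ z₀ zs / D.pmin + 2 * wsq D.wy zs.2) := by
  obtain ⟨-, hΔ, hb⟩ := Δ₀_bounds hD hS hzs hx₀
  have hq := hS.pmin_pos
  have hwy := fun j => (hS.wy_pos hD j).le
  set E := D.Δ₀ z₀ zs / D.pmin with hE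
  have hE0 : 0 ≤ E := by positivity
  -- Here 1.415 exceeds √2. The stated constant allows only a factor 1, so the excess 0.415 is
  -- absorbed into 2‖y⋆‖² and the spare 0.06 E.
  have hX : wnorm D.wx (z₀.1 - zs.1) ≤ 1415 / 1000 * √E := by
    unfold wnorm
    refine Real.sqrt_le_iff.2 ⟨by positivity, ?_⟩
    rw [mul_pow, Real.sq_sqrt hE0]
    have := wsq_nonneg hwy (z₀.2 - zs.2)
    nlinarith
  have hQ := hS.wnorm_At_le hD zs.2
  have hQ0 := wnorm_nonneg (fun i => D.τ i * D.p i) (D.At zs.2)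
  set Q := wnorm (fun i => D.τ i * D.p i) (D.At zs.2)
  have h1 : Q * wnorm D.wx (z₀.1 - zs.1) ≤ Q * √E + Q * (415 / 1000 * √E) := by
    have := mul_le_mul_of_nonneg_left hX hQ0
    linarith
  have h2 : Q * (415 / 1000 * √E) ≤ √D.N2P * wnorm D.wy zs.2 * (415 / 1000 * √E) :=
    mul_le_mul_of_nonneg_right hQ (by positivity)
  have h3 : wnorm D.wy zs.2 * (415 / 1000 * √E) ≤ 2 * wsq D.wy zs.2 + 6 / 100 * E := by
    rw [← sq_wnorm hwy]
    nth_rewrite 2 [← Real.sq_sqrt hE0]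
    nlinarith [sq_nonneg (wnorm D.wy zs.2 - 1 / 10 * √E), sq_nonneg (wnorm D.wy zs.2), sq_nonneg √E,
      wnorm_nonneg D.wy zs.2, Real.sqrt_nonneg E]
  have h4 := mul_le_mul_of_nonneg_left h3 (Real.sqrt_nonneg D.N2P)
  have e : 4 * D.Δ₀ z₀ zs / D.pmin = 4 * E := by rw [hE]; ring
  rw [e]
  linarith

section Path

variable (hD : D.Assumptions) (hS : D.StepRule) {zs : Blk dX × Blk dY} (hzs : D.IsKKT zs)
  {z₀ : Blk dX × Blk dY} (hx₀ : z₀.1 ∈ dom D.G) (hy₀ : conj D.H z₀.2 ≠ ⊤) (i₀ : Fin n) {K : ℕ}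

include hD hS hzs hx₀ hy₀

theorem neg_Ex_noise_le (y : (ℕ → Fin n) → Blk dY) :
    -∑ l ∈ Finset.range K, Ex D.p i₀ K (fun s => inner ℝ (y s) (D.noise (D.iter z₀ s l) (s l)))
      ≤ D.pmin * Ex D.p i₀ K (fun s => wsq D.wy (y s - z₀.2)) + 1 / 2 * D.Δ₀ z₀ zs := by
  have hq := hS.pmin_pos
  have hwy := fun j => (hS.wy_pos hD j).le
  have hwd := fun j => (hS.wd_pos hD j).le
  have hM := Ex_wsq_sum_noise_le hD hS hzs hx₀ i₀ (K := K) hy₀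
  -- The deterministic y₀ pairs to zero with the noise and may be subtracted, so only y - y₀ appears
  -- in Young's inequality.
  have h0 : ∑ l ∈ Finset.range K,
      Ex D.p i₀ K (fun s => inner ℝ z₀.2 (D.noise (D.iter z₀ s l) (s l))) = 0 :=
    Finset.sum_eq_zero fun l hl => Ex_inner_noise hS z₀ i₀ (Finset.mem_range.1 hl)
      fun _ _ _ => rfl
  rw [← Ex_sum] at h0 ⊢
  have h1 : ∀ s, -(∑ l ∈ Finset.range K, inner ℝ (y s) (D.noise (D.iter z₀ s l) (s l)))
      + ∑ l ∈ Finset.range K, inner ℝ z₀.2 (D.noise (D.iter z₀ s l) (s l))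
      ≤ D.pmin * wsq D.wy (y s - z₀.2) + 1 / (4 * D.pmin) *
        wsq D.wd (∑ l ∈ Finset.range K, D.noise (D.iter z₀ s l) (s l)) := by
    intro s
    rw [← inner_sum, ← inner_sum]
    set M := ∑ l ∈ Finset.range K, D.noise (D.iter z₀ s l) (s l)
    have h2 := (abs_le.1 (abs_inner_le_wnorm hwy hwd (hS.wy_mul_wd hD) (y s - z₀.2) M)).1
    rw [inner_sub_left] at h2
    have h3 : wnorm D.wy (y s - z₀.2) * wnorm D.wd M
        ≤ D.pmin * wsq D.wy (y s - z₀.2) + 1 / (4 * D.pmin) * wsq D.wd M := by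
      rw [← sq_wnorm hwy, ← sq_wnorm hwd]
      set a := wnorm D.wy (y s - z₀.2)
      set b := wnorm D.wd M
      have : D.pmin * a ^ 2 + 1 / (4 * D.pmin) * b ^ 2 - a * b
          = D.pmin * (a - b / (2 * D.pmin)) ^ 2 := by field_simp; ring
      nlinarith [mul_nonneg hq.le (sq_nonneg (a - b / (2 * D.pmin)))]
    linarith
  have h4 := Ex_mono (p := D.p) (i₀ := i₀) (K := K) (fun i => (hS.p_pos i).le) h1
  have e : ∀ Φ : (ℕ → Fin n) → ℝ, Ex D.p i₀ K (fun s => - Φ s) = - Ex D.p i₀ K Φ := by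
    intro Φ
    have := Ex_const_mul (p := D.p) (i₀ := i₀) (K := K) (-1) Φ
    simpa using this
  rw [Ex_add, Ex_add, Ex_const_mul, Ex_const_mul, e, h0] at h4
  have h5 : 1 / (4 * D.pmin) * Ex D.p i₀ K (fun s => wsq D.wd
      (∑ l ∈ Finset.range K, D.noise (D.iter z₀ s l) (s l))) ≤ 1 / 2 * D.Δ₀ z₀ zs := by
    refine (mul_le_mul_of_nonneg_left hM (by positivity)).trans (le_of_eq ?_)
    field_simp
    norm_num
  linarith

/-- The averaged gap against a path-dependent dual point. -/
theorem averaged_gap_le (hK : 1 ≤ K) (y : (ℕ → Fin n) → Blk dY) (hy : ∀ s, conj D.H (y s) ≠ ⊤) :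
    D.pmin * K * Ex D.p i₀ K (fun s => D.F (D.xav z₀ s K) - D.F zs.1
        + (inner ℝ (y s) (D.A (D.xav z₀ s K)) - D.hs (y s))
        + (D.hs zs.2 - inner ℝ zs.2 (D.A zs.1)))
      ≤ D.gapConst z₀ zs + D.c₂ * Ex D.p i₀ K (fun s => wsq D.wy (y s - z₀.2)) := by
  have hq := hS.pmin_pos
  have hq1 := sub_nonneg.2 hS.pmin_le_one
  have hp := fun i => (hS.p_pos i).le
  have hys : conj D.H zs.2 ≠ ⊤ := mem_dom_of_mem_subdiff hzs.2 hy₀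
  have hT := Ex_telescope hD hS hzs hx₀ i₀ (le_refl K) y hy
  have hN := neg_Ex_noise_le hD hS hzs hx₀ hy₀ i₀ (K := K) y
  have hξ := Ex_wsq_iter_le hD hS hzs hx₀ i₀ (K := K) hy₀
  obtain ⟨hV, hΔ, hXY⟩ := Δ₀_bounds hD hS hzs hx₀
  have hR : 0 ≤ ∑ l ∈ Finset.range K, Ex D.p i₀ K (fun s => D.decr (D.iter z₀ s l)) :=
    Finset.sum_nonneg fun l _ => Ex_nonneg hp fun s => decr_nonneg hD hS _
  have hW : 0 ≤ Ex D.p i₀ K (fun s => D.V (D.iter z₀ s K - (zs.1, y s))) :=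
    Ex_nonneg hp fun s => V_nonneg hD hS _
  set w := Ex D.p i₀ K (fun s => wsq D.wy (y s - z₀.2)) with hw
  have hW0 : Ex D.p i₀ K (fun s => D.V (z₀ - (zs.1, y s)))
      = D.pmin / 2 * wsq D.wx (z₀.1 - zs.1) + D.pmin / 2 * w := by
    rw [hw, ← Ex_const_mul, ← Ex_const (p := D.p) (i₀ := i₀) (K := K) hS.p_sum
      (D.pmin / 2 * wsq D.wx (z₀.1 - zs.1)), ← Ex_add]
    congr 1
    funext s
    rw [wsq_sub_comm D.wy (y s)]
    rfl
  have hW0' : D.pmin / 2 * wsq D.wx (z₀.1 - zs.1) ≤ D.Δ₀ z₀ zs := by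
    have e : D.V (z₀ - zs) = D.pmin / 2 * wsq D.wx (z₀.1 - zs.1)
      + D.pmin / 2 * wsq D.wy (z₀.2 - zs.2) := rfl
    have := wsq_nonneg (fun j => (hS.wy_pos hD j).le) (z₀.2 - zs.2)
    rw [e] at hV
    nlinarith
  have hP : Ex D.p i₀ K (fun s => D.F z₀.1 + inner ℝ (y s) (D.A z₀.1))
      - Ex D.p i₀ K (fun s => D.F (D.iter z₀ s K).1 + inner ℝ (y s) (D.A (D.iter z₀ s K).1))
      ≤ D.F z₀.1 - D.F zs.1
        + wnorm (fun i => D.τ i * D.p i) (D.At zs.2) * √(D.Δ₀ z₀ zs / D.pmin)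
        + √D.N2P * (4 * D.Δ₀ z₀ zs / D.pmin + 2 * wsq D.wy zs.2) + √D.N2P * w := by
    rw [← Ex_sub]
    have h1 := Ex_mono (p := D.p) (i₀ := i₀) (K := K) hp fun s =>
      coupling_le hD hS hzs z₀ (iter_mem_dom hD hS hzs hx₀ s K) (y s)
    rw [Ex_add, Ex_const hS.p_sum, Ex_const_mul, Ex_add, Ex_add, Ex_const hS.p_sum,
      Ex_const_mul] at h1
    have h2 := coupling_const_le hD hS hzs hx₀
    have h3 := mul_le_mul_of_nonneg_left (add_le_add
      (mul_le_mul_of_nonneg_left hXY (by norm_num : (0 : ℝ) ≤ 9 / 8))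
      (mul_le_mul_of_nonneg_left hξ (by norm_num : (0 : ℝ) ≤ 169 / 200))) (Real.sqrt_nonneg D.N2P)
    rw [← hw] at h1
    linarith
  have hP' := mul_le_mul_of_nonneg_left hP hq1
  -- Jensen's inequality handles F at the average, and optimality of y⋆ bounds the dual gap at each
  -- ȳ from below. The average starts at k = 1, matching the indices l + 1.
  have hG : D.pmin * K * Ex D.p i₀ K (fun s => D.F (D.xav z₀ s K) - D.F zs.1
        + (inner ℝ (y s) (D.A (D.xav z₀ s K)) - D.hs (y s))
        + (D.hs zs.2 - inner ℝ zs.2 (D.A zs.1)))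
      ≤ D.pmin * ∑ l ∈ Finset.range K, (Ex D.p i₀ K (fun s => D.F (D.iter z₀ s (l + 1)).1
          + inner ℝ (y s) (D.A (D.iter z₀ s (l + 1)).1))
        + Ex D.p i₀ K (fun s => D.hs (D.ybar (D.iter z₀ s l))
          - inner ℝ (D.ybar (D.iter z₀ s l)) (D.A zs.1))
        - Ex D.p i₀ K (fun s => D.F zs.1 + D.hs (y s))) := by
    rw [mul_assoc]
    refine mul_le_mul_of_nonneg_left ?_ hq.le
    simp only [← Ex_add, ← Ex_sub]
    rw [← Ex_sum, ← Ex_const_mul]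
    refine Ex_mono hp fun s => ?_
    have h1 := (xav_mem_dom hD hS hzs hx₀ s hK).2
    have hK' : (K : ℝ) ≠ 0 := by positivity
    have h2 : K * inner ℝ (y s) (D.A (D.xav z₀ s K))
        = ∑ l ∈ Finset.range K, inner ℝ (y s) (D.A (D.iter z₀ s (l + 1)).1) := by
      rw [xav_eq, ← Finset.smul_sum, map_smul, inner_smul_right, map_sum, inner_sum]
      field_simp
    have h3 := Finset.sum_le_sum fun l (_ : l ∈ Finset.range K) =>
      hs_add_inner_le hD hzs (ybar_spec hD hS (D.iter z₀ s l) hys).1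
    rw [Finset.sum_const, Finset.card_range, nsmul_eq_mul] at h3
    rw [Finset.sum_sub_distrib, Finset.sum_add_distrib, Finset.sum_add_distrib, Finset.sum_const,
      Finset.card_range, nsmul_eq_mul]
    linarith
  unfold gapConst c₂
  linarith

end Path

/-- The subgradient inequality for h* is tested at y⋆ with only block j moved to its value in y₀;
the other blocks cancel. -/
theorem conj_block_gap_le (hD : D.Assumptions) {zs z₀ : Blk dX × Blk dY} (hzs : D.IsKKT zs)
    (hy₀ : conj D.H z₀.2 ≠ ⊤) (j : Fin m) :
    inner ℝ (D.A zs.1 j) (z₀.2 j - zs.2 j)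
      ≤ (conj (D.h j) (z₀.2 j)).toReal - (conj (D.h j) (zs.2 j)).toReal := by
  have hb : ∀ j x, D.h j x ≠ ⊥ := fun j => (hD.h_pcc j).ne_bot
  have hpr : ∀ j, ∃ x, D.h j x ≠ ⊤ := fun j => (hD.h_pcc j).proper
  have hys : conj D.H zs.2 ≠ ⊤ := mem_dom_of_mem_subdiff hzs.2 hy₀
  obtain ⟨hf0, -⟩ := conj_sep hb hpr hy₀
  obtain ⟨hfs, hes⟩ := conj_sep hb hpr hys
  set y : Blk dY := zs.2 + U dY j (z₀.2 j - zs.2 j) with hydef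
  have hyj : y j = z₀.2 j := by simp [hydef, U]
  have hyl : ∀ l, l ≠ j → y l = zs.2 l := fun l hl => by simp [hydef, U, hl]
  have hfy : ∀ l, conj (D.h l) (y l) ≠ ⊤ := by
    intro l
    by_cases hl : l = j
    · subst hl; rw [hyj]; exact hf0 l
    · rw [hyl l hl]; exact hfs l
  have hle : conj D.H y ≤ ((∑ l, (conj (D.h l) (y l)).toReal : ℝ) : EReal) := by
    refine conj_le_coe hD.H_ne_bot fun w hw => ?_
    have hw' := (sep_ne_top_iff hb w).1 hw
    have e : (D.H w).toReal = _ := toReal_sep hb hw'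
    rw [e, inner_eq_sum, ← Finset.sum_sub_distrib]
    refine Finset.sum_le_sum fun i _ => ?_
    linarith [inner_le_conj_add (hb i) (hw' i) (hfy i)]
  have hy : conj D.H y ≠ ⊤ := (hle.trans_lt (EReal.coe_lt_top _)).ne
  have h1 := toReal_add_inner_le hD.conj_H_ne_bot hzs.2 hy
  have h2 := EReal.toReal_le_toReal hle (hD.conj_H_ne_bot y) (EReal.coe_ne_top _)
  rw [EReal.toReal_coe] at h2
  have e1 : (conj D.H zs.2).toReal = _ := hes
  rw [e1, hydef, add_sub_cancel_left, inner_U] at h1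
  have e2 : ∑ l ∈ Finset.univ.erase j, (conj (D.h l) (y l)).toReal
      = ∑ l ∈ Finset.univ.erase j, (conj (D.h l) (zs.2 l)).toReal :=
    Finset.sum_congr rfl fun l hl => by rw [hyl l (Finset.ne_of_mem_erase hl)]
  rw [← Finset.add_sum_erase _ _ (Finset.mem_univ j), e2, hyj] at h2
  rw [← Finset.add_sum_erase _ _ (Finset.mem_univ j)] at h1
  linarith

/-! ### Comparison with the stated constants -/

section Constants

variable (hD : D.Assumptions) (hS : D.StepRule) {zs : Blk dX × Blk dY} (hzs : D.IsKKT zs)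
  {z₀ : Blk dX × Blk dY} (hx₀ : z₀.1 ∈ dom D.G)

include hD hS hzs hx₀

theorem le_Cg2 : D.N2P * (4 * D.Δ₀ z₀ zs / D.pmin) + 5 * D.Δ₀ z₀ zs ≤ D.Cg2 z₀ zs := by
  obtain ⟨-, hΔ, -⟩ := Δ₀_bounds hD hS hzs hx₀
  have hq := hS.pmin_pos
  have hC := hS.CτV_pos hD
  have hC1 := hS.CτV_le_one hD
  have hN := hS.N2P_pos
  have hNP := hS.one_le_NP
  have hκ : 0 ≤ D.κ := by unfold κ; positivity
  have h1 : 2 * D.Δ₀ z₀ zs / D.pmin ≤ 2 * D.Δ₀ z₀ zs / (D.pmin * D.CτV) := by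
    refine div_le_div_of_nonneg_left (by positivity) (by positivity) ?_
    nlinarith
  have h2 : D.Δ₀ z₀ zs ≤ D.Δ₀ z₀ zs / D.CτV := by
    rw [le_div_iff₀ hC]; nlinarith
  have h3 : D.N2P * 2 * (2 * D.Δ₀ z₀ zs / D.pmin)
      ≤ D.N2P * (1 + D.NP + D.κ) * (2 * D.Δ₀ z₀ zs / (D.pmin * D.CτV)) := by
    refine mul_le_mul (mul_le_mul_of_nonneg_left (by linarith) hN.le) h1 (by positivity) ?_
    exact mul_nonneg hN.le (by linarith)
  have h4 : 0 ≤ D.κ * D.Δ₀ z₀ zs := mul_nonneg hκ hΔ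
  have e : D.N2P * 2 * (2 * D.Δ₀ z₀ zs / D.pmin) = D.N2P * (4 * D.Δ₀ z₀ zs / D.pmin) := by ring
  unfold Cg2
  linarith

/-- The difference of `hγ` values in `Cg5` may be negative. Blockwise subgradient inequalities bound
it below, and completing a square shows that the quadratic terms compensate. -/
theorem dual_bracket_nonneg (hy₀ : conj D.H z₀.2 ≠ ⊤) :
    0 ≤ D.hγ z₀.2 - D.hγ zs.2 + 1 / 2 * wsq (fun j => D.σ j / D.pi j) (D.A zs.1)
      + D.Δ₀ z₀ zs / D.pmin := by
  obtain ⟨-, -, hXY⟩ := Δ₀_bounds hD hS hzs hx₀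
  have hX := wsq_nonneg (fun i => (hS.wx_pos i).le) (z₀.1 - zs.1)
  have h : -(1 / 2 * wsq D.wy (z₀.2 - zs.2)) ≤ D.hγ z₀.2 - D.hγ zs.2
      + 1 / 2 * wsq (fun j => D.σ j / D.pi j) (D.A zs.1) := by
    simp only [hγ, wsq, Finset.mul_sum, ← Finset.sum_add_distrib, ← Finset.sum_sub_distrib,
      ← Finset.sum_neg_distrib]
    refine Finset.sum_le_sum fun j _ => ?_
    have h1 := conj_block_gap_le hD hzs hy₀ j
    have hπ := hS.pi_pos hD j
    have hπ1 := hS.pi_le_one j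
    have hσ := hS.σ_pos j
    have h2 := (abs_le.1 (abs_real_inner_le_norm (D.A zs.1 j) (z₀.2 j - zs.2 j))).1
    have hγ0 : 0 ≤ (D.pi j)⁻¹ - 1 := by
      have := one_le_inv_iff₀.2 ⟨hπ, hπ1⟩
      linarith
    have h3 := mul_le_mul_of_nonneg_left (h2.trans h1) hγ0
    rw [PiLp.sub_apply]
    set a := ‖D.A zs.1 j‖
    set b := ‖z₀.2 j - zs.2 j‖
    have e : 1 / 2 * (D.σ j / D.pi j * a ^ 2) + 1 / 2 * (D.wy j * b ^ 2)
        - ((D.pi j)⁻¹ - 1) * (a * b)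
        = 1 / (2 * D.pi j * D.σ j) * ((D.σ j * a - (1 - D.pi j) * b) ^ 2
          + D.pi j * (2 - D.pi j) * b ^ 2) := by
      unfold wy
      field_simp
      ring
    have : 0 ≤ 1 / (2 * D.pi j * D.σ j) * ((D.σ j * a - (1 - D.pi j) * b) ^ 2
          + D.pi j * (2 - D.pi j) * b ^ 2) := by
      have : 0 ≤ 2 - D.pi j := by linarith
      positivity
    linarith
  linarith

/-- The extra multiple of N, available in `Cg2`, is retained because `le_Cf` spends it when N ≥ 1.
-/
theorem gapConst_add_le_Cs (hy₀ : conj D.H z₀.2 ≠ ⊤) :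
    D.gapConst z₀ zs + D.N2P * (4 * D.Δ₀ z₀ zs / D.pmin) ≤ D.Cs z₀ zs := by
  obtain ⟨-, hΔ, -⟩ := Δ₀_bounds hD hS hzs hx₀
  have hq := hS.pmin_pos
  have h1 := le_Cg2 hD hS hzs hx₀
  have h2 := mul_nonneg hq.le (dual_bracket_nonneg hD hS hzs hx₀ hy₀)
  have h3 : 0 ≤ D.pmin * (D.Δ₀ z₀ zs * D.N2P / (D.pmin ^ 2 * D.CτV)) := by
    have := hS.N2P_pos
    have := hS.CτV_pos hD
    positivity
  have h4 : 0 ≤ D.pmin * √D.N2P * D.Nπ * (4 * D.Δ₀ z₀ zs / D.pmin + 2 * wsq D.wx zs.1) := by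
    have := hS.Nπ_nonneg hD
    have := wsq_nonneg (fun i => (hS.wx_pos i).le) zs.1
    positivity
  unfold Cs Cg5 Cg6 gapConst
  linarith

theorem gapConst_le_Cs (hy₀ : conj D.H z₀.2 ≠ ⊤) : D.gapConst z₀ zs ≤ D.Cs z₀ zs := by
  obtain ⟨-, hΔ, -⟩ := Δ₀_bounds hD hS hzs hx₀
  have hq := hS.pmin_pos
  have := hS.N2P_pos
  have h1 := gapConst_add_le_Cs hD hS hzs hx₀ hy₀
  have : 0 ≤ D.N2P * (4 * D.Δ₀ z₀ zs / D.pmin) := by positivity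
  linarith

end Constants

namespace StepRule

theorem c₁_nonneg (hS : D.StepRule) (hD : D.Assumptions) : 0 ≤ D.c₁ := by
  have := hS.pmin_pos
  have := hS.Nπ_nonneg hD
  unfold c₁
  positivity

theorem c₂_pos (hS : D.StepRule) : 0 < D.c₂ := by
  have := hS.pmin_pos
  have := mul_nonneg (sub_nonneg.2 hS.pmin_le_one) (Real.sqrt_nonneg D.N2P)
  unfold c₂
  linarith

theorem c₂_le (hS : D.StepRule) : D.c₂ ≤ 3 / 2 := by
  have h1 := sub_nonneg.2 hS.pmin_le_one
  have h2 : √D.N2P ≤ 3 / 2 :=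
    Real.sqrt_le_iff.2 ⟨by norm_num, by linarith [hS.N2P_le_two]⟩
  unfold c₂
  nlinarith

theorem c₂_le_of_N2P_le_one (hS : D.StepRule) (h : D.N2P ≤ 1) : D.c₂ ≤ 1 + D.pmin := by
  have h1 := sub_nonneg.2 hS.pmin_le_one
  have h2 : √D.N2P ≤ 1 := Real.sqrt_le_one.2 h
  have := hS.pmin_pos
  unfold c₂
  nlinarith

theorem c₂_le_c (hS : D.StepRule) : D.c₂ ≤ D.c := by
  have := hS.pmin_pos
  have := hS.c₂_le
  unfold c
  linarith

end StepRule

end Data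

end PureCD

namespace PureCD

/-! ### Passage from the probability space to finite expectations -/

section Law

variable {n : ℕ} {Ω : Type*} [MeasurableSpace Ω] {μ : Measure Ω} [IsProbabilityMeasure μ]
  {p : Fin n → ℝ} {idx : ℕ → Ω → Fin n}

/-- Functions of finitely many independent draws are integrable, with integral given by `Ex`. -/
theorem integral_eq_Ex (hmeas : ∀ k, Measurable (idx k)) (hindep : iIndepFun idx μ)
    (hlaw : ∀ k i, μ.real (idx k ⁻¹' {i}) = p i) (i₀ : Fin n) {K : ℕ} {Φ : (ℕ → Fin n) → ℝ}
    (hΦ : DependsOnFirst K Φ) :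
    Integrable (fun ω => Φ fun k => idx k ω) μ ∧
      ∫ ω, Φ (fun k => idx k ω) ∂μ = Ex p i₀ K Φ := by
  set T : Ω → Fin K → Fin n := fun ω k => idx k ω with hTdef
  have hT : Measurable T := measurable_pi_iff.2 fun k => hmeas k
  have hfun : (fun ω => Φ fun k => idx k ω) = (fun t => Φ (extend i₀ t)) ∘ T := by
    funext ω
    refine hΦ _ _ fun j hj => ?_
    simp [extend, hj, hTdef]
  have hprob : IsProbabilityMeasure (μ.map T) := Measure.isProbabilityMeasure_map hT.aemeasurable
  have hmass : ∀ t, (μ.map T).real {t} = ∏ k, p (t k) := by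
    intro t
    rw [map_measureReal_apply hT (measurableSet_singleton t)]
    have e : T ⁻¹' {t} = ⋂ k : Fin K, idx k ⁻¹' {t k} := by
      ext ω
      simp [hTdef, funext_iff]
    have hind : iIndepFun (fun k : Fin K => idx k) μ := hindep.precomp Fin.val_injective
    have h1 := hind.meas_iInter (s := fun k : Fin K => idx k ⁻¹' {t k}) fun k => 
      ⟨{t k}, measurableSet_singleton _, rfl⟩
    rw [e, measureReal_def, h1, ENNReal.toReal_prod]
    exact Finset.prod_congr rfl fun k _ => hlaw k (t k)
  have hi : Integrable (fun t => Φ (extend i₀ t)) (μ.map T) := Integrable.of_finite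
  rw [hfun]
  refine ⟨hi.comp_measurable hT, ?_⟩
  have h2 := integral_map (μ := μ) hT.aemeasurable hi.aestronglyMeasurable
  simp only [Function.comp_def]
  rw [← h2, integral_fintype hi]
  simp only [hmass, smul_eq_mul]
  rfl

end Law

namespace Data

variable {n m : ℕ} {dX : Fin n → ℕ} {dY : Fin m → ℕ} {D : Data dX dY}

theorem norm_le_wnorm_div (hD : D.Assumptions) (hS : D.StepRule) (v : Blk dY) :
    ‖v‖ ≤ wnorm D.wd v / √(⨅ j, D.wd j) := by
  rcases isEmpty_or_nonempty (Fin m) with hm | hm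
  -- For m = 0 the infimum defaults to 0 and division by its root gives 0, so the bound holds only
  -- because the vector itself vanishes.
  · have : ‖v‖ = 0 := by
      have := norm_sq_eq_sum v
      simpa using this
    rw [this]
    exact div_nonneg (wnorm_nonneg _ _) (Real.sqrt_nonneg _)
  · obtain ⟨j, hj⟩ := exists_eq_ciInf_of_finite (f := D.wd)
    have hpos : 0 < ⨅ j, D.wd j := by rw [← hj]; exact hS.wd_pos hD j
    rw [le_div_iff₀ (Real.sqrt_pos.2 hpos)]
    refine Real.le_sqrt_of_sq_le ?_
    rw [mul_pow, Real.sq_sqrt hpos.le, norm_sq_eq_sum, Finset.sum_mul]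
    refine Finset.sum_le_sum fun l _ => ?_
    rw [mul_comm]
    exact mul_le_mul_of_nonneg_right (ciInf_le (Set.finite_range _).bddBelow l) (sq_nonneg _)

theorem wsq_diag_wd (hD : D.Assumptions) (hS : D.StepRule) (r : Blk dY) :
    wsq D.wy (diag dY D.wd r) = wsq D.wd r := by
  refine Finset.sum_congr rfl fun j _ => ?_
  rw [diag_apply, norm_smul, mul_pow, Real.norm_eq_abs, sq_abs]
  have := hS.wy_mul_wd hD j
  calc _ = (D.wy j * D.wd j) * (D.wd j * ‖r j‖ ^ 2) := by ring
    _ = _ := by rw [this, one_mul]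

theorem wsq_diag_wy (hD : D.Assumptions) (hS : D.StepRule) (r : Blk dY) :
    wsq D.wd (diag dY D.wy r) = wsq D.wy r := by
  refine Finset.sum_congr rfl fun j _ => ?_
  rw [diag_apply, norm_smul, mul_pow, Real.norm_eq_abs, sq_abs]
  have := hS.wy_mul_wd hD j
  calc _ = (D.wy j * D.wd j) * (D.wy j * ‖r j‖ ^ 2) := by ring
    _ = _ := by rw [this, one_mul]

theorem inner_diag_self {k : ℕ} {d : Fin k → ℕ} (w : Fin k → ℝ) (r : Blk d) :
    inner ℝ (diag d w r) r = wsq w r := by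
  rw [inner_eq_sum]
  refine Finset.sum_congr rfl fun j _ => ?_
  rw [diag_apply, real_inner_smul_left, real_inner_self_eq_norm_sq]

theorem wsq_smul {k : ℕ} {d : Fin k → ℕ} (w : Fin k → ℝ) (t : ℝ) (r : Blk d) :
    wsq w (t • r) = t ^ 2 * wsq w r := by
  simp only [wsq, Finset.mul_sum]
  refine Finset.sum_congr rfl fun j _ => ?_
  rw [PiLp.smul_apply, norm_smul, mul_pow, Real.norm_eq_abs, sq_abs]
  ring

theorem le_of_quadratic {R c d C : ℝ} (hc : 0 < c) (h : R ^ 2 / (4 * c) - d * R ≤ C) :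
    R ≤ 2 * c * d + 2 * c * √(d ^ 2 + C / c) := by
  have h1 : (R - 2 * c * d) ^ 2 ≤ (2 * c) ^ 2 * (d ^ 2 + C / c) := by
    have e : (2 * c) ^ 2 * (d ^ 2 + C / c) - (R - 2 * c * d) ^ 2
        = 4 * c * (C - (R ^ 2 / (4 * c) - d * R)) := by field_simp; ring
    have := mul_nonneg (by positivity : 0 ≤ 4 * c) (sub_nonneg.2 h)
    linarith
  have h2 := (le_abs_self _).trans (Real.abs_le_sqrt h1)
  rw [Real.sqrt_mul (sq_nonneg _), Real.sqrt_sq (by positivity)] at h2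
  linarith

/-! ### The constants of the residual bound -/

section Feasibility

variable (hD : D.Assumptions) (hS : D.StepRule) {zs : Blk dX × Blk dY} (hzs : D.IsKKT zs)
  {z₀ : Blk dX × Blk dY} (hx₀ : z₀.1 ∈ dom D.G)

include hD hS hzs hx₀

theorem wsq_dual_le :
    wsq D.wy (zs.2 - z₀.2) ≤ 2 * (D.Δ₀ z₀ zs / D.pmin) ∧
      wsq D.wy (zs.2 - z₀.2) ≤ 2 * D.pmin⁻¹ * D.V (z₀ - zs) := by
  obtain ⟨-, -, hXY⟩ := Δ₀_bounds hD hS hzs hx₀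
  have hX := wsq_nonneg (fun i => (hS.wx_pos i).le) (z₀.1 - zs.1)
  have hq := hS.pmin_pos
  rw [wsq_sub_comm]
  refine ⟨by linarith, ?_⟩
  have e : D.V (z₀ - zs) = D.pmin / 2 * wsq D.wx (z₀.1 - zs.1)
    + D.pmin / 2 * wsq D.wy (z₀.2 - zs.2) := rfl
  have e2 : 2 * D.pmin⁻¹ * D.V (z₀ - zs) = wsq D.wx (z₀.1 - zs.1) + wsq D.wy (z₀.2 - zs.2) := by
    rw [e]; field_simp
  linarith

variable (hy₀ : conj D.H z₀.2 ≠ ⊤)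

include hy₀

theorem le_Cf' : 2 * D.c₂ * wnorm D.wy (zs.2 - z₀.2)
      + 2 * D.c₂ * √(wnorm D.wy (zs.2 - z₀.2) ^ 2 + D.gapConst z₀ zs / D.c₂) ≤ D.Cf' z₀ zs := by
  have hc := hS.c₂_pos
  have hc1 := hS.c₁_nonneg hD
  have hC := gapConst_le_Cs hD hS hzs hx₀ hy₀
  unfold Cf'
  rw [sq_wnorm fun j => (hS.wy_pos hD j).le]
  have h1 : D.gapConst z₀ zs / D.c₂ ≤ D.Cs z₀ zs / D.c₂ := by gcongr
  have h2 : 0 ≤ 2 * D.c₁ / D.c₂ := by positivity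
  have h3 := mul_le_mul_of_nonneg_left (Real.sqrt_le_sqrt (by linarith :
    wsq D.wy (zs.2 - z₀.2) + D.gapConst z₀ zs / D.c₂
      ≤ wsq D.wy (zs.2 - z₀.2) + D.Cs z₀ zs / D.c₂ + 2 * D.c₁ / D.c₂))
    (by positivity : 0 ≤ 2 * D.c₂)
  linarith

theorem le_Cf : 2 * D.c₂ * wnorm D.wy (zs.2 - z₀.2)
      + 2 * D.c₂ * √(wnorm D.wy (zs.2 - z₀.2) ^ 2 + D.gapConst z₀ zs / D.c₂) ≤ D.Cf z₀ zs := by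
  have hc := hS.c₂_pos
  have hcc := hS.c₂_le_c
  have hq := hS.pmin_pos
  have hC := gapConst_le_Cs hD hS hzs hx₀ hy₀
  obtain ⟨-, hΔ, -⟩ := Δ₀_bounds hD hS hzs hx₀
  have hd0 := wnorm_nonneg D.wy (zs.2 - z₀.2)
  have hd2 := sq_wnorm (fun j => (hS.wy_pos hD j).le) (zs.2 - z₀.2)
  have hd := (wsq_dual_le hD hS hzs hx₀).1
  rw [← hd2] at hd
  set d := wnorm D.wy (zs.2 - z₀.2)
  have e : D.c₂ * √(d ^ 2 + D.gapConst z₀ zs / D.c₂)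
      = √(D.c₂ * (D.c₂ * d ^ 2 + D.gapConst z₀ zs)) := by
    nth_rewrite 1 [← Real.sqrt_sq hc.le]
    rw [← Real.sqrt_mul (sq_nonneg _)]
    congr 1
    field_simp
  have h2c : 0 ≤ 2 * √2 * D.c := by
    have : 0 ≤ D.c := hc.le.trans hcc
    positivity
  have hmono : √(D.c₂ * D.Cs z₀ zs) ≤ √(D.c * D.Cs z₀ zs) := by
    rcases le_total 0 (D.Cs z₀ zs) with h | h
    · exact Real.sqrt_le_sqrt (mul_le_mul_of_nonneg_right hcc h)
    · rw [Real.sqrt_eq_zero_of_nonpos (mul_nonpos_of_nonneg_of_nonpos hc.le h)]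
      exact Real.sqrt_nonneg _
  unfold Cf
  -- For N ≤ 1 one has c₂ ≤ c/2, so the two occurrences of c₂‖y⋆ - y₀‖ fit in the linear term of
  -- `Cf`. For N ≥ 1 the retained slack 4NΔ₀/p_min absorbs c₂‖y⋆ - y₀‖² ≤ 3Δ₀/p_min under the root.
  rcases le_total D.N2P 1 with hN | hN
  · have h1 : √(D.c₂ * (D.c₂ * d ^ 2 + D.gapConst z₀ zs)) ≤ D.c₂ * d + √(D.c₂ * D.Cs z₀ zs) := by
      have h2 : D.c₂ * (D.c₂ * d ^ 2 + D.gapConst z₀ zs)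
          ≤ (D.c₂ * d) ^ 2 + D.c₂ * D.Cs z₀ zs := by nlinarith
      refine Real.sqrt_le_iff.2 ⟨by positivity, h2.trans ?_⟩
      have h3 : D.c₂ * D.Cs z₀ zs ≤ √(D.c₂ * D.Cs z₀ zs) ^ 2 := by
        rcases le_total 0 (D.c₂ * D.Cs z₀ zs) with h | h
        · exact (Real.sq_sqrt h).ge
        · exact h.trans (sq_nonneg _)
      nlinarith [mul_nonneg (mul_nonneg hc.le hd0) (Real.sqrt_nonneg (D.c₂ * D.Cs z₀ zs))]
    have h4 : D.c₂ ≤ D.c / 2 := by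
      have := hS.c₂_le_of_N2P_le_one hN
      unfold c
      linarith
    have h5 := mul_le_mul_of_nonneg_right h4 hd0
    linarith
  · have h1 : D.c₂ * d ^ 2 + D.gapConst z₀ zs ≤ D.Cs z₀ zs := by
      have h2 := gapConst_add_le_Cs hD hS hzs hx₀ hy₀
      have hE : 0 ≤ D.Δ₀ z₀ zs / D.pmin := by positivity
      have e3 : 4 * D.Δ₀ z₀ zs / D.pmin = 4 * (D.Δ₀ z₀ zs / D.pmin) := by ring
      rw [e3] at h2
      have h3 := hS.c₂_le
      have h4 := mul_le_mul_of_nonneg_right h3 (sq_nonneg d)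
      nlinarith
    have h2 := Real.sqrt_le_sqrt (mul_le_mul_of_nonneg_left h1 hc.le)
    have h5 := mul_le_mul_of_nonneg_right hcc hd0
    linarith

end Feasibility

/-! ### Linear constraints -/

section Linear

variable (hD : D.Assumptions) {b : Blk dY} (hb : D.H b = 0) (hbt : ∀ y, y ≠ b → D.H y = ⊤)

include hb hbt

theorem conj_indicator (y : Blk dY) : conj D.H y = ((inner ℝ b y : ℝ) : EReal) := by
  refine le_antisymm (iSup_le fun w => ?_) ?_
  · by_cases hw : w = b
    · rw [hw, hb, sub_zero]
    · rw [hbt w hw, EReal.sub_top]; exact bot_le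
  · refine le_trans (le_of_eq ?_) (le_iSup (fun w => ((inner ℝ w y : ℝ) : EReal) - D.H w) b)
    rw [hb, sub_zero]

theorem hs_indicator (y : Blk dY) : D.hs y = inner ℝ b y := by
  rw [hs, conj_indicator hb hbt, EReal.toReal_coe]

include hD

/-- Here h* is the linear function ⟨b, ·⟩. Testing the subgradient inequality in the direction Ax⋆ -
b forces that vector to be zero. -/
theorem A_kkt_eq {zs : Blk dX × Blk dY} (hzs : D.IsKKT zs) : D.A zs.1 = b := by
  have hfin : ∀ y, conj D.H y ≠ ⊤ := fun y => by
    rw [conj_indicator hb hbt]; exact EReal.coe_ne_top _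
  have h := hs_add_inner_le hD hzs (hfin (zs.2 + (D.A zs.1 - b)))
  rw [hs_indicator hb hbt, hs_indicator hb hbt, inner_add_right, inner_add_left] at h
  have h2 : inner ℝ (D.A zs.1 - b) (D.A zs.1 - b) ≤ 0 := by
    have e : inner ℝ b (D.A zs.1 - b) = inner ℝ (D.A zs.1 - b) b := real_inner_comm _ _
    rw [inner_sub_right (D.A zs.1 - b)]
    linarith
  exact sub_eq_zero.1 (real_inner_self_nonpos.1 h2)

variable (hS : D.StepRule) {zs : Blk dX × Blk dY} (hzs : D.IsKKT zs)
  {z₀ : Blk dX × Blk dY} (hx₀ : z₀.1 ∈ dom D.G) (i₀ : Fin n) {K : ℕ} (hK : 1 ≤ K)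

include hS hzs hx₀ hK

theorem Ex_indicator_gap_le (y : (ℕ → Fin n) → Blk dY) :
    D.pmin * K * Ex D.p i₀ K (fun s => D.F (D.xav z₀ s K) - D.F zs.1
        + inner ℝ (y s) (D.A (D.xav z₀ s K) - b))
      ≤ D.gapConst z₀ zs + D.c₂ * Ex D.p i₀ K (fun s => wsq D.wy (y s - z₀.2)) := by
  have hfin : ∀ y, conj D.H y ≠ ⊤ := fun y => by
    rw [conj_indicator hb hbt]; exact EReal.coe_ne_top _
  have h := averaged_gap_le hD hS hzs hx₀ (hfin _) i₀ hK y fun s => hfin _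
  have e : ∀ s, D.F (D.xav z₀ s K) - D.F zs.1 + inner ℝ (y s) (D.A (D.xav z₀ s K) - b)
      = D.F (D.xav z₀ s K) - D.F zs.1 + (inner ℝ (y s) (D.A (D.xav z₀ s K)) - D.hs (y s))
        + (D.hs zs.2 - inner ℝ zs.2 (D.A zs.1)) := by
    intro s
    rw [A_kkt_eq hD hb hbt hzs, hs_indicator hb hbt, hs_indicator hb hbt, inner_sub_right,
      real_inner_comm (y s) b, real_inner_comm zs.2 b]
    ring
  simp only [e]
  exact h

theorem Ex_feasibility_le :
    D.pmin * K * Ex D.p i₀ K (fun s => wnorm D.wd (D.A (D.xav z₀ s K) - b))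
      ≤ 2 * D.c₂ * wnorm D.wy (zs.2 - z₀.2)
        + 2 * D.c₂ * √(wnorm D.wy (zs.2 - z₀.2) ^ 2 + D.gapConst z₀ zs / D.c₂) := by
  have hp := fun i => (hS.p_pos i).le
  have hc := hS.c₂_pos
  have hq := hS.pmin_pos
  have hK' : (0 : ℝ) < K := by exact_mod_cast hK
  have hwy := fun j => (hS.wy_pos hD j).le
  have hwd := fun j => (hS.wd_pos hD j).le
  set ρ : (ℕ → Fin n) → ℝ := fun s => wnorm D.wd (D.A (D.xav z₀ s K) - b) with hρ
  -- With residual r, the maximizer over y of p_min K⟨y, r⟩ - c₂‖y - y₀‖² is y₀ + aσπr, which yields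
  -- (p_min K)²‖r‖²/(4c₂). Optimality of x⋆ limits the loss to p_min K‖y⋆ - y₀‖‖r‖.
  set a : ℝ := D.pmin * K / (2 * D.c₂) with ha
  set d := wnorm D.wy (zs.2 - z₀.2) with hd
  refine le_of_quadratic hc ?_
  have h := Ex_indicator_gap_le hD hb hbt hS hzs hx₀ i₀ hK
    (fun s => z₀.2 + a • diag dY D.wd (D.A (D.xav z₀ s K) - b))
  have e1 : ∀ s, wsq D.wy (z₀.2 + a • diag dY D.wd (D.A (D.xav z₀ s K) - b) - z₀.2)
      = a ^ 2 * ρ s ^ 2 := by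
    intro s
    rw [add_sub_cancel_left, wsq_smul, wsq_diag_wd hD hS, hρ, sq_wnorm hwd]
  have e2 : ∀ s, -(d * ρ s) + a * ρ s ^ 2 ≤ D.F (D.xav z₀ s K) - D.F zs.1
      + inner ℝ (z₀.2 + a • diag dY D.wd (D.A (D.xav z₀ s K) - b)) (D.A (D.xav z₀ s K) - b) := by
    intro s
    have h1 := F_add_inner_le hD hzs (xav_mem_dom hD hS hzs hx₀ s hK).1
    rw [inner_At, map_sub, A_kkt_eq hD hb hbt hzs] at h1
    rw [inner_add_left, real_inner_smul_left, inner_diag_self, hρ, sq_wnorm hwd]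
    have h2 := (abs_le.1 (abs_inner_le_wnorm hwy hwd (hS.wy_mul_wd hD) (zs.2 - z₀.2)
      (D.A (D.xav z₀ s K) - b))).2
    rw [inner_sub_left] at h2
    simp only at h2 ⊢
    linarith
  simp only [e1] at h
  have h3 := mul_le_mul_of_nonneg_left (Ex_mono (p := D.p) (i₀ := i₀) (K := K) hp e2)
    (by positivity : 0 ≤ D.pmin * K)
  have e3 : Ex D.p i₀ K (fun s => -(d * ρ s) + a * ρ s ^ 2)
      = -d * Ex D.p i₀ K ρ + a * Ex D.p i₀ K (fun s => ρ s ^ 2) := by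
    rw [← Ex_const_mul, ← Ex_const_mul, ← Ex_add]
    congr 1
    funext s
    ring
  rw [e3] at h3
  rw [Ex_const_mul] at h
  -- Jensen's inequality turns the expected square into a quadratic inequality for the expected
  -- residual alone.
  have h4 := sq_Ex_le (i₀ := i₀) (K := K) hp hS.p_sum ρ
  have e4 : D.pmin * K = a * (2 * D.c₂) := by rw [ha]; field_simp
  have ha0 : 0 ≤ a := by rw [ha]; positivity
  rw [e4] at h3 h ⊢
  have e5 : (a * (2 * D.c₂) * Ex D.p i₀ K ρ) ^ 2 / (4 * D.c₂)
      = D.c₂ * a ^ 2 * Ex D.p i₀ K ρ ^ 2 := by field_simp; ring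
  rw [e5]
  have h5 := mul_le_mul_of_nonneg_left h4 (by positivity : 0 ≤ D.c₂ * a ^ 2)
  nlinarith

/-- With the constant choice y = y⋆, the term ⟨y⋆, Ax - b⟩ is removed by Cauchy–Schwarz and charged
to the expected residual. -/
theorem Ex_objective_le :
    D.pmin * K * Ex D.p i₀ K (fun s => D.F (D.xav z₀ s K) - D.F zs.1)
      ≤ D.gapConst z₀ zs + D.c₂ * wsq D.wy (zs.2 - z₀.2) + wnorm D.wy zs.2 *
        (D.pmin * K * Ex D.p i₀ K (fun s => wnorm D.wd (D.A (D.xav z₀ s K) - b))) := by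
  have hp := fun i => (hS.p_pos i).le
  have hq := hS.pmin_pos
  have hwy := fun j => (hS.wy_pos hD j).le
  have hwd := fun j => (hS.wd_pos hD j).le
  have h := Ex_indicator_gap_le hD hb hbt hS hzs hx₀ i₀ hK (fun _ => zs.2)
  rw [Ex_const hS.p_sum] at h
  have h1 := Ex_mono (p := D.p) (i₀ := i₀) (K := K) hp fun s =>
    (by
      have := (abs_le.1 (abs_inner_le_wnorm hwy hwd (hS.wy_mul_wd hD) zs.2
        (D.A (D.xav z₀ s K) - b))).1
      linarith : (D.F (D.xav z₀ s K) - D.F zs.1) -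
        wnorm D.wy zs.2 * wnorm D.wd (D.A (D.xav z₀ s K) - b)
        ≤ D.F (D.xav z₀ s K) - D.F zs.1 + inner ℝ zs.2 (D.A (D.xav z₀ s K) - b))
  rw [Ex_sub, Ex_const_mul] at h1
  have h2 := mul_le_mul_of_nonneg_left h1 (by positivity : 0 ≤ D.pmin * K)
  linarith

end Linear

/-! ### Lipschitz penalties -/

section Lipschitz

variable (hD : D.Assumptions) (hS : D.StepRule) {L : ℝ} (hL : 0 ≤ L)
  (hlip : ∀ u v, D.H u ≤ D.H v + ((L * wnorm D.wd (u - v) : ℝ) : EReal))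

include hD hlip

theorem H_ne_top (u : Blk dY) : D.H u ≠ ⊤ := by
  obtain ⟨w, hw⟩ := hD.exists_H_ne_top
  intro h
  have := hlip u w
  rw [h, ← EReal.coe_toReal hw (hD.H_ne_bot w), ← EReal.coe_add, top_le_iff] at this
  exact EReal.coe_ne_top _ this

theorem toReal_H_le (u v : Blk dY) :
    (D.H u).toReal ≤ (D.H v).toReal + L * wnorm D.wd (u - v) := by
  have := hlip u v
  rwa [← EReal.coe_toReal (H_ne_top hD hlip u) (hD.H_ne_bot u),
    ← EReal.coe_toReal (H_ne_top hD hlip v) (hD.H_ne_bot v), ← EReal.coe_add,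
    EReal.coe_le_coe_iff] at this

/-- An affine minorant of h that equals h(v) - ε at v has a slope that is almost optimal in the
biconjugate formula; attainment of the supremum is not needed. -/
theorem exists_approx_subgradient (v : Blk dY) {ε : ℝ} (hε : 0 < ε) :
    ∃ y, conj D.H y ≠ ⊤ ∧ (D.H v).toReal - ε ≤ inner ℝ y v - D.hs y := by
  have hdom : dom D.H = Set.univ := Set.eq_univ_of_forall (H_ne_top hD hlip)
  have hconv := convexOn_toReal hD.H_ne_bot hD.H_convex
  rw [hdom] at hconv
  have hlsc : LowerSemicontinuousOn (fun u => (D.H u).toReal) Set.univ := by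
    have h1 : LowerSemicontinuous D.H :=
      lowerSemicontinuous_sep (fun j => (hD.h_pcc j).ne_bot) fun j => (hD.h_pcc j).lsc
    intro u _ a ha
    have h2 : (a : EReal) < D.H u := by
      rw [← EReal.coe_toReal (H_ne_top hD hlip u) (hD.H_ne_bot u)]
      exact EReal.coe_lt_coe_iff.2 ha
    rw [nhdsWithin_univ]
    filter_upwards [h1 u _ h2] with x hx
    rw [← EReal.coe_toReal (H_ne_top hD hlip x) (hD.H_ne_bot x)] at hx
    exact EReal.coe_lt_coe_iff.1 hx
  obtain ⟨l, c, hl, hlv⟩ := hconv.exists_affine_le_of_lt (𝕜 := ℝ) (Set.mem_univ v)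
    (sub_lt_self _ hε) isClosed_univ hlsc
  set y := (InnerProductSpace.toDual ℝ (Blk dY)).symm l with hy
  have hyl : ∀ u, inner ℝ y u = l u := fun u => InnerProductSpace.toDual_symm_apply
  have hle : conj D.H y ≤ ((-c : ℝ) : EReal) := by
    refine conj_le_coe hD.H_ne_bot fun w _ => ?_
    have h1 : l w + c ≤ (D.H w).toReal := hl ⟨w, Set.mem_univ w⟩
    rw [real_inner_comm, hyl]
    linarith
  refine ⟨y, (hle.trans_lt (EReal.coe_lt_top _)).ne, ?_⟩
  have h2 := EReal.toReal_le_toReal hle (hD.conj_H_ne_bot y) (EReal.coe_ne_top _)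
  rw [EReal.toReal_coe] at h2
  have h3 : l v + c = (D.H v).toReal - ε := hlv
  rw [hyl]
  unfold hs
  linarith

include hS hL

/-- Fenchel's inequality is tested along the ray dual to y: if a = ‖y‖ > L, then ta(a - L) would
stay bounded as t grows. -/
theorem wnorm_le_of_conj_ne_top {y : Blk dY} (hy : conj D.H y ≠ ⊤) : wnorm D.wy y ≤ L := by
  have hwy := fun j => (hS.wy_pos hD j).le
  set a := wnorm D.wy y with ha
  have ha0 : 0 ≤ a := wnorm_nonneg _ _
  by_contra! hc
  have h1 : ∀ t : ℝ, 0 < t → t * (a * (a - L)) ≤ D.hs y + (D.H 0).toReal := by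
    intro t ht
    have h2 := inner_le_conj_add hD.H_ne_bot (H_ne_top hD hlip (t • diag dY D.wy y)) hy
    have h3 := toReal_H_le hD hlip (t • diag dY D.wy y) 0
    rw [real_inner_smul_left, inner_diag_self, ← sq_wnorm hwy, ← ha] at h2
    have h4 : wnorm D.wd (t • diag dY D.wy y - 0) = t * a := by
      rw [sub_zero, ha]
      unfold wnorm
      rw [wsq_smul, wsq_diag_wy hD hS, Real.sqrt_mul (sq_nonneg t), Real.sqrt_sq ht.le]
    rw [h4] at h3
    unfold hs
    nlinarith
  have hpos : 0 < a * (a - L) := mul_pos (hL.trans_lt hc) (sub_pos.2 hc)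
  have h5 := h1 ((|D.hs y + (D.H 0).toReal| + 1) / (a * (a - L))) (by positivity)
  rw [div_mul_cancel₀ _ hpos.ne'] at h5
  linarith [le_abs_self (D.hs y + (D.H 0).toReal)]

variable {zs : Blk dX × Blk dY} (hzs : D.IsKKT zs)
  {z₀ : Blk dX × Blk dY} (hx₀ : z₀.1 ∈ dom D.G) (hy₀ : conj D.H z₀.2 ≠ ⊤)
  (i₀ : Fin n) {K : ℕ} (hK : 1 ≤ K)

include hzs hx₀ hy₀ hK

/-- The test point y is an almost-subgradient of h at the averaged point. Both y and y₀ lie in the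
ball of radius L, so ‖y - y₀‖² ≤ 4L². -/
theorem Ex_lipschitz_gap_le :
    D.pmin * K * Ex D.p i₀ K (fun s => D.F (D.xav z₀ s K) + (D.H (D.A (D.xav z₀ s K))).toReal
        - D.F zs.1 - (D.H (D.A zs.1)).toReal)
      ≤ D.gapConst z₀ zs + 4 * D.c₂ * L ^ 2 := by
  have hp := fun i => (hS.p_pos i).le
  have hq := hS.pmin_pos
  have hc := hS.c₂_pos
  have hK' : (0 : ℝ) < K := by exact_mod_cast hK
  have hwy := fun j => (hS.wy_pos hD j).le
  have hys : conj D.H zs.2 ≠ ⊤ := mem_dom_of_mem_subdiff hzs.2 hy₀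
  refine le_of_forall_pos_le_add fun ε hε => ?_
  have hε' : 0 < ε / (D.pmin * K) := by positivity
  choose y hy1 hy2 using fun s : ℕ → Fin n =>
    exists_approx_subgradient hD hlip (D.A (D.xav z₀ s K)) hε'
  have h := averaged_gap_le hD hS hzs hx₀ hy₀ i₀ hK y hy1
  have h1 : Ex D.p i₀ K (fun s => wsq D.wy (y s - z₀.2)) ≤ 4 * L ^ 2 := by
    rw [← Ex_const (p := D.p) (i₀ := i₀) (K := K) hS.p_sum (4 * L ^ 2)]
    refine Ex_mono hp fun s => ?_
    have h2 := wnorm_sub_le hwy (y s) z₀.2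
    have h3 := wnorm_le_of_conj_ne_top hD hS hL hlip (hy1 s)
    have h4 := wnorm_le_of_conj_ne_top hD hS hL hlip hy₀
    rw [← sq_wnorm hwy]
    nlinarith [wnorm_nonneg D.wy (y s - z₀.2)]
  have h2 := Ex_mono (p := D.p) (i₀ := i₀) (K := K) hp fun s =>
    (by
      have h3 := inner_le_conj_add hD.H_ne_bot (H_ne_top hD hlip (D.A zs.1)) hys
      rw [real_inner_comm] at h3
      have h4 := hy2 s
      unfold hs at h4 ⊢
      linarith : (D.F (D.xav z₀ s K) + (D.H (D.A (D.xav z₀ s K))).toReal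
        - D.F zs.1 - (D.H (D.A zs.1)).toReal) - ε / (D.pmin * K)
        ≤ D.F (D.xav z₀ s K) - D.F zs.1
        + (inner ℝ (y s) (D.A (D.xav z₀ s K)) - D.hs (y s))
        + (D.hs zs.2 - inner ℝ zs.2 (D.A zs.1)))
  have e6 := Ex_sub (p := D.p) (i₀ := i₀) (K := K) (fun s => D.F (D.xav z₀ s K)
    + (D.H (D.A (D.xav z₀ s K))).toReal - D.F zs.1 - (D.H (D.A zs.1)).toReal)
    fun _ => ε / (D.pmin * K)
  rw [Ex_const hS.p_sum] at e6
  rw [e6] at h2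
  have h5 := mul_le_mul_of_nonneg_left h2 (by positivity : 0 ≤ D.pmin * K)
  have h6 := mul_le_mul_of_nonneg_left h1 hc.le
  have e : D.pmin * K * (ε / (D.pmin * K)) = ε := by field_simp
  rw [mul_sub, e] at h5
  linarith

end Lipschitz

end Data

end PureCD

theorem theorem4 {n m : ℕ} {dX : Fin n → ℕ} {dY : Fin m → ℕ} (D : PureCD.Data dX dY)
    (hD : D.Assumptions) (hS : D.StepRule)
    (zs : PureCD.Blk dX × PureCD.Blk dY) (hzs : D.IsKKT zs)
    (z₀ : PureCD.Blk dX × PureCD.Blk dY) (hx₀ : z₀.1 ∈ PureCD.dom D.G)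
    {Ω : Type*} [MeasurableSpace Ω] (μ : Measure Ω) [IsProbabilityMeasure μ]
    (idx : ℕ → Ω → Fin n) (hmeas : ∀ k, Measurable (idx k)) (hindep : iIndepFun idx μ)
    (hlaw : ∀ k i, μ.real (idx k ⁻¹' {i}) = D.p i)
    (K : ℕ) (hK : 1 ≤ K)
    (X : Ω → PureCD.Blk dX) (hX : ∀ ω, X ω = D.xav z₀ (fun k => idx k ω) K) :
    (∀ ω, X ω ∈ PureCD.dom D.G) ∧
    -- linear constraints: `h` is the indicator function of `{b}`
    (∀ b : PureCD.Blk dY, D.H b = 0 → (∀ y, y ≠ b → D.H y = ⊤) →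
      Integrable (fun ω => D.F (X ω)) μ ∧
      ∫ ω, (D.F (X ω) - D.F zs.1) ∂μ ≤ D.Co z₀ zs / (D.pmin * K) ∧
      ∫ ω, (D.F (X ω) - D.F zs.1) ∂μ ≤ D.Co' z₀ zs / (D.pmin * K) ∧
      Integrable (fun ω => ‖D.A (X ω) - b‖) μ ∧
      Integrable (fun ω => PureCD.wnorm D.wd (D.A (X ω) - b)) μ ∧
      ∫ ω, PureCD.wnorm D.wd (D.A (X ω) - b) ∂μ ≤ D.Cf z₀ zs / (D.pmin * K) ∧
      ∫ ω, PureCD.wnorm D.wd (D.A (X ω) - b) ∂μ ≤ D.Cf' z₀ zs / (D.pmin * K) ∧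
      ∫ ω, ‖D.A (X ω) - b‖ ∂μ ≤ D.Cf z₀ zs / √(⨅ j, D.wd j) / (D.pmin * K) ∧
      ∫ ω, ‖D.A (X ω) - b‖ ∂μ ≤ D.Cf' z₀ zs / √(⨅ j, D.wd j) / (D.pmin * K)) ∧
    -- `h` is Lipschitz
    (z₀.2 ∈ PureCD.dom (PureCD.conj D.H) → ∀ L : ℝ, 0 ≤ L →
      -- for the norm weighted by `σπ`
      ((∀ u v, D.H u ≤ D.H v + ((L * PureCD.wnorm D.wd (u - v) : ℝ) : EReal)) →
        Integrable (fun ω => D.F (X ω) + (D.H (D.A (X ω))).toReal) μ ∧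
        ∫ ω, (D.F (X ω) + (D.H (D.A (X ω))).toReal
            - D.F zs.1 - (D.H (D.A zs.1)).toReal) ∂μ ≤ D.Cl z₀ zs L / (D.pmin * K) ∧
        ∫ ω, (D.F (X ω) + (D.H (D.A (X ω))).toReal
            - D.F zs.1 - (D.H (D.A zs.1)).toReal) ∂μ ≤ D.Cl' z₀ zs L / (D.pmin * K)) ∧
      -- for the Euclidean norm
      ((∀ u v, D.H u ≤ D.H v + ((L * ‖u - v‖ : ℝ) : EReal)) →
        Integrable (fun ω => D.F (X ω) + (D.H (D.A (X ω))).toReal) μ ∧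
        ∫ ω, (D.F (X ω) + (D.H (D.A (X ω))).toReal
            - D.F zs.1 - (D.H (D.A zs.1)).toReal) ∂μ
              ≤ D.Cl z₀ zs (L / √(⨅ j, D.wd j)) / (D.pmin * K) ∧
        ∫ ω, (D.F (X ω) + (D.H (D.A (X ω))).toReal
            - D.F zs.1 - (D.H (D.A zs.1)).toReal) ∂μ
              ≤ D.Cl' z₀ zs (L / √(⨅ j, D.wd j)) / (D.pmin * K))) := by
  obtain ⟨i₀⟩ := hS.nonempty
  have hq := hS.pmin_pos
  have hK' : (0 : ℝ) < K := by exact_mod_cast hK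
  have hqK : 0 < D.pmin * K := mul_pos hq hK'
  have hwx := fun i => (hS.wx_pos i).le
  have hwy := fun j => (hS.wy_pos hD j).le
  have hX' : X = fun ω => D.xav z₀ (fun k => idx k ω) K := funext hX
  subst hX'
  -- The average takes finitely many values, so every function of it is integrable without any
  -- measurability hypothesis.
  have hE : ∀ Ψ : PureCD.Blk dX → ℝ,
      Integrable (fun ω => Ψ (D.xav z₀ (fun k => idx k ω) K)) μ ∧
      ∫ ω, Ψ (D.xav z₀ (fun k => idx k ω) K) ∂μ
        = PureCD.Ex D.p i₀ K (fun s => Ψ (D.xav z₀ s K)) := fun Ψ =>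
    PureCD.integral_eq_Ex hmeas hindep hlaw i₀
      (Φ := fun s => Ψ (D.xav z₀ s K)) fun s s' h => congrArg Ψ (D.dependsOnFirst_xav z₀ K s s' h)
  refine ⟨fun ω => (PureCD.Data.xav_mem_dom hD hS hzs hx₀ _ hK).1, ?_, ?_⟩
  · intro b hb hbt
    -- The conjugate of an indicator of a point is finite everywhere, so any y₀ is admissible.
    have hy₀ : PureCD.conj D.H z₀.2 ≠ ⊤ := by
      rw [PureCD.Data.conj_indicator hb hbt]; exact EReal.coe_ne_top _
    have hR := PureCD.Data.Ex_feasibility_le hD hb hbt hS hzs hx₀ i₀ hK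
    have hO := PureCD.Data.Ex_objective_le hD hb hbt hS hzs hx₀ i₀ hK
    have hCf := hR.trans (PureCD.Data.le_Cf hD hS hzs hx₀ hy₀)
    have hCf' := hR.trans (PureCD.Data.le_Cf' hD hS hzs hx₀ hy₀)
    have hC := PureCD.Data.gapConst_le_Cs hD hS hzs hx₀ hy₀
    have hys := PureCD.wnorm_nonneg D.wy zs.2
    have hd0 := PureCD.wsq_nonneg hwy (zs.2 - z₀.2)
    obtain ⟨hFi, -⟩ := hE D.F
    obtain ⟨-, hFe⟩ := hE fun x => D.F x - D.F zs.1
    obtain ⟨hni, -⟩ := hE fun x => ‖D.A x - b‖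
    obtain ⟨hwi, hwe⟩ := hE fun x => PureCD.wnorm D.wd (D.A x - b)
    have hf : ∫ ω, PureCD.wnorm D.wd (D.A (D.xav z₀ (fun k => idx k ω) K) - b) ∂μ
        ≤ D.Cf z₀ zs / (D.pmin * K) := by
      rw [hwe, le_div_iff₀ hqK, mul_comm]; exact hCf
    have hf' : ∫ ω, PureCD.wnorm D.wd (D.A (D.xav z₀ (fun k => idx k ω) K) - b) ∂μ
        ≤ D.Cf' z₀ zs / (D.pmin * K) := by
      rw [hwe, le_div_iff₀ hqK, mul_comm]; exact hCf'
    have hn : ∫ ω, ‖D.A (D.xav z₀ (fun k => idx k ω) K) - b‖ ∂μ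
        ≤ (∫ ω, PureCD.wnorm D.wd (D.A (D.xav z₀ (fun k => idx k ω) K) - b) ∂μ)
          / √(⨅ j, D.wd j) := by
      rw [← integral_div]
      exact integral_mono hni (hwi.div_const _) fun ω => PureCD.Data.norm_le_wnorm_div hD hS _
    refine ⟨hFi, ?_, ?_, hni, hwi, hf, hf', hn.trans ?_, hn.trans ?_⟩
    · rw [hFe, le_div_iff₀ hqK, mul_comm]
      have h1 := mul_le_mul_of_nonneg_left hCf hys
      have h2 := (PureCD.Data.wsq_dual_le hD hS hzs hx₀ (z₀ := z₀)).2
      have h3 := mul_le_mul_of_nonneg_right hS.c₂_le_c hd0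
      have h4 := mul_le_mul_of_nonneg_left h2 (hS.c₂_pos.le.trans hS.c₂_le_c)
      unfold PureCD.Data.Co
      linarith
    · rw [hFe, le_div_iff₀ hqK, mul_comm]
      have h1 := mul_le_mul_of_nonneg_left hCf' hys
      have h2 := mul_nonneg (hS.c₁_nonneg hD) (PureCD.wsq_nonneg hwx (z₀.1 - zs.1))
      unfold PureCD.Data.Co'
      linarith
    · rw [div_right_comm]
      exact div_le_div_of_nonneg_right hf (Real.sqrt_nonneg _)
    · rw [div_right_comm]
      exact div_le_div_of_nonneg_right hf' (Real.sqrt_nonneg _)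
  · intro hy₀ L hL
    have key : ∀ L : ℝ, 0 ≤ L →
        (∀ u v, D.H u ≤ D.H v + ((L * PureCD.wnorm D.wd (u - v) : ℝ) : EReal)) →
        Integrable (fun ω => D.F (D.xav z₀ (fun k => idx k ω) K)
          + (D.H (D.A (D.xav z₀ (fun k => idx k ω) K))).toReal) μ ∧
        ∫ ω, (D.F (D.xav z₀ (fun k => idx k ω) K)
            + (D.H (D.A (D.xav z₀ (fun k => idx k ω) K))).toReal
            - D.F zs.1 - (D.H (D.A zs.1)).toReal) ∂μ ≤ D.Cl z₀ zs L / (D.pmin * K) ∧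
        ∫ ω, (D.F (D.xav z₀ (fun k => idx k ω) K)
            + (D.H (D.A (D.xav z₀ (fun k => idx k ω) K))).toReal
            - D.F zs.1 - (D.H (D.A zs.1)).toReal) ∂μ ≤ D.Cl' z₀ zs L / (D.pmin * K) := by
      intro L hL hlip
      have hG := PureCD.Data.Ex_lipschitz_gap_le hD hS hL hlip hzs hx₀ hy₀ i₀ hK
      have hC := PureCD.Data.gapConst_le_Cs hD hS hzs hx₀ hy₀
      have hx := PureCD.wsq_nonneg hwx (zs.1 - z₀.1)
      obtain ⟨hi, -⟩ := hE fun x => D.F x + (D.H (D.A x)).toReal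
      obtain ⟨-, he⟩ := hE fun x =>
        D.F x + (D.H (D.A x)).toReal - D.F zs.1 - (D.H (D.A zs.1)).toReal
      refine ⟨hi, ?_, ?_⟩
      · rw [he, le_div_iff₀ hqK, mul_comm]
        have h1 := mul_le_mul_of_nonneg_right hS.c₂_le_c (sq_nonneg L)
        have h2 := mul_nonneg (hS.c₂_pos.le.trans hS.c₂_le_c) hx
        unfold PureCD.Data.Cl
        linarith
      · rw [he, le_div_iff₀ hqK, mul_comm]
        have h2 := mul_nonneg (hS.c₁_nonneg hD) hx
        unfold PureCD.Data.Cl'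
        linarith
    -- The Euclidean case reduces to the weighted one through norm equivalence with constant (minⱼ
    -- σⱼπⱼ)^{-1/2}.
    refine ⟨key L hL, fun hlip => key _ (div_nonneg hL (Real.sqrt_nonneg _)) fun u v => ?_⟩
    refine (hlip u v).trans (add_le_add_right (EReal.coe_le_coe_iff.2 ?_) _)
    calc L * ‖u - v‖ ≤ L * (PureCD.wnorm D.wd (u - v) / √(⨅ j, D.wd j)) :=
          mul_le_mul_of_nonneg_left (PureCD.Data.norm_le_wnorm_div hD hS _) hL
      _ = _ := by ring
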